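/- Let $B\subset\mathbb{R}^3$ be a Platonic solid, that is, a convex polytope with nonempty interior whose two-dimensional faces are congruent regular polygons, the same number of them meeting at every vertex. Let $O$ be the center of the sphere in which $B$ is inscribed (all vertices of $B$ lie on a sphere with center $O$). Define the following sets of segments: - $\mathcal{S}$: the segments joining $O$ with the vertices of $B$; - $\mathcal{O}$: the segments joining $O$ with the centers of the faces of $B$; - $\mathcal{E}$: the edges of $B$; - $\mathcal{D}$: the segments joining the center of each face of $B$ with the vertices of that face. For $U\subset\mathbb{R}^3$ of dimension $d\in\{1,2,3\}$ let $\operatorname{Avg}(f,U)=\frac{1}{|U|}\int_U f$, where the integral and $|U|$ are taken with respect to the $d$-dimensional measure (length, area, volume); for a family of segments, $\operatorname{Avg}(f,\cdot)$ is the average with respect to length over the union of the segments. Let $h_O^{3/4}(\mathbf{x})=O+\frac34(\mathbf{x}-O)$, and let $\partial$ denote the boundary. Let $f\colon B\to\mathbb{R}$ be a function whose restriction to every (solid) pyramid with a face of $B$ as its base and $O$ as its apex is convex. Then $f$ is integrable over each of the sets $B$, $\partial B$, $\partial h_O^{3/4}(B)$ and over the unions of the families $\mathcal{O},\mathcal{E},\mathcal{S},\mathcal{D}$,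 and $$\operatorname{Avg}(f,B)\le \tfrac14 f(O)+\tfrac34\operatorname{Avg}(f,\partial B),$$ $$\operatorname{Avg}(f,B)\le \tfrac12\operatorname{Avg}(f,\mathcal{O})+\tfrac12\operatorname{Avg}(f,\mathcal{E}),$$ $$\operatorname{Avg}(f,B)\le \tfrac12\operatorname{Avg}(f,\mathcal{S})+\tfrac12\operatorname{Avg}(f,\mathcal{D}),$$ $$\operatorname{Avg}(f,\partial h_O^{3/4}(B))\le \operatorname{Avg}(f,B).$$ -/

import Mathlib

open MeasureTheory

/-- Euclidean three-space. -/
abbrev E3 : Type := EuclideanSpace ℝ (Fin 3)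

namespace Platonic

/-- `F` is a `k`-dimensional face of the convex body `B`: the set of all maximizers over `B` of
some linear functional, with an affine hull of dimension `k`. -/
def IsFace (k : ℕ) (B F : Set E3) : Prop :=
  F.Nonempty ∧ IsExposed ℝ B F ∧ Module.finrank ℝ (vectorSpan ℝ F) = k

/-- `F` is a (solid, planar) regular `n`-gon with center `c` and circumradius `r`; the orthonormal
vectors `u`, `v` span the direction of its plane. -/
def IsRegularPolygon (n : ℕ) (r : ℝ) (c : E3) (F : Set E3) : Prop :=
  3 ≤ n ∧ 0 < r ∧ ∃ u v : E3, ‖u‖ = 1 ∧ ‖v‖ = 1 ∧ inner ℝ u v = 0 ∧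
    F = convexHull ℝ (Set.range fun k : Fin n =>
      c + (r * Real.cos (2 * Real.pi * (k : ℕ) / n)) • u
        + (r * Real.sin (2 * Real.pi * (k : ℕ) / n)) • v)

/-- `c` is the center of the regular polygon `F`. -/
def IsCenter (c : E3) (F : Set E3) : Prop :=
  ∃ (n : ℕ) (r : ℝ), IsRegularPolygon n r c F

/-- A Platonic solid: a convex polytope with nonempty interior in three-space whose two-dimensional
faces are congruent regular polygons (same number of sides, same circumradius), with the same
number of them meeting at every vertex. -/
structure IsPlatonicSolid (B : Set E3) : Prop where
  isPolytope : ∃ V : Set E3, V.Finite ∧ B = convexHull ℝ V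
  interior_nonempty : (interior B).Nonempty
  congruent_regular_faces : ∃ (n : ℕ) (r : ℝ), ∀ F : Set E3, IsFace 2 B F →
    ∃ c : E3, IsRegularPolygon n r c F
  equal_vertex_degrees : ∃ q : ℕ, ∀ v ∈ B.extremePoints ℝ,
    {F : Set E3 | IsFace 2 B F ∧ v ∈ F}.ncard = q

/-- The pyramid with base `F` and apex `O`. -/
def pyramid (O : E3) (F : Set E3) : Set E3 := convexHull ℝ (insert O F)

/-- The segments joining `O` with the vertices of `B`. -/
def segmentsToVertices (O : E3) (B : Set E3) : Set (Set E3) :=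
  {s | ∃ v ∈ B.extremePoints ℝ, s = segment ℝ O v}

/-- The segments joining `O` with the centers of the faces of `B`. -/
def segmentsToCenters (O : E3) (B : Set E3) : Set (Set E3) :=
  {s | ∃ (F : Set E3) (c : E3), IsFace 2 B F ∧ IsCenter c F ∧ s = segment ℝ O c}

/-- The edges of `B`. -/
def edges (B : Set E3) : Set (Set E3) := {s | IsFace 1 B s}

/-- The segments joining the centers of the faces of `B` with the vertices of these faces. -/
def segmentsCenterToVertex (B : Set E3) : Set (Set E3) :=
  {s | ∃ (F : Set E3) (c v : E3), IsFace 2 B F ∧ IsCenter c F ∧ v ∈ F.extremePoints ℝ ∧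
    s = segment ℝ c v}

/-- The average of `f` over the `d`-dimensional set `U`, with respect to `d`-dimensional
Hausdorff measure normalized so as to be length, area and volume for `d = 1, 2, 3`. -/
noncomputable def Avg (d : ℕ) (f : E3 → ℝ) (U : Set E3) : ℝ :=
  (μHE[d].real U)⁻¹ * ∫ x in U, f x ∂μHE[d]

/-- In dimension three the measure above is the Lebesgue measure. -/
theorem avg_three (f : E3 → ℝ) (U : Set E3) :
    Avg 3 f U = (volume.real U)⁻¹ * ∫ x in U, f x := by
  rw [Avg, EuclideanSpace.euclideanHausdorffMeasure_eq_volume]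

end Platonic

/-! The vertices of every face lie on the sphere about `O`, so the center of a face is the foot of
the perpendicular from `O`. As all faces have the same circumradius `r`, all centers have the same
squared distance `H = R² - r²` from `O`. For a face with center `c` and a side with endpoints `p`,
`q`, the simplex `O c p q` is therefore congruent to one reference simplex depending only on `n`,
`r`, `H`. These flag simplices tile `B`. No symmetry group of `B` is needed, only the congruence of
the flags.

Each set in the statement is a union of copies of one piece of the reference simplex: the whole
simplex, the face opposite the apex (or its image under the homothety), or one of four edges. Almost
every point of such a union is covered by the same number of flags: 1 for solids, surfaces and
center–vertex segments, `n` for the segments from `O` to face centers, 2 for the edges of `B`, and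
the vertex degree for the segments from `O` to the vertices. The multiplicity cancels in the average
(`avg_iUnion_image`), so every average of `f` equals the average, over the corresponding piece, of
the single function `symmetrize ι f`, which is convex on the reference simplex. The theorem thus
reduces to inequalities for a convex function on one simplex.

For the first and the last inequality, cut the simplex by planes parallel to the face opposite the
apex. The integral over the slice at height `t`, in the coordinates of the base, is a convex
function of `t`, and the average over the simplex is a mean for the density `3t²` on `[0,1]`, whose
expectation is `3/4`. Bounding the convex function by its chord gives the weights `1/4` and `3/4`
(`avg_tetrahedron_le_cone`); Jensen's inequality at `3/4` gives the homothety bound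
(`avg_homothety_le_avg_tetrahedron`). For the two middle inequalities, cut by planes parallel to two
opposite edges: each interior point lies on a segment joining the two edges, and convexity on that
segment gives the bound (`avg_tetrahedron_le_join`). The two choices of opposite edges give the two
inequalities. -/

namespace Platonic

open Module

/-! ### Hausdorff measure and averages under injective affine parametrizations -/

theorem measure_hyperplane {V : Type*} [NormedAddCommGroup V] [NormedSpace ℝ V]
    [MeasurableSpace V] [BorelSpace V] [FiniteDimensional ℝ V] (ν : Measure V)
    [ν.IsAddHaarMeasure] {l : V →ₗ[ℝ] ℝ} (hl : l ≠ 0) (b : ℝ) : ν {x | l x = b} = 0 := by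
  by_cases h : ∃ x0, l x0 = b
  · obtain ⟨x0, hx0⟩ := h
    have hs : {x | l x = b} = (AffineSubspace.mk' x0 (LinearMap.ker l) : Set V) := by
      ext x
      simp [AffineSubspace.mem_mk', hx0, sub_eq_zero]
    rw [hs]
    refine Measure.addHaar_affineSubspace ν _ fun h => hl ?_
    have := congrArg AffineSubspace.direction h
    rw [AffineSubspace.direction_mk', AffineSubspace.direction_top] at this
    exact LinearMap.ker_eq_top.mp this
  · have hs : {x | l x = b} = ∅ := Set.eq_empty_of_forall_notMem fun x hx => h ⟨x, hx⟩
    rw [hs, measure_empty]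

section Image

variable {V : Type*} [NormedAddCommGroup V] [NormedSpace ℝ V] [MeasurableSpace V] [BorelSpace V]
  [FiniteDimensional ℝ V] (ν : Measure V) [ν.IsAddHaarMeasure] {ψ : V →ᵃ[ℝ] E3}

theorem measurableEmbedding_affine (hψ : Function.Injective ψ) : MeasurableEmbedding ψ := by
  have hl : Function.Injective ψ.linear := ψ.linear_injective_iff.mpr hψ
  have h1 : Topology.IsClosedEmbedding ψ.linear :=
    LinearMap.isClosedEmbedding_of_injective (LinearMap.ker_eq_bot.mpr hl)
  have h2 : (ψ : V → E3) = (Homeomorph.addRight (ψ 0)) ∘ ψ.linear := by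
    ext1 x
    exact congrFun ψ.decomp x
  rw [h2]
  exact ((Homeomorph.addRight (ψ 0)).isClosedEmbedding.comp h1).measurableEmbedding

/-- In Euclidean coordinates the linear part of `ψ` scales Hausdorff measure by `normDet`, and two
Haar measures differ by a positive factor. The value of `κ` is irrelevant, since it cancels from
averages; it only has to be nonzero and finite. -/
theorem exists_measure_image_affine (hψ : Function.Injective ψ) {d : ℕ} (hd : finrank ℝ V = d) :
    ∃ κ : ENNReal, κ ≠ 0 ∧ κ ≠ ⊤ ∧ ∀ S : Set V, μHE[d] (ψ '' S) = κ * ν S := by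
  have hl : Function.Injective ψ.linear := ψ.linear_injective_iff.mpr hψ
  let E : V ≃L[ℝ] EuclideanSpace ℝ (Fin d) :=
    ContinuousLinearEquiv.ofFinrankEq (by simp [hd])
  let g : EuclideanSpace ℝ (Fin d) →ₗ[ℝ] E3 := ψ.linear ∘ₗ (E.symm : _ →ₗ[ℝ] V)
  have hg : Function.Injective g := hl.comp E.symm.injective
  have hg0 : g.normDet ≠ 0 := ((g.normDet_ne_zero_tfae).out 0 1).mpr (LinearMap.ker_eq_bot.mpr hg)
  have hm : (ν.map E).IsAddHaarMeasure := E.isAddHaarMeasure_map ν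
  have hv : (volume : Measure (EuclideanSpace ℝ (Fin d))) =
      Measure.addHaarScalarFactor volume (ν.map E) • ν.map E :=
    Measure.isAddLeftInvariant_eq_smul _ _
  have hc := Measure.addHaarScalarFactor_pos_of_isAddHaarMeasure
    (volume : Measure (EuclideanSpace ℝ (Fin d))) (ν.map E)
  refine ⟨ENNReal.ofReal g.normDet * Measure.addHaarScalarFactor volume (ν.map E),
    mul_ne_zero ?_ (by simpa using hc.ne'), ENNReal.mul_ne_top (by simp) (by simp), fun S => ?_⟩
  · have := g.normDet_nonneg
    simpa using lt_of_le_of_ne this hg0.symm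
  · have h2 : ψ '' S = (IsometryEquiv.addRight (ψ 0)) '' (g '' (E '' S)) := by
      simp only [Set.image_image]
      refine Set.image_congr fun x _ => ?_
      simpa [g] using congrFun ψ.decomp x
    have h3 := g.euclideanHausdorffMeasure_image_eq_normDet_mul_volume (E '' S)
    rw [finrank_euclideanSpace_fin] at h3
    rw [h2, (IsometryEquiv.isometry _).euclideanHausdorffMeasure_image, h3, mul_assoc]
    have h4 : (ν.map E) (E '' S) = ν S := by
      have := E.toHomeomorph.toMeasurableEquiv.map_apply (μ := ν) (E '' S)
      simp only [Homeomorph.toMeasurableEquiv_coe, ContinuousLinearEquiv.coe_toHomeomorph] at this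
      rw [this, Set.preimage_image_eq _ E.injective]
    have h5 := DFunLike.congr_fun hv (E '' S)
    rw [Measure.smul_apply, h4] at h5
    rw [h5, ENNReal.smul_def, smul_eq_mul]

theorem exists_restrict_range_eq (hψ : Function.Injective ψ) {d : ℕ} (hd : finrank ℝ V = d) :
    ∃ κ : ENNReal, κ ≠ 0 ∧ κ ≠ ⊤ ∧ (∀ S : Set V, μHE[d] (ψ '' S) = κ * ν S) ∧
      (μHE[d]).restrict (Set.range ψ) = κ • ν.map ψ := by
  obtain ⟨κ, h0, ht, h⟩ := exists_measure_image_affine ν hψ hd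
  have he := measurableEmbedding_affine hψ
  refine ⟨κ, h0, ht, h, ?_⟩
  rw [← he.map_comap]
  ext s hs
  rw [he.map_apply, Measure.smul_apply, he.map_apply, he.comap_apply, h, smul_eq_mul]

omit [ν.IsAddHaarMeasure] in
theorem restrict_image_eq {S : Set V} {κ : ENNReal} {d : ℕ} (hψ : Function.Injective ψ)
    (h : (μHE[d]).restrict (Set.range ψ) = κ • ν.map ψ) :
    (μHE[d]).restrict (ψ '' S) = κ • (ν.restrict S).map ψ := by
  have he := measurableEmbedding_affine hψ
  have : (μHE[d]).restrict (ψ '' S) = ((μHE[d]).restrict (Set.range ψ)).restrict (ψ '' S) := by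
    rw [Measure.restrict_restrict_of_subset (Set.image_subset_range _ _)]
  rw [this, h, Measure.restrict_smul, he.restrict_map, Set.preimage_image_eq _ hψ]

theorem integrableOn_image_iff (hψ : Function.Injective ψ) {d : ℕ} (hd : finrank ℝ V = d)
    {f : E3 → ℝ} {S : Set V} :
    IntegrableOn f (ψ '' S) μHE[d] ↔ IntegrableOn (f ∘ ψ) S ν := by
  obtain ⟨κ, h0, ht, -, h⟩ := exists_restrict_range_eq ν hψ hd
  rw [IntegrableOn, restrict_image_eq ν hψ h, integrable_smul_measure h0 ht,
    (measurableEmbedding_affine hψ).integrable_map_iff]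
  rfl

theorem avg_image (hψ : Function.Injective ψ) {d : ℕ} (hd : finrank ℝ V = d)
    (f : E3 → ℝ) (S : Set V) :
    Avg d f (ψ '' S) = (ν.real S)⁻¹ * ∫ x in S, f (ψ x) ∂ν := by
  obtain ⟨κ, h0, ht, h1, h⟩ := exists_restrict_range_eq ν hψ hd
  have hk : κ.toReal ≠ 0 := ENNReal.toReal_ne_zero.mpr ⟨h0, ht⟩
  rw [Avg, restrict_image_eq ν hψ h, integral_smul_measure,
    (measurableEmbedding_affine hψ).integral_map, measureReal_def, h1, ENNReal.toReal_mul,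
    ← measureReal_def, smul_eq_mul]
  field_simp

end Image

end Platonic

/-! ### Bounded convex functions, barycentric coordinates, parametrizations of simplices -/

namespace Platonic

open Module

section Bounded

variable {E : Type*} [AddCommGroup E] [Module ℝ E]

/-- The maximum over the vertices bounds `f` from above. For the lower bound, the centroid `b` is a
combination of `x` and another point `z` of the hull, with a weight on `x` that does not depend on
`x`; convexity then bounds `f x` below in terms of `f b` and the upper bound at `z`. -/
theorem exists_abs_le_of_convexOn_convexHull {s : Finset E} {f : E → ℝ}
    (hf : ConvexOn ℝ (convexHull ℝ (s : Set E)) f) :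
    ∃ C, ∀ x ∈ convexHull ℝ (s : Set E), |f x| ≤ C := by
  obtain ⟨M, hM⟩ := (s.finite_toSet.image f).bddAbove
  have hup : ∀ x ∈ convexHull ℝ (s : Set E), f x ≤ M := fun x hx => by
    obtain ⟨y, hy, hxy⟩ := hf.exists_ge_of_mem_convexHull (subset_convexHull ℝ _) hx
    exact hxy.trans (hM (Set.mem_image_of_mem f hy))
  rcases s.eq_empty_or_nonempty with rfl | hs
  · exact ⟨0, by simp⟩
  set N : ℝ := (s.card : ℝ) with hN
  have hN1 : 1 ≤ N := by
    rw [hN]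
    exact_mod_cast hs.card_pos
  -- A weight of at most `1/N` keeps the coefficients of `z` nonnegative; half of that also keeps `1
  -- - a` nonzero when `N = 1`.
  set a : ℝ := 1 / (2 * N) with ha
  have ha0 : 0 < a := by positivity
  have haN : a * (2 * N) = 1 := by rw [ha]; field_simp
  have ha1 : a ≤ 1 / 2 := by nlinarith
  set b : E := ∑ y ∈ s, (1 / N) • y with hb
  have hlow : ∀ x ∈ convexHull ℝ (s : Set E), (f b - (1 - a) * M) / a ≤ f x := fun x hx => by
    obtain ⟨w, hw0, hw1, hwx⟩ := Finset.mem_convexHull'.mp hx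
    have hle : ∀ y ∈ s, w y ≤ 1 := fun y hy => hw1 ▸ Finset.single_le_sum hw0 hy
    set z : E := ∑ y ∈ s, ((1 / N - a * w y) / (1 - a)) • y with hz
    have hzm : z ∈ convexHull ℝ (s : Set E) := by
      refine Finset.mem_convexHull'.mpr ⟨fun y => (1 / N - a * w y) / (1 - a), fun y hy => ?_, ?_,
        rfl⟩
      · have h1 := hle y hy
        have h2 : 1 / N = 2 * a := by field_simp; linarith
        refine div_nonneg ?_ (by linarith)
        nlinarith
      · rw [← Finset.sum_div, Finset.sum_sub_distrib, ← Finset.mul_sum, hw1, Finset.sum_const,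
          nsmul_eq_mul, ← hN]
        have h3 : 1 - a ≠ 0 := by linarith
        field_simp
    have hbz : b = a • x + (1 - a) • z := by
      rw [hb, hz, ← hwx, Finset.smul_sum, Finset.smul_sum, ← Finset.sum_add_distrib]
      refine Finset.sum_congr rfl fun y _ => ?_
      rw [smul_smul, smul_smul, ← add_smul]
      have h3 : 1 - a ≠ 0 := by linarith
      congr 1
      field_simp
      ring
    have h4 := hf.2 hx hzm ha0.le (by linarith : 0 ≤ 1 - a) (by ring)
    rw [← hbz, smul_eq_mul, smul_eq_mul] at h4
    have h5 := hup z hzm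
    rw [div_le_iff₀ ha0]
    nlinarith
  refine ⟨max M (-((f b - (1 - a) * M) / a)), fun x hx => abs_le.mpr ⟨?_, ?_⟩⟩
  · have := le_max_right M (-((f b - (1 - a) * M) / a))
    linarith [hlow x hx]
  · exact (hup x hx).trans (le_max_left _ _)

end Bounded

/-- A convex function is continuous in the interior of its domain but may jump at the boundary.
Integrability therefore comes from continuity on an open region plus a bound, and the boundary of
the simplex is discarded as a null set. -/
theorem integrableOn_of_continuousOn_of_abs_le {V : Type*} [NormedAddCommGroup V]
    [NormedSpace ℝ V] [MeasurableSpace V] [BorelSpace V] [FiniteDimensional ℝ V] (ν : Measure V)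
    [ν.IsAddHaarMeasure] {S : Set V} (hS : IsOpen S) (hb : Bornology.IsBounded S) {g : V → ℝ}
    (hg : ContinuousOn g S) {C : ℝ} (hC : ∀ x ∈ S, |g x| ≤ C) : IntegrableOn g S ν := by
  have : IsFiniteMeasure (ν.restrict S) := ⟨by simpa using hb.measure_lt_top⟩
  exact Integrable.of_bound (hg.aestronglyMeasurable hS.measurableSet) C
    ((ae_restrict_iff' hS.measurableSet).mpr (.of_forall hC))

section ConvexHull

variable {E : Type*} [AddCommGroup E] [Module ℝ E]

theorem mem_convexHull_triple {p q r x : E} : x ∈ convexHull ℝ ({p, q, r} : Set E) ↔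
    ∃ a b c : ℝ, 0 ≤ a ∧ 0 ≤ b ∧ 0 ≤ c ∧ a + b + c = 1 ∧ x = a • p + b • q + c • r := by
  constructor
  · have hsub : convexHull ℝ ({p, q, r} : Set E) ⊆ {x | ∃ a b c : ℝ, 0 ≤ a ∧ 0 ≤ b ∧ 0 ≤ c ∧
        a + b + c = 1 ∧ x = a • p + b • q + c • r} := by
      refine convexHull_min ?_ ?_
      · rintro y (rfl | rfl | rfl)
        · exact ⟨1, 0, 0, by norm_num, by norm_num, by norm_num, by norm_num, by module⟩
        · exact ⟨0, 1, 0, by norm_num, by norm_num, by norm_num, by norm_num, by module⟩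
        · exact ⟨0, 0, 1, by norm_num, by norm_num, by norm_num, by norm_num, by module⟩
      · rintro y ⟨a, b, c, ha, hb, hc, hs, rfl⟩ z ⟨a', b', c', ha', hb', hc', hs', rfl⟩ s t hs0 ht0 hst
        refine ⟨s * a + t * a', s * b + t * b', s * c + t * c', by positivity, by positivity,
          by positivity, ?_, by module⟩
        linear_combination s * hs + t * hs' + hst
    exact fun hx => hsub hx
  · rintro ⟨a, b, c, ha, hb, hc, hs, rfl⟩
    have h := convex_convexHull ℝ ({p, q, r} : Set E)
    have := h.sum_mem (t := Finset.univ) (w := ![a, b, c]) (z := ![p, q, r])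
      (by intro i _; fin_cases i <;> simpa) (by simpa [Fin.sum_univ_three])
      (by intro i _; fin_cases i <;> exact subset_convexHull ℝ _ (by simp))
    simpa [Fin.sum_univ_three] using this

theorem mem_convexHull_quadruple {p q r s x : E} : x ∈ convexHull ℝ ({p, q, r, s} : Set E) ↔
    ∃ a b c d : ℝ, 0 ≤ a ∧ 0 ≤ b ∧ 0 ≤ c ∧ 0 ≤ d ∧ a + b + c + d = 1 ∧
      x = a • p + b • q + c • r + d • s := by
  constructor
  · have hsub : convexHull ℝ ({p, q, r, s} : Set E) ⊆ {x | ∃ a b c d : ℝ, 0 ≤ a ∧ 0 ≤ b ∧ 0 ≤ c ∧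
        0 ≤ d ∧ a + b + c + d = 1 ∧ x = a • p + b • q + c • r + d • s} := by
      refine convexHull_min ?_ ?_
      · rintro y (rfl | rfl | rfl | rfl)
        · exact ⟨1, 0, 0, 0, by norm_num, by norm_num, by norm_num, by norm_num, by norm_num,
            by module⟩
        · exact ⟨0, 1, 0, 0, by norm_num, by norm_num, by norm_num, by norm_num, by norm_num,
            by module⟩
        · exact ⟨0, 0, 1, 0, by norm_num, by norm_num, by norm_num, by norm_num, by norm_num,
            by module⟩
        · exact ⟨0, 0, 0, 1, by norm_num, by norm_num, by norm_num, by norm_num, by norm_num,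
            by module⟩
      · rintro y ⟨a, b, c, d, ha, hb, hc, hd, h, rfl⟩ z ⟨a', b', c', d', ha', hb', hc', hd', h', rfl⟩
          u v hu hv huv
        refine ⟨u * a + v * a', u * b + v * b', u * c + v * c', u * d + v * d', by positivity,
          by positivity, by positivity, by positivity, ?_, by module⟩
        linear_combination u * h + v * h' + huv
    exact fun hx => hsub hx
  · rintro ⟨a, b, c, d, ha, hb, hc, hd, h1, rfl⟩
    have h := convex_convexHull ℝ ({p, q, r, s} : Set E)
    have := h.sum_mem (t := Finset.univ) (w := ![a, b, c, d]) (z := ![p, q, r, s])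
      (by intro i _; fin_cases i <;> simpa) (by simpa [Fin.sum_univ_four])
      (by intro i _; fin_cases i <;> exact subset_convexHull ℝ _ (by simp))
    simpa [Fin.sum_univ_four] using this

/-- The relative interior of the triangle with vertices `p`, `q`, `r`. -/
def openTriangle (p q r : E) : Set E :=
  {x | ∃ a b c : ℝ, 0 < a ∧ 0 < b ∧ 0 < c ∧ a + b + c = 1 ∧ x = a • p + b • q + c • r}

/-- The interior of the tetrahedron with vertices `p`, `q`, `r`, `s`. -/
def openTetrahedron (p q r s : E) : Set E :=
  {x | ∃ a b c d : ℝ, 0 < a ∧ 0 < b ∧ 0 < c ∧ 0 < d ∧ a + b + c + d = 1 ∧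
    x = a • p + b • q + c • r + d • s}

theorem openTriangle_subset (p q r : E) : openTriangle p q r ⊆ convexHull ℝ {p, q, r} := by
  rintro x ⟨a, b, c, ha, hb, hc, h, rfl⟩
  exact mem_convexHull_triple.mpr ⟨a, b, c, ha.le, hb.le, hc.le, h, rfl⟩

theorem openTetrahedron_subset (p q r s : E) :
    openTetrahedron p q r s ⊆ convexHull ℝ {p, q, r, s} := by
  rintro x ⟨a, b, c, d, ha, hb, hc, hd, h, rfl⟩
  exact mem_convexHull_quadruple.mpr ⟨a, b, c, d, ha.le, hb.le, hc.le, hd.le, h, rfl⟩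

end ConvexHull

/-- The affine parametrization of a plane through `p` with direction vectors `e₁`, `e₂`. -/
noncomputable def planeMap (p e₁ e₂ : E3) : ℝ × ℝ →ᵃ[ℝ] E3 :=
  ((LinearMap.toSpanSingleton ℝ E3 e₁).coprod (LinearMap.toSpanSingleton ℝ E3 e₂)).toAffineMap +
    AffineMap.const ℝ (ℝ × ℝ) p

/-- The affine parametrization of space with origin `p` and direction vectors `e₁`, `e₂`, `e₃`. -/
noncomputable def spaceMap (p e₁ e₂ e₃ : E3) : ℝ × (ℝ × ℝ) →ᵃ[ℝ] E3 :=
  ((LinearMap.toSpanSingleton ℝ E3 e₁).coprod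
    ((LinearMap.toSpanSingleton ℝ E3 e₂).coprod (LinearMap.toSpanSingleton ℝ E3 e₃))).toAffineMap +
    AffineMap.const ℝ (ℝ × (ℝ × ℝ)) p

theorem planeMap_apply (p e₁ e₂ : E3) (z : ℝ × ℝ) :
    planeMap p e₁ e₂ z = p + z.1 • e₁ + z.2 • e₂ := by
  simp [planeMap]
  abel

theorem spaceMap_apply (p e₁ e₂ e₃ : E3) (z : ℝ × (ℝ × ℝ)) :
    spaceMap p e₁ e₂ e₃ z = p + z.1 • e₁ + z.2.1 • e₂ + z.2.2 • e₃ := by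
  simp [spaceMap]
  abel

/-- The vectors `q - p`, `r - p`, `s - p` are linearly independent. -/
def Nondegenerate (p q r s : E3) : Prop :=
  ∀ a b c : ℝ, a • (q - p) + b • (r - p) + c • (s - p) = 0 → a = 0 ∧ b = 0 ∧ c = 0

theorem planeMap_injective {p q r s : E3} (h : Nondegenerate p q r s) :
    Function.Injective (planeMap q (r - q) (s - q)) := by
  intro x y hxy
  rw [planeMap_apply, planeMap_apply] at hxy
  obtain ⟨-, h1, h2⟩ := h (-(x.1 - y.1) - (x.2 - y.2)) (x.1 - y.1) (x.2 - y.2) (by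
    rw [← sub_eq_zero] at hxy; rw [← hxy]; module)
  exact Prod.ext (by linarith) (by linarith)

/-- In these coordinates the first variable is the total barycentric weight of `q`, `r`, `s`, that
is, the height measured from the apex `p`. -/
theorem coneMap_injective {p q r s : E3} (h : Nondegenerate p q r s) :
    Function.Injective (spaceMap p (q - p) (r - q) (s - q)) := by
  intro x y hxy
  rw [spaceMap_apply, spaceMap_apply] at hxy
  obtain ⟨h0, h1, h2⟩ := h ((x.1 - y.1) - (x.2.1 - y.2.1) - (x.2.2 - y.2.2)) (x.2.1 - y.2.1)
    (x.2.2 - y.2.2) (by rw [← sub_eq_zero] at hxy; rw [← hxy]; module)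
  exact Prod.ext (by linarith) (Prod.ext (by linarith) (by linarith))

/-- Here the first variable `t` is the total weight of `r` and `s`; the other two are the weights of
`q` and of `s`. A slice of the simplex is then a rectangle with sides `1 - t` and `t`. -/
theorem joinMap_injective {p q r s : E3} (h : Nondegenerate p q r s) :
    Function.Injective (spaceMap p (r - p) (q - p) (s - r)) := by
  intro x y hxy
  rw [spaceMap_apply, spaceMap_apply] at hxy
  obtain ⟨h0, h1, h2⟩ := h (x.2.1 - y.2.1) ((x.1 - y.1) - (x.2.2 - y.2.2))
    (x.2.2 - y.2.2) (by rw [← sub_eq_zero] at hxy; rw [← hxy]; module)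
  exact Prod.ext (by linarith) (Prod.ext (by linarith) (by linarith))

end Platonic

/-! ### Closed simplices agree with open ones up to null sets -/

namespace Platonic

open Module

theorem ae_eq_of_diff_null {d : ℕ} {U U' : Set E3} (h : U' ⊆ U) (h0 : μHE[d] (U \ U') = 0) :
    U =ᵐ[μHE[d]] U' :=
  Filter.EventuallyLE.antisymm (ae_le_set.mpr h0) h.eventuallyLE

theorem avg_congr_set {d : ℕ} {U U' : Set E3} (h : U =ᵐ[μHE[d]] U') (f : E3 → ℝ) :
    Avg d f U = Avg d f U' := by
  rw [Avg, Avg, setIntegral_congr_set h, measureReal_congr h]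

/-- The parameter domain of the interior of a triangle. -/
def triangleRegion : Set (ℝ × ℝ) := {z | 0 < z.1 ∧ 0 < z.2 ∧ z.1 + z.2 < 1}

/-- The parameter domain of the interior of a tetrahedron, sliced by the planes parallel to a
face. -/
def coneRegion : Set (ℝ × (ℝ × ℝ)) := {z | z.1 < 1 ∧ 0 < z.2.1 ∧ 0 < z.2.2 ∧ z.2.1 + z.2.2 < z.1}

/-- The parameter domain of the interior of a tetrahedron, sliced by the planes parallel to two
opposite edges. -/
def joinRegion : Set (ℝ × (ℝ × ℝ)) := {z | 0 < z.2.1 ∧ z.2.1 < 1 - z.1 ∧ 0 < z.2.2 ∧ z.2.2 < z.1}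

instance : (volume : Measure (ℝ × (ℝ × ℝ))).IsAddHaarMeasure :=
  inferInstanceAs ((volume : Measure ℝ).prod (volume : Measure (ℝ × ℝ))).IsAddHaarMeasure

theorem isOpen_triangleRegion : IsOpen triangleRegion := by
  have h1 : IsOpen {z : ℝ × ℝ | 0 < z.1} := isOpen_lt continuous_const (by fun_prop)
  have h2 : IsOpen {z : ℝ × ℝ | 0 < z.2} := isOpen_lt continuous_const (by fun_prop)
  have h3 : IsOpen {z : ℝ × ℝ | z.1 + z.2 < 1} := isOpen_lt (by fun_prop) continuous_const
  exact h1.inter (h2.inter h3)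

theorem isOpen_coneRegion : IsOpen coneRegion := by
  have h1 : IsOpen {z : ℝ × (ℝ × ℝ) | z.1 < 1} := isOpen_lt (by fun_prop) continuous_const
  have h2 : IsOpen {z : ℝ × (ℝ × ℝ) | 0 < z.2.1} := isOpen_lt continuous_const (by fun_prop)
  have h3 : IsOpen {z : ℝ × (ℝ × ℝ) | 0 < z.2.2} := isOpen_lt continuous_const (by fun_prop)
  have h4 : IsOpen {z : ℝ × (ℝ × ℝ) | z.2.1 + z.2.2 < z.1} := isOpen_lt (by fun_prop) (by fun_prop)
  exact h1.inter (h2.inter (h3.inter h4))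

theorem isOpen_joinRegion : IsOpen joinRegion := by
  have h1 : IsOpen {z : ℝ × (ℝ × ℝ) | 0 < z.2.1} := isOpen_lt continuous_const (by fun_prop)
  have h2 : IsOpen {z : ℝ × (ℝ × ℝ) | z.2.1 < 1 - z.1} := isOpen_lt (by fun_prop) (by fun_prop)
  have h3 : IsOpen {z : ℝ × (ℝ × ℝ) | 0 < z.2.2} := isOpen_lt continuous_const (by fun_prop)
  have h4 : IsOpen {z : ℝ × (ℝ × ℝ) | z.2.2 < z.1} := isOpen_lt (by fun_prop) (by fun_prop)
  exact h1.inter (h2.inter (h3.inter h4))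

theorem isBounded_triangleRegion : Bornology.IsBounded triangleRegion :=
  (Metric.isBounded_Icc ((0 : ℝ), (0 : ℝ)) (1, 1)).subset fun z ⟨h1, h2, h3⟩ =>
    ⟨⟨h1.le, h2.le⟩, ⟨by change z.1 ≤ 1; linarith, by change z.2 ≤ 1; linarith⟩⟩

theorem isBounded_coneRegion : Bornology.IsBounded coneRegion :=
  (Metric.isBounded_Icc ((0 : ℝ), ((0 : ℝ), (0 : ℝ))) (1, (1, 1))).subset fun z ⟨h1, h2, h3, h4⟩ =>
    ⟨⟨by change 0 ≤ z.1; linarith, h2.le, h3.le⟩,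
      ⟨h1.le, by change z.2.1 ≤ 1; linarith, by change z.2.2 ≤ 1; linarith⟩⟩

theorem isBounded_joinRegion : Bornology.IsBounded joinRegion :=
  (Metric.isBounded_Icc ((0 : ℝ), ((0 : ℝ), (0 : ℝ))) (1, (1, 1))).subset fun z ⟨h1, h2, h3, h4⟩ =>
    ⟨⟨by change 0 ≤ z.1; linarith, h1.le, h3.le⟩,
      ⟨by change z.1 ≤ 1; linarith, by change z.2.1 ≤ 1; linarith, by change z.2.2 ≤ 1; linarith⟩⟩

theorem measure_image_hyperplane {V : Type*} [NormedAddCommGroup V] [NormedSpace ℝ V]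
    [MeasurableSpace V] [BorelSpace V] [FiniteDimensional ℝ V] {ψ : V →ᵃ[ℝ] E3}
    (hψ : Function.Injective ψ) {d : ℕ} (hd : finrank ℝ V = d) {l : V →ₗ[ℝ] ℝ} (hl : l ≠ 0)
    (b : ℝ) : μHE[d] (ψ '' {x | l x = b}) = 0 := by
  let K : TopologicalSpace.PositiveCompacts V := Classical.arbitrary _
  obtain ⟨κ, -, -, h⟩ := exists_measure_image_affine (Measure.addHaarMeasure K) hψ hd
  rw [h, measure_hyperplane _ hl, mul_zero]

variable {p q r s : E3}

theorem openTriangle_eq_image (q r s : E3) :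
    openTriangle q r s = planeMap q (r - q) (s - q) '' triangleRegion := by
  ext x
  constructor
  · rintro ⟨a, b, c, ha, hb, hc, h, rfl⟩
    refine ⟨(b, c), ⟨hb, hc, by change b + c < 1; linarith⟩, ?_⟩
    rw [planeMap_apply]
    obtain rfl : a = 1 - b - c := by linarith
    module
  · rintro ⟨z, ⟨h1, h2, h3⟩, rfl⟩
    refine ⟨1 - z.1 - z.2, z.1, z.2, by linarith, h1, h2, by ring, ?_⟩
    rw [planeMap_apply]
    module

theorem openTetrahedron_eq_cone (p q r s : E3) :
    openTetrahedron p q r s = spaceMap p (q - p) (r - q) (s - q) '' coneRegion := by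
  ext x
  constructor
  · rintro ⟨a, b, c, d, ha, hb, hc, hd, h, rfl⟩
    refine ⟨(b + c + d, (c, d)), ⟨by change b + c + d < 1; linarith, hc, hd,
      by change c + d < b + c + d; linarith⟩, ?_⟩
    rw [spaceMap_apply]
    obtain rfl : a = 1 - b - c - d := by linarith
    module
  · rintro ⟨z, ⟨h1, h2, h3, h4⟩, rfl⟩
    refine ⟨1 - z.1, z.1 - z.2.1 - z.2.2, z.2.1, z.2.2, by linarith, by linarith, h2, h3,
      by ring, ?_⟩
    rw [spaceMap_apply]
    module

theorem openTetrahedron_eq_join (p q r s : E3) :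
    openTetrahedron p q r s = spaceMap p (r - p) (q - p) (s - r) '' joinRegion := by
  ext x
  constructor
  · rintro ⟨a, b, c, d, ha, hb, hc, hd, h, rfl⟩
    refine ⟨(c + d, (b, d)), ⟨hb, by change b < 1 - (c + d); linarith, hd,
      by change d < c + d; linarith⟩, ?_⟩
    rw [spaceMap_apply]
    obtain rfl : a = 1 - b - c - d := by linarith
    module
  · rintro ⟨z, ⟨h1, h2, h3, h4⟩, rfl⟩
    refine ⟨1 - z.1 - z.2.1, z.2.1, z.1 - z.2.2, z.2.2, by linarith, h1, by linarith, h3,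
      by ring, ?_⟩
    rw [spaceMap_apply]
    module

theorem openSegment_eq_lineMap_image (p q : E3) :
    openSegment ℝ p q = AffineMap.lineMap p q '' Set.Ioo (0 : ℝ) 1 :=
  openSegment_eq_image_lineMap ℝ p q

/-- A removed point has a vanishing barycentric coordinate, so it lies on one of three lines. The
apex `p` only serves to make `q`, `r`, `s` affinely independent. -/
theorem measure_triangle_diff (h : Nondegenerate p q r s) :
    μHE[2] (convexHull ℝ {q, r, s} \ openTriangle q r s) = 0 := by
  have hψ := planeMap_injective h
  have hd : finrank ℝ (ℝ × ℝ) = 2 := by simp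
  have h1 := measure_image_hyperplane hψ hd (l := LinearMap.fst ℝ ℝ ℝ)
    (fun h => by simpa using LinearMap.congr_fun h (1, 0)) 0
  have h2 := measure_image_hyperplane hψ hd (l := LinearMap.snd ℝ ℝ ℝ)
    (fun h => by simpa using LinearMap.congr_fun h (0, 1)) 0
  have h3 := measure_image_hyperplane hψ hd (l := LinearMap.fst ℝ ℝ ℝ + LinearMap.snd ℝ ℝ ℝ)
    (fun h => by simpa using LinearMap.congr_fun h (1, 0)) 1
  refine measure_mono_null ?_ (measure_union_null h1 (measure_union_null h2 h3))
  rintro x ⟨hx, hx'⟩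
  obtain ⟨a, b, c, ha, hb, hc, hs, rfl⟩ := mem_convexHull_triple.mp hx
  have hpt : planeMap q (r - q) (s - q) (b, c) = a • q + b • r + c • s := by
    rw [planeMap_apply]
    obtain rfl : a = 1 - b - c := by linarith
    module
  rcases hb.eq_or_lt with hb | hb
  · exact Or.inl ⟨(b, c), hb.symm, hpt⟩
  rcases hc.eq_or_lt with hc | hc
  · exact Or.inr (Or.inl ⟨(b, c), hc.symm, hpt⟩)
  rcases ha.eq_or_lt with ha | ha
  · exact Or.inr (Or.inr ⟨(b, c), by change b + c = 1; linarith, hpt⟩)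
  exact absurd ⟨a, b, c, ha, hb, hc, hs, rfl⟩ hx'

theorem measure_tetrahedron_diff (h : Nondegenerate p q r s) :
    μHE[3] (convexHull ℝ {p, q, r, s} \ openTetrahedron p q r s) = 0 := by
  have hψ := coneMap_injective h
  have hd : finrank ℝ (ℝ × (ℝ × ℝ)) = 3 := by simp
  have h1 := measure_image_hyperplane hψ hd (l := LinearMap.fst ℝ ℝ (ℝ × ℝ))
    (fun h => by simpa using LinearMap.congr_fun h (1, (0, 0))) 1
  have h2 := measure_image_hyperplane hψ hd
    (l := LinearMap.fst ℝ ℝ ℝ ∘ₗ LinearMap.snd ℝ ℝ (ℝ × ℝ))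
    (fun h => by simpa using LinearMap.congr_fun h (0, (1, 0))) 0
  have h3 := measure_image_hyperplane hψ hd
    (l := LinearMap.snd ℝ ℝ ℝ ∘ₗ LinearMap.snd ℝ ℝ (ℝ × ℝ))
    (fun h => by simpa using LinearMap.congr_fun h (0, (0, 1))) 0
  have h4 := measure_image_hyperplane hψ hd
    (l := LinearMap.fst ℝ ℝ (ℝ × ℝ) - LinearMap.fst ℝ ℝ ℝ ∘ₗ LinearMap.snd ℝ ℝ (ℝ × ℝ) -
      LinearMap.snd ℝ ℝ ℝ ∘ₗ LinearMap.snd ℝ ℝ (ℝ × ℝ))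
    (fun h => by simpa using LinearMap.congr_fun h (1, (0, 0))) 0
  refine measure_mono_null ?_ (measure_union_null h1 (measure_union_null h2
    (measure_union_null h3 h4)))
  rintro x ⟨hx, hx'⟩
  obtain ⟨a, b, c, d, ha, hb, hc, hd, hs, rfl⟩ := mem_convexHull_quadruple.mp hx
  have hpt : spaceMap p (q - p) (r - q) (s - q) (b + c + d, (c, d)) =
      a • p + b • q + c • r + d • s := by
    rw [spaceMap_apply]
    obtain rfl : a = 1 - b - c - d := by linarith
    module
  rcases ha.eq_or_lt with ha | ha
  · exact Or.inl ⟨_, by change b + c + d = 1; linarith, hpt⟩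
  rcases hc.eq_or_lt with hc | hc
  · exact Or.inr (Or.inl ⟨_, hc.symm, hpt⟩)
  rcases hd.eq_or_lt with hd | hd
  · exact Or.inr (Or.inr (Or.inl ⟨_, hd.symm, hpt⟩))
  rcases hb.eq_or_lt with hb | hb
  · exact Or.inr (Or.inr (Or.inr ⟨_, by change b + c + d - c - d = 0; linarith, hpt⟩))
  exact absurd ⟨a, b, c, d, ha, hb, hc, hd, hs, rfl⟩ hx'

theorem measure_segment_diff (h : p ≠ q) :
    μHE[1] (segment ℝ p q \ openSegment ℝ p q) = 0 := by
  have hψ : Function.Injective (AffineMap.lineMap p q : ℝ →ᵃ[ℝ] E3) := AffineMap.lineMap_injective ℝ h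
  have hd : finrank ℝ ℝ = 1 := by simp
  have h1 : ∀ b, μHE[1] ((AffineMap.lineMap p q : ℝ →ᵃ[ℝ] E3) '' {x | LinearMap.id (R := ℝ) x = b}) = 0 :=
    measure_image_hyperplane hψ hd (fun h => by simpa using LinearMap.congr_fun h (1 : ℝ))
  refine measure_mono_null ?_ (measure_union_null (h1 0) (h1 1))
  rintro x ⟨hx, hx'⟩
  rw [segment_eq_image_lineMap] at hx
  rw [openSegment_eq_lineMap_image] at hx'
  obtain ⟨t, ⟨ht0, ht1⟩, rfl⟩ := hx
  rcases ht0.eq_or_lt with ht0 | ht0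
  · exact Or.inl ⟨t, ht0.symm, rfl⟩
  rcases ht1.eq_or_lt with ht1 | ht1
  · exact Or.inr ⟨t, ht1, rfl⟩
  exact absurd ⟨t, ⟨ht0, ht1⟩, rfl⟩ hx'

theorem triangle_ae_eq (h : Nondegenerate p q r s) :
    (convexHull ℝ {q, r, s} : Set E3) =ᵐ[μHE[2]] openTriangle q r s :=
  ae_eq_of_diff_null (openTriangle_subset q r s) (measure_triangle_diff h)

theorem tetrahedron_ae_eq (h : Nondegenerate p q r s) :
    (convexHull ℝ {p, q, r, s} : Set E3) =ᵐ[μHE[3]] openTetrahedron p q r s :=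
  ae_eq_of_diff_null (openTetrahedron_subset p q r s) (measure_tetrahedron_diff h)

theorem segment_ae_eq (h : p ≠ q) : segment ℝ p q =ᵐ[μHE[1]] openSegment ℝ p q :=
  ae_eq_of_diff_null (openSegment_subset_segment ℝ p q) (measure_segment_diff h)

theorem avg_triangle (h : Nondegenerate p q r s) (f : E3 → ℝ) :
    Avg 2 f (convexHull ℝ {q, r, s}) = (volume.real triangleRegion)⁻¹ *
      ∫ z in triangleRegion, f (planeMap q (r - q) (s - q) z) := by
  rw [avg_congr_set (triangle_ae_eq h), openTriangle_eq_image,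
    avg_image volume (planeMap_injective h) (by simp)]

theorem avg_tetrahedron_cone (h : Nondegenerate p q r s) (f : E3 → ℝ) :
    Avg 3 f (convexHull ℝ {p, q, r, s}) = (volume.real coneRegion)⁻¹ *
      ∫ z in coneRegion, f (spaceMap p (q - p) (r - q) (s - q) z) := by
  rw [avg_congr_set (tetrahedron_ae_eq h), openTetrahedron_eq_cone,
    avg_image volume (coneMap_injective h) (by simp)]

theorem avg_tetrahedron_join (h : Nondegenerate p q r s) (f : E3 → ℝ) :
    Avg 3 f (convexHull ℝ {p, q, r, s}) = (volume.real joinRegion)⁻¹ *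
      ∫ z in joinRegion, f (spaceMap p (r - p) (q - p) (s - r) z) := by
  rw [avg_congr_set (tetrahedron_ae_eq h), openTetrahedron_eq_join,
    avg_image volume (joinMap_injective h) (by simp)]

theorem avg_segment (h : p ≠ q) (f : E3 → ℝ) :
    Avg 1 f (segment ℝ p q) = ∫ t in Set.Ioo (0 : ℝ) 1, f (AffineMap.lineMap p q t) := by
  rw [avg_congr_set (segment_ae_eq h), openSegment_eq_lineMap_image,
    avg_image volume (AffineMap.lineMap_injective ℝ h) (by simp)]
  simp

end Platonic

/-! ### Slicing a simplex parallel to a face: the first and the last inequality -/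

namespace Platonic

open Module Set

section Slices

variable {R : Set (ℝ × (ℝ × ℝ))} {D : ℝ → Set (ℝ × ℝ)} {G : ℝ × (ℝ × ℝ) → ℝ}

theorem integral_indicator_slice (hD : ∀ t, MeasurableSet (D t))
    (h1 : ∀ t ∈ Ioo (0 : ℝ) 1, ∀ z, (t, z) ∈ R ↔ z ∈ D t)
    (h0 : ∀ t ∉ Ioo (0 : ℝ) 1, ∀ z, (t, z) ∉ R) (t : ℝ) :
    ∫ z, R.indicator G (t, z) = (Ioo (0 : ℝ) 1).indicator (fun t => ∫ z in D t, G (t, z)) t := by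
  by_cases ht : t ∈ Ioo (0 : ℝ) 1
  · rw [indicator_of_mem ht, ← integral_indicator (hD t)]
    refine integral_congr_ae (.of_forall fun z => ?_)
    by_cases hz : z ∈ D t
    · simp only [indicator_of_mem hz, indicator_of_mem ((h1 t ht z).mpr hz)]
    · simp only [indicator_of_notMem hz, indicator_of_notMem (fun h => hz ((h1 t ht z).mp h))]
  · rw [indicator_of_notMem ht]
    simp [indicator_of_notMem (h0 t ht _)]

theorem setIntegral_slices (hR : MeasurableSet R) (hD : ∀ t, MeasurableSet (D t))
    (h1 : ∀ t ∈ Ioo (0 : ℝ) 1, ∀ z, (t, z) ∈ R ↔ z ∈ D t)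
    (h0 : ∀ t ∉ Ioo (0 : ℝ) 1, ∀ z, (t, z) ∉ R) (hG : IntegrableOn G R) :
    ∫ x in R, G x = ∫ t in Ioo (0 : ℝ) 1, ∫ z in D t, G (t, z) := by
  have hG' := (integrable_indicator_iff hR).mpr hG
  rw [← integral_indicator hR, ← integral_indicator measurableSet_Ioo, Measure.volume_eq_prod,
    integral_prod _ hG']
  exact integral_congr_ae (.of_forall (integral_indicator_slice hD h1 h0))

theorem integrableOn_slices (hR : MeasurableSet R) (hD : ∀ t, MeasurableSet (D t))
    (h1 : ∀ t ∈ Ioo (0 : ℝ) 1, ∀ z, (t, z) ∈ R ↔ z ∈ D t)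
    (h0 : ∀ t ∉ Ioo (0 : ℝ) 1, ∀ z, (t, z) ∉ R) (hG : IntegrableOn G R) :
    IntegrableOn (fun t => ∫ z in D t, G (t, z)) (Ioo (0 : ℝ) 1) := by
  have hG' := (integrable_indicator_iff hR).mpr hG
  rw [← integrable_indicator_iff measurableSet_Ioo]
  refine (Integrable.integral_prod_left hG').congr
    (.of_forall (integral_indicator_slice hD h1 h0))

end Slices

open scoped Pointwise

theorem mem_coneRegion_iff {t : ℝ} (ht : t ∈ Ioo (0 : ℝ) 1) (z : ℝ × ℝ) :
    (t, z) ∈ coneRegion ↔ z ∈ t • triangleRegion := by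
  rw [mem_smul_set_iff_inv_smul_mem₀ ht.1.ne']
  have h := inv_pos.mpr ht.1
  have h2 : t⁻¹ * z.1 + t⁻¹ * z.2 < 1 ↔ z.1 + z.2 < t := by
    rw [← mul_add, inv_mul_lt_iff₀ ht.1, mul_one]
  simp only [coneRegion, triangleRegion, mem_ofPred_eq, Prod.smul_fst, Prod.smul_snd, smul_eq_mul,
    mul_pos_iff_of_pos_left h, h2, ht.2, true_and]

theorem notMem_coneRegion {t : ℝ} (ht : t ∉ Ioo (0 : ℝ) 1) (z : ℝ × ℝ) : (t, z) ∉ coneRegion :=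
  fun ⟨h1, h2, h3, h4⟩ => ht ⟨by dsimp only at *; linarith, h1⟩

theorem mem_joinRegion_iff {t : ℝ} (z : ℝ × ℝ) :
    (t, z) ∈ joinRegion ↔ z ∈ Ioo 0 (1 - t) ×ˢ Ioo 0 t := by
  simp only [joinRegion, mem_ofPred_eq, mem_prod, mem_Ioo, and_assoc]

theorem notMem_joinRegion {t : ℝ} (ht : t ∉ Ioo (0 : ℝ) 1) (z : ℝ × ℝ) : (t, z) ∉ joinRegion :=
  fun ⟨h1, h2, h3, h4⟩ => ht ⟨by dsimp only at *; linarith, by dsimp only at *; linarith⟩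

theorem measurableSet_smul_triangleRegion (t : ℝ) : MeasurableSet (t • triangleRegion) := by
  by_cases ht : t = 0
  · subst ht
    exact (subsingleton_zero_smul_set _).measurableSet
  · exact isOpen_triangleRegion.measurableSet.const_smul_of_ne_zero ht

theorem setIntegral_smul_triangleRegion {t : ℝ} (ht : 0 < t) (g : ℝ × ℝ → ℝ) :
    ∫ z in t • triangleRegion, g z = t ^ 2 * ∫ z in triangleRegion, g (t • z) := by
  rw [Measure.setIntegral_comp_smul_of_pos volume g triangleRegion ht]
  have : (t ^ 2 : ℝ) ≠ 0 := by positivity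
  simp [mul_inv_cancel_left₀ this]

/-- Fubini: the slice at height `t` is the base triangle scaled by `t`, and `t ^ 2` is the Jacobian
of that scaling. -/
theorem setIntegral_coneRegion {G : ℝ × (ℝ × ℝ) → ℝ} (hG : IntegrableOn G coneRegion) :
    ∫ x in coneRegion, G x =
      ∫ t in Ioo (0 : ℝ) 1, t ^ 2 * ∫ z in triangleRegion, G (t, t • z) := by
  rw [setIntegral_slices isOpen_coneRegion.measurableSet measurableSet_smul_triangleRegion
    (fun t ht z => mem_coneRegion_iff ht z) (fun t ht z => notMem_coneRegion ht z) hG]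
  exact setIntegral_congr_fun measurableSet_Ioo fun t ht =>
    setIntegral_smul_triangleRegion ht.1 fun z => G (t, z)

theorem integrableOn_coneRegion_slices {G : ℝ × (ℝ × ℝ) → ℝ} (hG : IntegrableOn G coneRegion) :
    IntegrableOn (fun t => t ^ 2 * ∫ z in triangleRegion, G (t, t • z)) (Ioo (0 : ℝ) 1) :=
  (integrableOn_slices isOpen_coneRegion.measurableSet measurableSet_smul_triangleRegion
    (fun _ ht z => mem_coneRegion_iff ht z) (fun _ ht z => notMem_coneRegion ht z) hG).congr_fun
    (fun t ht => setIntegral_smul_triangleRegion ht.1 fun z => G (t, z)) measurableSet_Ioo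

theorem setIntegral_joinRegion {G : ℝ × (ℝ × ℝ) → ℝ} (hG : IntegrableOn G joinRegion) :
    ∫ x in joinRegion, G x = ∫ t in Ioo (0 : ℝ) 1, ∫ z in Ioo 0 (1 - t) ×ˢ Ioo 0 t, G (t, z) :=
  setIntegral_slices isOpen_joinRegion.measurableSet
    (fun _ => measurableSet_Ioo.prod measurableSet_Ioo)
    (fun _ _ z => mem_joinRegion_iff z) (fun _ ht z => notMem_joinRegion ht z) hG

theorem setIntegral_Ioo_eq_intervalIntegral (g : ℝ → ℝ) :
    ∫ t in Ioo (0 : ℝ) 1, g t = ∫ t in (0 : ℝ)..1, g t := by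
  rw [intervalIntegral.integral_of_le zero_le_one, integral_Ioc_eq_integral_Ioo]

/-- Multiplied by 3 this is `a + 3b/4`: the density `3t²` has mean `3/4`, the source of the constant
`3/4` in the theorem. -/
theorem setIntegral_sq_mul_affine (a b : ℝ) :
    ∫ t in Ioo (0 : ℝ) 1, t ^ 2 * (a + b * t) = a / 3 + b / 4 := by
  rw [setIntegral_Ioo_eq_intervalIntegral]
  have : ∀ t : ℝ, t ^ 2 * (a + b * t) = a * t ^ 2 + b * t ^ 3 := fun t => by ring
  simp only [this]
  rw [intervalIntegral.integral_add (by apply Continuous.intervalIntegrable; fun_prop)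
    (by apply Continuous.intervalIntegrable; fun_prop), intervalIntegral.integral_const_mul,
    intervalIntegral.integral_const_mul, integral_pow, integral_pow]
  norm_num
  ring

/-- The slice has area `(1 - t) * t`; the additional factors `1 - t` and `t` are the convexity
weights of the two opposite edges. -/
theorem setIntegral_join_weights (a b : ℝ) :
    ∫ t in Ioo (0 : ℝ) 1, ((1 - t) ^ 2 * t * a + t ^ 2 * (1 - t) * b) = (a + b) / 12 := by
  rw [setIntegral_Ioo_eq_intervalIntegral]
  have : ∀ t : ℝ, (1 - t) ^ 2 * t * a + t ^ 2 * (1 - t) * b =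
    a * t + (b - 2 * a) * t ^ 2 + (a - b) * t ^ 3 := fun t => by ring
  simp only [this]
  rw [intervalIntegral.integral_add (by apply Continuous.intervalIntegrable; fun_prop)
    (by apply Continuous.intervalIntegrable; fun_prop),
    intervalIntegral.integral_add (by apply Continuous.intervalIntegrable; fun_prop)
    (by apply Continuous.intervalIntegrable; fun_prop), intervalIntegral.integral_const_mul,
    intervalIntegral.integral_const_mul, intervalIntegral.integral_const_mul, integral_pow,
    integral_pow, integral_id]
  norm_num
  ring

theorem volume_triangleRegion_pos : 0 < volume.real triangleRegion := by
  refine ENNReal.toReal_pos (isOpen_triangleRegion.measure_pos volume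
    ⟨(1 / 4, 1 / 4), ?_⟩).ne' isBounded_triangleRegion.measure_lt_top.ne
  norm_num [triangleRegion]

theorem volume_coneRegion : volume.real coneRegion = volume.real triangleRegion / 3 := by
  have h := setIntegral_coneRegion (G := fun _ => 1)
    (integrableOn_const isBounded_coneRegion.measure_lt_top.ne)
  have h2 := setIntegral_sq_mul_affine (volume.real triangleRegion) 0
  simp at h h2
  rw [h, h2]

theorem volume_joinRegion : volume.real joinRegion = 1 / 6 := by
  have h := setIntegral_joinRegion (G := fun _ => 1)
    (integrableOn_const isBounded_joinRegion.measure_lt_top.ne)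
  have h2 := setIntegral_join_weights 1 1
  rw [setIntegral_const, smul_eq_mul, mul_one] at h
  rw [h, show (1 : ℝ) / 6 = (1 + 1) / 12 by norm_num, ← h2]
  refine setIntegral_congr_fun measurableSet_Ioo fun t ht => ?_
  have h3 : volume.real (Ioo 0 (1 - t) ×ˢ Ioo 0 t) = (1 - t) * t := by
    rw [Measure.volume_eq_prod, measureReal_prod_prod, Real.volume_real_Ioo_of_le (by linarith [ht.2]),
      Real.volume_real_Ioo_of_le ht.1.le]
    ring
  simp only [setIntegral_const, smul_eq_mul, h3]
  ring

/-- A convex function on `[0, 1]` has a supporting line at every interior point. -/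
theorem exists_supporting_line {φ : ℝ → ℝ} (hφ : ConvexOn ℝ (Icc 0 1) φ) {x : ℝ}
    (hx : x ∈ Ioo (0 : ℝ) 1) : ∃ m, ∀ t ∈ Icc (0 : ℝ) 1, φ x + m * (t - x) ≤ φ t := by
  have hxi : x ∈ interior (Icc (0 : ℝ) 1) := by rwa [interior_Icc]
  refine ⟨derivWithin φ (Ioi x) x, fun t ht => ?_⟩
  rcases lt_trichotomy t x with h | rfl | h
  · have h1 := hφ.slope_le_leftDeriv_of_mem_interior ht hxi h
    have h2 := h1.trans (hφ.leftDeriv_le_rightDeriv_of_mem_interior hxi)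
    rw [slope_def_field, div_le_iff₀ (by linarith)] at h2
    linarith
  · simp
  · have h1 := hφ.rightDeriv_le_slope_of_mem_interior hxi ht h
    rw [slope_def_field, le_div_iff₀ (by linarith)] at h1
    linarith

section Simplex

variable {p q r s : E3} {g : E3 → ℝ}

theorem integrableOn_comp_affine {V : Type*} [NormedAddCommGroup V] [NormedSpace ℝ V]
    [MeasurableSpace V] [BorelSpace V] [FiniteDimensional ℝ V] (ν : Measure V)
    [ν.IsAddHaarMeasure] {T : Set E3} (hg : ConvexOn ℝ T g) {C : ℝ} (hC : ∀ x ∈ T, |g x| ≤ C)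
    {S : Set V} (hS : IsOpen S) (hb : Bornology.IsBounded S) (ψ : V →ᵃ[ℝ] E3)
    (hψ : MapsTo ψ S T) : IntegrableOn (fun z => g (ψ z)) S ν :=
  integrableOn_of_continuousOn_of_abs_le ν hS hb
    ((hg.comp_affineMap ψ).continuousOn_interior.mono (interior_maximal hψ hS))
    fun z hz => hC _ (hψ hz)

theorem exists_abs_le_tetrahedron (hg : ConvexOn ℝ (convexHull ℝ {p, q, r, s}) g) :
    ∃ C, ∀ x ∈ convexHull ℝ {p, q, r, s}, |g x| ≤ C := by
  classical
  have := exists_abs_le_of_convexOn_convexHull (s := {p, q, r, s}) (f := g)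
  push_cast at this
  exact this hg

theorem planeMap_mem_openTriangle {z : ℝ × ℝ} (hz : z ∈ triangleRegion) :
    planeMap q (r - q) (s - q) z ∈ openTriangle q r s :=
  openTriangle_eq_image q r s ▸ mem_image_of_mem _ hz

theorem triangle_subset_tetrahedron :
    convexHull ℝ {q, r, s} ⊆ convexHull ℝ ({p, q, r, s} : Set E3) :=
  convexHull_mono (subset_insert _ _)

theorem mapsTo_homothety_planeMap {t : ℝ} (ht : t ∈ Icc (0 : ℝ) 1) :
    MapsTo ((AffineMap.homothety p t).comp (planeMap q (r - q) (s - q))) triangleRegion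
      (convexHull ℝ {p, q, r, s}) := by
  intro z hz
  rw [AffineMap.comp_apply, AffineMap.homothety_eq_lineMap]
  refine (convex_convexHull ℝ _).lineMap_mem (subset_convexHull ℝ _ (by simp)) ?_ ht
  exact triangle_subset_tetrahedron (openTriangle_subset _ _ _ (planeMap_mem_openTriangle hz))

/-- The integral of `g` over the section at height `t` of the cone with apex `p` over the
triangle `q r s`, in the coordinates of the base. -/
noncomputable def sliceIntegral (g : E3 → ℝ) (p q r s : E3) (t : ℝ) : ℝ :=
  ∫ z in triangleRegion, g ((AffineMap.homothety p t).comp (planeMap q (r - q) (s - q)) z)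

/-- For a fixed base point the point at height `t` moves affinely along a segment from `p`, so the
integrand is convex in `t`, and integration preserves this. The endpoints 0 and 1 are included
because they give the value at the apex and the integral over the base. -/
theorem convexOn_sliceIntegral (hg : ConvexOn ℝ (convexHull ℝ {p, q, r, s}) g) :
    ConvexOn ℝ (Icc 0 1) (sliceIntegral g p q r s) := by
  obtain ⟨C, hC⟩ := exists_abs_le_tetrahedron hg
  have hint : ∀ t ∈ Icc (0 : ℝ) 1, IntegrableOn (fun z =>
      g ((AffineMap.homothety p t).comp (planeMap q (r - q) (s - q)) z)) triangleRegion :=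
    fun t ht => integrableOn_comp_affine volume hg hC isOpen_triangleRegion
      isBounded_triangleRegion _ (mapsTo_homothety_planeMap ht)
  refine ⟨convex_Icc 0 1, fun x hx y hy a b ha hb hab => ?_⟩
  simp only [sliceIntegral, smul_eq_mul]
  rw [← integral_const_mul, ← integral_const_mul, ← integral_add ((hint x hx).const_mul a)
    ((hint y hy).const_mul b)]
  refine setIntegral_mono_on (hint _ ((convex_Icc 0 1) hx hy ha hb hab))
    (((hint x hx).const_mul a).add ((hint y hy).const_mul b)) isOpen_triangleRegion.measurableSet
    fun z hz => ?_
  have h := hg.2 (mapsTo_homothety_planeMap hx hz) (mapsTo_homothety_planeMap hy hz) ha hb hab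
  simp only [smul_eq_mul] at h
  refine le_trans (le_of_eq (congrArg g ?_)) h
  obtain rfl : b = 1 - a := by linarith
  simp only [AffineMap.comp_apply, AffineMap.homothety_apply, vsub_eq_sub, vadd_eq_add]
  module

theorem integrableOn_cone (hg : ConvexOn ℝ (convexHull ℝ {p, q, r, s}) g) :
    IntegrableOn (fun z => g (spaceMap p (q - p) (r - q) (s - q) z)) coneRegion := by
  obtain ⟨C, hC⟩ := exists_abs_le_tetrahedron hg
  refine integrableOn_comp_affine volume hg hC isOpen_coneRegion isBounded_coneRegion _
    fun _ hz => openTetrahedron_subset _ _ _ _ ?_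
  rw [openTetrahedron_eq_cone]
  exact mem_image_of_mem _ hz

theorem integrableOn_join (hg : ConvexOn ℝ (convexHull ℝ {p, q, r, s}) g) :
    IntegrableOn (fun z => g (spaceMap p (r - p) (q - p) (s - r) z)) joinRegion := by
  obtain ⟨C, hC⟩ := exists_abs_le_tetrahedron hg
  refine integrableOn_comp_affine volume hg hC isOpen_joinRegion isBounded_joinRegion _
    fun _ hz => openTetrahedron_subset _ _ _ _ ?_
  rw [openTetrahedron_eq_join]
  exact mem_image_of_mem _ hz

theorem spaceMap_smul_eq (t : ℝ) (z : ℝ × ℝ) : spaceMap p (q - p) (r - q) (s - q) (t, t • z) =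
    (AffineMap.homothety p t).comp (planeMap q (r - q) (s - q)) z := by
  simp only [AffineMap.comp_apply, AffineMap.homothety_apply, vsub_eq_sub, vadd_eq_add,
    spaceMap_apply, planeMap_apply, Prod.smul_fst, Prod.smul_snd, smul_eq_mul]
  module

theorem integral_cone_eq (hg : ConvexOn ℝ (convexHull ℝ {p, q, r, s}) g) :
    ∫ z in coneRegion, g (spaceMap p (q - p) (r - q) (s - q) z) =
      ∫ t in Ioo (0 : ℝ) 1, t ^ 2 * sliceIntegral g p q r s t := by
  rw [setIntegral_coneRegion (integrableOn_cone hg)]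
  simp only [spaceMap_smul_eq, sliceIntegral]

theorem integrableOn_sq_mul_sliceIntegral (hg : ConvexOn ℝ (convexHull ℝ {p, q, r, s}) g) :
    IntegrableOn (fun t => t ^ 2 * sliceIntegral g p q r s t) (Ioo (0 : ℝ) 1) := by
  have := integrableOn_coneRegion_slices (integrableOn_cone hg)
  simpa only [spaceMap_smul_eq, sliceIntegral] using this

theorem integrableOn_sq_mul_affine (a b : ℝ) :
    IntegrableOn (fun t : ℝ => t ^ 2 * (a + b * t)) (Ioo (0 : ℝ) 1) :=
  (Continuous.integrableOn_Icc (by fun_prop)).mono_set Ioo_subset_Icc_self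

/-- The slice integral lies below its chord, whose mean for the density `3t²` weighs the apex by
`1/4` and the base by `3/4`. -/
theorem avg_tetrahedron_le_cone (h : Nondegenerate p q r s)
    (hg : ConvexOn ℝ (convexHull ℝ {p, q, r, s}) g) :
    Avg 3 g (convexHull ℝ {p, q, r, s}) ≤
      1 / 4 * g p + 3 / 4 * Avg 2 g (convexHull ℝ {q, r, s}) := by
  set φ := sliceIntegral g p q r s with hφ
  have hA := volume_triangleRegion_pos
  set A := volume.real triangleRegion
  have h0 : φ 0 = A * g p := by
    simp [hφ, sliceIntegral, A]
  have h1 : Avg 2 g (convexHull ℝ {q, r, s}) = A⁻¹ * φ 1 := by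
    rw [avg_triangle h]
    simp [hφ, sliceIntegral, A]
  have hle : ∫ t in Ioo (0 : ℝ) 1, t ^ 2 * φ t ≤
      ∫ t in Ioo (0 : ℝ) 1, t ^ 2 * (φ 0 + (φ 1 - φ 0) * t) := by
    refine setIntegral_mono_on (integrableOn_sq_mul_sliceIntegral hg)
      (integrableOn_sq_mul_affine _ _) measurableSet_Ioo fun t ht => ?_
    have h2 := (convexOn_sliceIntegral hg).2 (left_mem_Icc.mpr zero_le_one)
      (right_mem_Icc.mpr zero_le_one) (sub_nonneg.mpr ht.2.le) ht.1.le (by ring)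
    simp only [smul_eq_mul, mul_zero, mul_one, zero_add] at h2
    rw [← hφ] at h2
    have := sq_nonneg t
    refine mul_le_mul_of_nonneg_left ?_ this
    linarith
  rw [setIntegral_sq_mul_affine] at hle
  rw [avg_tetrahedron_cone h, integral_cone_eq hg, volume_coneRegion, h1]
  have h3 : (A / 3)⁻¹ * ∫ t in Ioo (0 : ℝ) 1, t ^ 2 * φ t ≤
      (A / 3)⁻¹ * (φ 0 / 3 + (φ 1 - φ 0) / 4) := mul_le_mul_of_nonneg_left hle (by positivity)
  refine h3.trans (le_of_eq ?_)
  rw [h0]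
  field_simp
  ring

theorem homothety_image_triangle (c : ℝ) : AffineMap.homothety p c '' convexHull ℝ {q, r, s} =
    convexHull ℝ {AffineMap.homothety p c q, AffineMap.homothety p c r,
      AffineMap.homothety p c s} := by
  rw [AffineMap.image_convexHull]
  simp [image_insert_eq]

theorem Nondegenerate.homothety (h : Nondegenerate p q r s) {t : ℝ} (ht : t ≠ 0) :
    Nondegenerate p (AffineMap.homothety p t q) (AffineMap.homothety p t r)
      (AffineMap.homothety p t s) := by
  intro a b c habc
  have := h (a * t) (b * t) (c * t) (by
    rw [← habc]
    simp only [AffineMap.homothety_apply, vsub_eq_sub, vadd_eq_add]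
    module)
  simpa [ht] using this

/-- Jensen's inequality for the slice integral and the density `3t²`: the slice at the mean height
`3/4` is exactly the image of the base under the homothety. -/
theorem avg_homothety_le_avg_tetrahedron (h : Nondegenerate p q r s)
    (hg : ConvexOn ℝ (convexHull ℝ {p, q, r, s}) g) :
    Avg 2 g (AffineMap.homothety p (3 / 4 : ℝ) '' convexHull ℝ {q, r, s}) ≤
      Avg 3 g (convexHull ℝ {p, q, r, s}) := by
  set φ := sliceIntegral g p q r s with hφ
  have hA := volume_triangleRegion_pos
  set A := volume.real triangleRegion
  have h1 : Avg 2 g (AffineMap.homothety p (3 / 4 : ℝ) '' convexHull ℝ {q, r, s}) =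
      A⁻¹ * φ (3 / 4) := by
    rw [homothety_image_triangle, avg_triangle (h.homothety (by norm_num))]
    simp only [hφ, sliceIntegral, A]
    congr 2
    ext z
    congr 1
    simp only [AffineMap.comp_apply, AffineMap.homothety_apply, vsub_eq_sub, vadd_eq_add,
      planeMap_apply]
    module
  -- Since `3/4` is the mean height, the slope `m` drops out after integrating the supporting line
  -- against `t ^ 2`.
  obtain ⟨m, hm⟩ := exists_supporting_line (convexOn_sliceIntegral hg)
    (x := 3 / 4) (by norm_num)
  have hle : ∫ t in Ioo (0 : ℝ) 1, t ^ 2 * ((φ (3 / 4) - m * (3 / 4)) + m * t) ≤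
      ∫ t in Ioo (0 : ℝ) 1, t ^ 2 * φ t := by
    refine setIntegral_mono_on (integrableOn_sq_mul_affine _ _)
      (integrableOn_sq_mul_sliceIntegral hg) measurableSet_Ioo fun t ht => ?_
    have h2 := hm t (Ioo_subset_Icc_self ht)
    refine mul_le_mul_of_nonneg_left ?_ (sq_nonneg t)
    rw [hφ]
    linarith
  rw [setIntegral_sq_mul_affine] at hle
  rw [avg_tetrahedron_cone h, integral_cone_eq hg, volume_coneRegion, h1]
  have h3 : (A / 3)⁻¹ * ((φ (3 / 4) - m * (3 / 4)) / 3 + m / 4) ≤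
      (A / 3)⁻¹ * ∫ t in Ioo (0 : ℝ) 1, t ^ 2 * φ t := mul_le_mul_of_nonneg_left hle (by positivity)
  refine le_trans (le_of_eq ?_) h3
  field_simp
  ring

end Simplex

end Platonic

/-! ### Slicing a simplex parallel to two opposite edges: the middle inequalities -/

namespace Platonic

open Module Set

section Join

variable {p q r s : E3} {g : E3 → ℝ}

theorem Nondegenerate.ne₁ (h : Nondegenerate p q r s) : p ≠ q := by
  rintro rfl
  simpa using h 1 0 0 (by simp)

theorem Nondegenerate.ne₂ (h : Nondegenerate p q r s) : r ≠ s := by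
  rintro rfl
  simpa using h 0 1 (-1) (by module)

theorem integrableOn_lineMap (hg : ConvexOn ℝ (segment ℝ p q) g) :
    IntegrableOn (fun t : ℝ => g (AffineMap.lineMap p q t)) (Ioo 0 1) := by
  classical
  obtain ⟨C, hC⟩ : ∃ C, ∀ x ∈ segment ℝ p q, |g x| ≤ C := by
    rw [← convexHull_pair] at hg ⊢
    have := exists_abs_le_of_convexOn_convexHull (s := {p, q}) (f := g)
    push_cast at this
    exact this hg
  refine integrableOn_comp_affine volume hg hC isOpen_Ioo (Metric.isBounded_Ioo 0 1)
    (AffineMap.lineMap p q) fun t ht => ?_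
  rw [segment_eq_image_lineMap]
  exact mem_image_of_mem _ (Ioo_subset_Icc_self ht)

theorem continuousOn_lineMap (hg : ConvexOn ℝ (segment ℝ p q) g) :
    ContinuousOn (fun t : ℝ => g (AffineMap.lineMap p q t)) (Ioo 0 1) := by
  refine (hg.comp_affineMap (AffineMap.lineMap p q : ℝ →ᵃ[ℝ] E3)).continuousOn_interior.mono
    (interior_maximal (fun t ht => ?_) isOpen_Ioo)
  rw [mem_preimage, segment_eq_image_lineMap]
  exact mem_image_of_mem _ (Ioo_subset_Icc_self ht)

theorem setIntegral_comp_div {u : ℝ} (hu : 0 < u) (γ : ℝ → ℝ) :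
    ∫ a in Ioo 0 u, γ (a / u) = u * ∫ a in Ioo (0 : ℝ) 1, γ a := by
  rw [setIntegral_Ioo_eq_intervalIntegral, ← integral_Ioc_eq_integral_Ioo,
    ← intervalIntegral.integral_of_le hu.le, intervalIntegral.integral_comp_div _ hu.ne', zero_div,
    div_self hu.ne', smul_eq_mul]

theorem integrableOn_comp_div {u : ℝ} (hu : 0 < u) {γ : ℝ → ℝ} (hγ : IntegrableOn γ (Ioo 0 1)) :
    IntegrableOn (fun a => γ (a / u)) (Ioo 0 u) := by
  rw [← integrableOn_Ioc_iff_integrableOn_Ioo,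
    ← intervalIntegrable_iff_integrableOn_Ioc_of_le zero_le_one] at hγ
  have := hγ.comp_mul_right (c := u⁻¹) 
  rw [← integrableOn_Ioc_iff_integrableOn_Ioo,
    ← intervalIntegrable_iff_integrableOn_Ioc_of_le hu.le]
  simpa [div_eq_mul_inv] using this

theorem setIntegral_rectangle {u v α β : ℝ} (hu : 0 < u) (hv : 0 < v) {γ δ : ℝ → ℝ}
    (hγ : IntegrableOn γ (Ioo 0 1)) (hδ : IntegrableOn δ (Ioo 0 1)) :
    ∫ z in Ioo 0 u ×ˢ Ioo 0 v, (α * γ (z.1 / u) + β * δ (z.2 / v)) =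
      α * (u * v * ∫ a in Ioo (0 : ℝ) 1, γ a) + β * (u * v * ∫ a in Ioo (0 : ℝ) 1, δ a) := by
  have h1 := integrableOn_comp_div hu hγ
  have h2 := integrableOn_comp_div hv hδ
  have h3 : ∀ w : ℝ, IntegrableOn (fun _ : ℝ => (1 : ℝ)) (Ioo 0 w) := fun w =>
    integrableOn_const (by simp)
  have i1 : IntegrableOn (fun z : ℝ × ℝ => γ (z.1 / u)) (Ioo 0 u ×ˢ Ioo 0 v) := by
    rw [IntegrableOn, Measure.volume_eq_prod, ← Measure.prod_restrict]
    simpa using Integrable.mul_prod h1 (h3 v)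
  have i2 : IntegrableOn (fun z : ℝ × ℝ => δ (z.2 / v)) (Ioo 0 u ×ˢ Ioo 0 v) := by
    rw [IntegrableOn, Measure.volume_eq_prod, ← Measure.prod_restrict]
    simpa using Integrable.mul_prod (h3 u) h2
  have e1 := setIntegral_prod_mul (μ := (volume : Measure ℝ)) (ν := (volume : Measure ℝ))
    (fun a => γ (a / u)) (fun _ => (1 : ℝ)) (Ioo 0 u) (Ioo 0 v)
  have e2 := setIntegral_prod_mul (μ := (volume : Measure ℝ)) (ν := (volume : Measure ℝ))
    (fun _ => (1 : ℝ)) (fun a => δ (a / v)) (Ioo 0 u) (Ioo 0 v)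
  rw [← Measure.volume_eq_prod] at e1 e2
  simp only [mul_one, one_mul, setIntegral_comp_div hu, setIntegral_comp_div hv, setIntegral_const,
    smul_eq_mul, Real.volume_real_Ioo_of_le hu.le, Real.volume_real_Ioo_of_le hv.le, sub_zero]
    at e1 e2
  rw [integral_add (i1.const_mul α) (i2.const_mul β), integral_const_mul, integral_const_mul, e1,
    e2]
  ring

/-- A point of the slice at `t` divides a segment from the edge `p q` to the edge `r s` in the ratio
given by the weights `1 - t` and `t`. By convexity `g` there is at most the weighted sum of its
values at the two ends. On a rectangular slice the ends vary independently and uniformly over the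
edges, so the bound integrates to a combination of the two edge averages. -/
theorem avg_tetrahedron_le_join (h : Nondegenerate p q r s)
    (hg : ConvexOn ℝ (convexHull ℝ {p, q, r, s}) g) :
    Avg 3 g (convexHull ℝ {p, q, r, s}) ≤
      1 / 2 * Avg 1 g (segment ℝ p q) + 1 / 2 * Avg 1 g (segment ℝ r s) := by
  have hT : ∀ x ∈ ({p, q, r, s} : Set E3), x ∈ convexHull ℝ ({p, q, r, s} : Set E3) :=
    fun x hx => subset_convexHull ℝ _ hx
  have hs1 : segment ℝ p q ⊆ convexHull ℝ ({p, q, r, s} : Set E3) :=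
    (convex_convexHull ℝ _).segment_subset (hT _ (by simp)) (hT _ (by simp))
  have hs2 : segment ℝ r s ⊆ convexHull ℝ ({p, q, r, s} : Set E3) :=
    (convex_convexHull ℝ _).segment_subset (hT _ (by simp)) (hT _ (by simp))
  have hg1 : ConvexOn ℝ (segment ℝ p q) g := hg.subset hs1 (convex_segment p q)
  have hg2 : ConvexOn ℝ (segment ℝ r s) g := hg.subset hs2 (convex_segment r s)
  obtain ⟨C, hC⟩ := exists_abs_le_tetrahedron hg
  rw [avg_segment h.ne₁, avg_segment h.ne₂, avg_tetrahedron_join h, volume_joinRegion]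
  set γ : ℝ → ℝ := fun t => g (AffineMap.lineMap p q t) with hγ
  set δ : ℝ → ℝ := fun t => g (AffineMap.lineMap r s t) with hδ
  have hγC : ∀ t ∈ Ioo (0 : ℝ) 1, AffineMap.lineMap p q t ∈ segment ℝ p q := fun t ht => by
    rw [segment_eq_image_lineMap]
    exact mem_image_of_mem _ (Ioo_subset_Icc_self ht)
  have hδC : ∀ t ∈ Ioo (0 : ℝ) 1, AffineMap.lineMap r s t ∈ segment ℝ r s := fun t ht => by
    rw [segment_eq_image_lineMap]
    exact mem_image_of_mem _ (Ioo_subset_Icc_self ht)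
  -- The quotients are the positions, on the edges `p q` and `r s`, of the ends of the segment
  -- through the given point.
  set H : ℝ × (ℝ × ℝ) → ℝ :=
    fun z => (1 - z.1) * γ (z.2.1 / (1 - z.1)) + z.1 * δ (z.2.2 / z.1) with hH
  have hpos : ∀ z ∈ joinRegion, 0 < z.1 ∧ 0 < 1 - z.1 := fun z ⟨h1, h2, h3, h4⟩ =>
    ⟨by linarith, by linarith⟩
  have hm1 : ∀ z ∈ joinRegion, z.2.1 / (1 - z.1) ∈ Ioo (0 : ℝ) 1 := fun z hz =>
    ⟨div_pos hz.1 (hpos z hz).2, (div_lt_one (hpos z hz).2).mpr hz.2.1⟩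
  have hm2 : ∀ z ∈ joinRegion, z.2.2 / z.1 ∈ Ioo (0 : ℝ) 1 := fun z hz =>
    ⟨div_pos hz.2.2.1 (hpos z hz).1, (div_lt_one (hpos z hz).1).mpr hz.2.2.2⟩
  have hHint : IntegrableOn H joinRegion := by
    refine integrableOn_of_continuousOn_of_abs_le volume isOpen_joinRegion isBounded_joinRegion
      (C := C) ?_ fun z hz => ?_
    · have c1 : ContinuousOn (fun z : ℝ × (ℝ × ℝ) => z.2.1 / (1 - z.1)) joinRegion :=
        ContinuousOn.div (by fun_prop) (by fun_prop) fun z hz => (hpos z hz).2.ne'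
      have c2 : ContinuousOn (fun z : ℝ × (ℝ × ℝ) => z.2.2 / z.1) joinRegion :=
        ContinuousOn.div (by fun_prop) (by fun_prop) fun z hz => (hpos z hz).1.ne'
      have c3 := (continuousOn_lineMap hg1).comp c1 hm1
      have c4 := (continuousOn_lineMap hg2).comp c2 hm2
      exact ((by fun_prop : ContinuousOn (fun z : ℝ × (ℝ × ℝ) => 1 - z.1) joinRegion).mul c3).add
        ((by fun_prop : ContinuousOn (fun z : ℝ × (ℝ × ℝ) => z.1) joinRegion).mul c4)
    · have b1 := abs_le.mp (hC _ (hs1 (hγC _ (hm1 z hz))))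
      have b2 := abs_le.mp (hC _ (hs2 (hδC _ (hm2 z hz))))
      obtain ⟨k1, k2⟩ := hpos z hz
      rw [abs_le]
      simp only [hH, hγ, hδ]
      constructor <;> nlinarith
  have hle : ∫ z in joinRegion, g (spaceMap p (r - p) (q - p) (s - r) z) ≤
      ∫ z in joinRegion, H z := by
    refine setIntegral_mono_on (integrableOn_join hg) hHint isOpen_joinRegion.measurableSet
      fun z hz => ?_
    obtain ⟨k1, k2⟩ := hpos z hz
    have k := hg.2 (hs1 (hγC _ (hm1 z hz))) (hs2 (hδC _ (hm2 z hz))) k2.le k1.le (by ring)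
    simp only [smul_eq_mul] at k
    refine le_trans (le_of_eq (congrArg g ?_)) k
    simp only [spaceMap_apply, AffineMap.lineMap_apply_module', smul_add, smul_smul]
    rw [mul_div_cancel₀ _ k1.ne', mul_div_cancel₀ _ k2.ne']
    module
  have hHeq : ∫ z in joinRegion, H z =
      ((∫ t in Ioo (0 : ℝ) 1, γ t) + ∫ t in Ioo (0 : ℝ) 1, δ t) / 12 := by
    rw [setIntegral_joinRegion hHint, ← setIntegral_join_weights]
    refine setIntegral_congr_fun measurableSet_Ioo fun t ht => ?_
    have := setIntegral_rectangle (α := 1 - t) (β := t) (sub_pos.mpr ht.2) ht.1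
      (integrableOn_lineMap hg1) (integrableOn_lineMap hg2)
    simp only [hH, hγ, hδ] at this ⊢
    rw [this]
    ring
  rw [hHeq] at hle
  linarith

end Join

section Integrable

variable {p q r s : E3} {g : E3 → ℝ}

theorem integrableOn_tetrahedron (h : Nondegenerate p q r s)
    (hg : ConvexOn ℝ (convexHull ℝ {p, q, r, s}) g) :
    IntegrableOn g (convexHull ℝ {p, q, r, s}) μHE[3] := by
  rw [integrableOn_congr_set_ae (tetrahedron_ae_eq h), openTetrahedron_eq_cone,
    integrableOn_image_iff volume (coneMap_injective h) (by simp)]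
  exact integrableOn_cone hg

theorem integrableOn_triangle (h : Nondegenerate p q r s)
    (hg : ConvexOn ℝ (convexHull ℝ {p, q, r, s}) g) :
    IntegrableOn g (convexHull ℝ {q, r, s}) μHE[2] := by
  obtain ⟨C, hC⟩ := exists_abs_le_tetrahedron hg
  rw [integrableOn_congr_set_ae (triangle_ae_eq h), openTriangle_eq_image,
    integrableOn_image_iff volume (planeMap_injective h) (by simp)]
  exact integrableOn_comp_affine volume hg hC isOpen_triangleRegion isBounded_triangleRegion _
    fun z hz => triangle_subset_tetrahedron
      (openTriangle_subset _ _ _ (planeMap_mem_openTriangle hz))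

theorem integrableOn_segment (h : p ≠ q) (hg : ConvexOn ℝ (segment ℝ p q) g) :
    IntegrableOn g (segment ℝ p q) μHE[1] := by
  rw [integrableOn_congr_set_ae (segment_ae_eq h), openSegment_eq_lineMap_image,
    integrableOn_image_iff volume (AffineMap.lineMap_injective ℝ h) (by simp)]
  exact integrableOn_lineMap hg

end Integrable

/-! ### Averages over finite unions of congruent copies -/

section Union

variable {J : Type*} [Fintype J] {d : ℕ} {ι : J → E3 ≃ᵃⁱ[ℝ] E3} {U U' : Set E3} {m : ℕ}
  {f : E3 → ℝ}

theorem measurePreserving_affineIsometryEquiv (e : E3 ≃ᵃⁱ[ℝ] E3) (d : ℕ) :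
    MeasurePreserving e μHE[d] μHE[d] :=
  e.toIsometryEquiv.measurePreserving_euclideanHausdorffMeasure d

theorem measurableEmbedding_affineIsometryEquiv (e : E3 ≃ᵃⁱ[ℝ] E3) : MeasurableEmbedding e :=
  e.toHomeomorph.measurableEmbedding

/-- If the congruent copies `ι j '' U` of a set `U` cover almost every point of their union
exactly `m` times, then the integral over the union is obtained by summing over the copies. -/
theorem mul_setIntegral_iUnion (hU : MeasurableSet U) (hU' : U =ᵐ[μHE[d]] U')
    (hm : ∀ j, ∀ x ∈ U', {k | ι j x ∈ ι k '' U}.ncard = m)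
    (hf : ∀ j, IntegrableOn (f ∘ ι j) U μHE[d]) :
    m * ∫ x in ⋃ j, ι j '' U, f x ∂μHE[d] = ∑ j, ∫ x in U, f (ι j x) ∂μHE[d] := by
  classical
  have hmeas : ∀ j, MeasurableSet (ι j '' U) := fun j =>
    (measurableEmbedding_affineIsometryEquiv (ι j)).measurableSet_image.mpr hU
  have hint : ∀ j, IntegrableOn f (ι j '' U) μHE[d] := fun j =>
    ((measurePreserving_affineIsometryEquiv (ι j) d).integrableOn_image
      (measurableEmbedding_affineIsometryEquiv (ι j))).mpr (hf j)
  have hae : ∀ j, ∀ᵐ x ∂(μHE[d] : Measure E3), x ∈ ι j '' U → {k | x ∈ ι k '' U}.ncard = m := by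
    intro j
    -- Points outside `U'` may have the wrong multiplicity, but isometries preserve Hausdorff
    -- measure, so their images stay null.
    have h0 : μHE[d] (ι j '' (U \ U')) = 0 := by
      rw [(ι j).isometry.euclideanHausdorffMeasure_image]
      exact ae_le_set.mp hU'.le
    filter_upwards [measure_eq_zero_iff_ae_notMem.mp h0] with x hx
    rintro ⟨y, hy, rfl⟩
    refine hm j y ?_
    by_contra hy'
    exact hx ⟨y, ⟨hy, hy'⟩, rfl⟩
  have hsum : ∀ᵐ x ∂(μHE[d] : Measure E3), m * (⋃ j, ι j '' U).indicator f x =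
      ∑ j, (ι j '' U).indicator f x := by
    filter_upwards [ae_all_iff.mpr hae] with x hx
    by_cases hxU : x ∈ ⋃ j, ι j '' U
    · obtain ⟨j, hj⟩ := mem_iUnion.mp hxU
      rw [indicator_of_mem hxU, ← hx j hj]
      simp only [indicator_apply]
      rw [← Finset.sum_filter, Finset.sum_const, nsmul_eq_mul]
      congr 2
      rw [← ncard_coe_finset]
      simp
    · rw [indicator_of_notMem hxU, mul_zero, Finset.sum_eq_zero]
      exact fun j _ => indicator_of_notMem (fun h => hxU (mem_iUnion.mpr ⟨j, h⟩)) f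
  rw [← integral_indicator (MeasurableSet.iUnion hmeas), ← integral_const_mul,
    integral_congr_ae hsum, integral_finsetSum _ fun j _ => (hint j).integrable_indicator (hmeas j)]
  refine Finset.sum_congr rfl fun j _ => ?_
  rw [integral_indicator (hmeas j)]
  exact (measurePreserving_affineIsometryEquiv (ι j) d).setIntegral_image_emb
    (measurableEmbedding_affineIsometryEquiv (ι j)) f U

theorem integrableOn_iUnion_image (hf : ∀ j, IntegrableOn (f ∘ ι j) U μHE[d]) :
    IntegrableOn f (⋃ j, ι j '' U) μHE[d] :=
  integrableOn_finite_iUnion.mpr fun j =>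
    ((measurePreserving_affineIsometryEquiv (ι j) d).integrableOn_image
      (measurableEmbedding_affineIsometryEquiv (ι j))).mpr (hf j)

/-- The multiplicity `m` divides both the integral of `f` and the measure of the union, which is the
same formula for the constant 1, so it cancels in the quotient. -/
theorem avg_iUnion_image [Nonempty J] (hU : MeasurableSet U) (hU' : U =ᵐ[μHE[d]] U')
    (hfin : μHE[d] U ≠ ⊤) (hm0 : m ≠ 0)
    (hm : ∀ j, ∀ x ∈ U', {k | ι j x ∈ ι k '' U}.ncard = m)
    (hf : ∀ j, IntegrableOn (f ∘ ι j) U μHE[d]) :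
    Avg d f (⋃ j, ι j '' U) =
      Avg d (fun x => (Fintype.card J : ℝ)⁻¹ * ∑ j, f (ι j x)) U := by
  have h1 := mul_setIntegral_iUnion hU hU' hm hf
  have h2 := mul_setIntegral_iUnion (f := fun _ => 1) hU hU' hm
    (fun j => integrableOn_const hfin)
  have hm' : (m : ℝ) ≠ 0 := Nat.cast_ne_zero.mpr hm0
  have hJ : (Fintype.card J : ℝ) ≠ 0 := Nat.cast_ne_zero.mpr Fintype.card_ne_zero
  simp only [setIntegral_const, smul_eq_mul, mul_one, Finset.sum_const, Finset.card_univ,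
    nsmul_eq_mul] at h2
  have h3 : (μHE[d]).real (⋃ j, ι j '' U) = (m : ℝ)⁻¹ * (Fintype.card J * (μHE[d]).real U) := by
    rw [← h2]
    field_simp
  have h4 : ∫ x in ⋃ j, ι j '' U, f x ∂μHE[d] =
      (m : ℝ)⁻¹ * ∑ j, ∫ x in U, f (ι j x) ∂μHE[d] := by
    rw [← h1]
    field_simp
  have h5 : ∫ x in U, ∑ j, f (ι j x) ∂μHE[d] = ∑ j, ∫ x in U, f (ι j x) ∂μHE[d] :=
    integral_finsetSum _ fun j _ => hf j
  rw [Avg, Avg, h3, h4, integral_const_mul, h5]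
  simp only [mul_inv, inv_inv]
  field_simp

end Union

end Platonic

/-! ### Trigonometry and convex geometry of regular polygons -/

namespace Platonic

open Module Set

section Trig

/-- An odd multiple of `π/n` stays at distance at least `π/n` from the multiples of `2π`. Reduction
modulo `2n` keeps the multiplier odd, hence at least 1, and the reflection `b ↦ 2n - b` brings it
into `[1, n]`, where the cosine decreases. -/
theorem cos_odd_mul_le {n : ℕ} (hn : 0 < n) (a : ℤ) :
    Real.cos ((2 * a + 1) * Real.pi / n) ≤ Real.cos (Real.pi / n) := by
  have hn' : (0 : ℝ) < n := Nat.cast_pos.mpr hn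
  have hpi := Real.pi_pos
  have key : ∀ b : ℤ, 1 ≤ b → b ≤ n → Real.cos (b * Real.pi / n) ≤ Real.cos (Real.pi / n) := by
    intro b hb1 hbn
    have h1 : (1 : ℝ) ≤ b := by exact_mod_cast hb1
    have h2 : (b : ℝ) ≤ n := by exact_mod_cast hbn
    apply Real.cos_le_cos_of_nonneg_of_le_pi (by positivity)
    · rw [div_le_iff₀ hn']
      nlinarith
    · gcongr
      nlinarith
  obtain ⟨b, q, hab, hb0, hbn⟩ : ∃ b q : ℤ, 2 * a + 1 = b + 2 * n * q ∧ 1 ≤ b ∧ b < 2 * n := by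
    refine ⟨(2 * a + 1) % (2 * n), (2 * a + 1) / (2 * n), (Int.emod_add_mul_ediv _ _).symm, ?_,
      Int.emod_lt_of_pos _ (by omega)⟩
    have h1 := Int.emod_nonneg (2 * a + 1) (b := 2 * n) (by omega)
    have h2 : ((2 * a + 1) % (2 * n)) % 2 = 1 := by
      rw [Int.emod_emod_of_dvd _ (Dvd.intro _ rfl)]
      omega
    omega
  have hab' : (2 * a + 1 : ℝ) = b + 2 * n * q := by exact_mod_cast hab
  have h3 : (2 * a + 1 : ℝ) * Real.pi / n = b * Real.pi / n + q * (2 * Real.pi) := by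
    rw [hab']
    field_simp
  rw [h3, Real.cos_add_int_mul_two_pi]
  by_cases h : b ≤ n
  · exact key b hb0 h
  · have h4 : (b : ℝ) * Real.pi / n = 2 * Real.pi - ((2 * n - b : ℤ) : ℝ) * Real.pi / n := by
      push_cast
      field_simp
      ring
    rw [h4, Real.cos_two_pi_sub]
    exact key _ (by omega) (by omega)

/-- Both `2D - 1` and `2D + 1` are `±1` modulo `2n`. The one choice of signs not giving `n ∣ D`
would force `n ∣ 2`. Geometrically, a side is determined by its two ends being extremal for its
normal. -/
theorem dvd_of_cos_eq {n : ℕ} (hn : 3 ≤ n) {D : ℤ}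
    (h1 : Real.cos ((2 * (D - 1 : ℤ) + 1) * Real.pi / n) = Real.cos (Real.pi / n))
    (h2 : Real.cos ((2 * D + 1) * Real.pi / n) = Real.cos (Real.pi / n)) : (n : ℤ) ∣ D := by
  have hn' : (n : ℝ) ≠ 0 := by positivity
  have hpi := Real.pi_ne_zero
  obtain ⟨k, hk⟩ := Real.cos_eq_cos_iff.mp h1
  obtain ⟨l, hl⟩ := Real.cos_eq_cos_iff.mp h2
  have hk' : (1 : ℤ) = 2 * k * n + (2 * (D - 1) + 1) ∨ (1 : ℤ) = 2 * k * n - (2 * (D - 1) + 1) := by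
    rcases hk with hk | hk
    · left
      field_simp at hk
      have : (1 : ℝ) = 2 * k * n + (2 * ((D - 1 : ℤ) : ℝ) + 1) := by linarith
      exact_mod_cast this
    · right
      field_simp at hk
      have : (1 : ℝ) = 2 * k * n - (2 * ((D - 1 : ℤ) : ℝ) + 1) := by linarith
      exact_mod_cast this
  have hl' : (1 : ℤ) = 2 * l * n + (2 * D + 1) ∨ (1 : ℤ) = 2 * l * n - (2 * D + 1) := by
    rcases hl with hl | hl
    · left
      field_simp at hl
      have : (1 : ℝ) = 2 * l * n + (2 * D + 1) := by linarith
      exact_mod_cast this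
    · right
      field_simp at hl
      have : (1 : ℝ) = 2 * l * n - (2 * D + 1) := by linarith
      exact_mod_cast this
  rcases hk' with hk | hk
  · rcases hl' with hl | hl
    · exact ⟨-l, by linarith⟩
    · exfalso
      have h3 : (n : ℤ) ∣ 2 := ⟨k + l, by linarith⟩
      have := Int.le_of_dvd (by norm_num) h3
      omega
  · exact ⟨k, by linarith⟩

/-- Real and imaginary parts of the vanishing sum of the `n`-th roots of unity; this places the
center at the mean of the vertices. -/
theorem sum_cos_sin_eq_zero {n : ℕ} (hn : 2 ≤ n) :
    ∑ k ∈ Finset.range n, Real.cos (2 * Real.pi * k / n) = 0 ∧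
      ∑ k ∈ Finset.range n, Real.sin (2 * Real.pi * k / n) = 0 := by
  have h := (Complex.isPrimitiveRoot_exp n (by omega)).geom_sum_eq_zero (by omega)
  have h2 : ∀ k : ℕ, Complex.exp (2 * Real.pi * Complex.I / n) ^ k =
      Complex.exp ((2 * Real.pi * k / n : ℝ) * Complex.I) := by
    intro k
    rw [← Complex.exp_nat_mul]
    congr 1
    push_cast
    ring
  simp only [h2] at h
  constructor
  · have := congrArg Complex.re h
    simpa only [Complex.re_sum, Complex.exp_ofReal_mul_I_re, Complex.zero_re] using this
  · have := congrArg Complex.im h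
    simpa only [Complex.im_sum, Complex.exp_ofReal_mul_I_im, Complex.zero_im] using this

end Trig

/-- The `k`-th vertex of the regular `n`-gon with center `c` and circumradius `r` in the plane
spanned by `u` and `v`. -/
noncomputable def polygonVertex (n : ℕ) (r : ℝ) (c u v : E3) (k : ℕ) : E3 :=
  c + (r * Real.cos (2 * Real.pi * k / n)) • u + (r * Real.sin (2 * Real.pi * k / n)) • v

/-- The solid regular `n`-gon with center `c` and circumradius `r` in the plane spanned by `u`
and `v`. -/
noncomputable def polygon (n : ℕ) (r : ℝ) (c u v : E3) : Set E3 :=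
  convexHull ℝ (range fun k : Fin n => polygonVertex n r c u v k)

/-- The unit normal of the side of the polygon joining the vertices `k` and `k + 1`. -/
noncomputable def sideNormal (n : ℕ) (u v : E3) (k : ℕ) : E3 :=
  Real.cos ((2 * k + 1) * Real.pi / n) • u + Real.sin ((2 * k + 1) * Real.pi / n) • v

section Polygon

variable {n : ℕ} {r : ℝ} {c u v : E3}

theorem polygonVertex_add_self (hn : 3 ≤ n) (k : ℕ) :
    polygonVertex n r c u v (k + n) = polygonVertex n r c u v k := by
  have h : 2 * Real.pi * ((k + n : ℕ) : ℝ) / n = 2 * Real.pi * k / n + 2 * Real.pi := by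
    have : (n : ℝ) ≠ 0 := by positivity
    push_cast
    field_simp
  rw [polygonVertex, h, Real.cos_add_two_pi, Real.sin_add_two_pi, polygonVertex]

theorem polygonVertex_mod (hn : 3 ≤ n) (k : ℕ) :
    polygonVertex n r c u v (k % n) = polygonVertex n r c u v k := by
  conv_rhs => rw [← Nat.mod_add_div k n]
  generalize k / n = q
  induction q with
  | zero => simp
  | succ q ih => rw [mul_add, mul_one, ← add_assoc, polygonVertex_add_self hn, ih]

theorem polygonVertex_congr (hn : 3 ≤ n) {k l : ℕ} (h : k % n = l % n) :
    polygonVertex n r c u v k = polygonVertex n r c u v l := by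
  rw [← polygonVertex_mod hn k, h, polygonVertex_mod hn]

theorem range_polygonVertex (hn : 3 ≤ n) :
    (range fun k : Fin n => polygonVertex n r c u v k) = range (polygonVertex n r c u v) := by
  ext x
  constructor
  · rintro ⟨k, rfl⟩
    exact ⟨k, rfl⟩
  · rintro ⟨k, rfl⟩
    exact ⟨⟨k % n, Nat.mod_lt _ (by omega)⟩, polygonVertex_mod hn k⟩

theorem polygonVertex_mem (hn : 3 ≤ n) (k : ℕ) :
    polygonVertex n r c u v k ∈ polygon n r c u v := by
  rw [polygon, range_polygonVertex hn]
  exact subset_convexHull ℝ _ ⟨k, rfl⟩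

theorem inner_circle (hu : ‖u‖ = 1) (hv : ‖v‖ = 1) (huv : inner ℝ u v = 0) (a b a' b' : ℝ) :
    inner ℝ (a • u + b • v) (a' • u + b' • v) = a * a' + b * b' := by
  have hvu : inner ℝ v u = 0 := by rw [real_inner_comm]; exact huv
  simp only [inner_add_left, inner_add_right, inner_smul_left, inner_smul_right,
    real_inner_self_eq_norm_sq, hu, hv, huv, hvu]
  simp
  ring

theorem polygonVertex_sub (k : ℕ) : polygonVertex n r c u v k - c =
    (r * Real.cos (2 * Real.pi * k / n)) • u + (r * Real.sin (2 * Real.pi * k / n)) • v := by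
  rw [polygonVertex]
  abel

/-- The standing assumptions on the data defining a regular polygon. -/
structure PolygonFrame (n : ℕ) (r : ℝ) (u v : E3) : Prop where
  hn : 3 ≤ n
  hr : 0 < r
  hu : ‖u‖ = 1
  hv : ‖v‖ = 1
  huv : inner ℝ u v = 0

theorem inner_polygonVertex_sub (P : PolygonFrame n r u v) (i k : ℕ) :
    inner ℝ (polygonVertex n r c u v i - c) (polygonVertex n r c u v k - c) =
      r ^ 2 * Real.cos (2 * Real.pi * ((i : ℝ) - k) / n) := by
  rw [polygonVertex_sub, polygonVertex_sub, inner_circle P.hu P.hv P.huv]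
  have : 2 * Real.pi * ((i : ℝ) - k) / n = 2 * Real.pi * i / n - 2 * Real.pi * k / n := by ring
  rw [this, Real.cos_sub]
  ring

theorem norm_polygonVertex_sub (P : PolygonFrame n r u v) (k : ℕ) : ‖polygonVertex n r c u v k - c‖ = r := by
  have h := inner_polygonVertex_sub (r := r) (c := c) P k k
  rw [real_inner_self_eq_norm_sq] at h
  simp only [sub_self, mul_zero, zero_div, Real.cos_zero, mul_one] at h
  exact (sq_eq_sq₀ (norm_nonneg _) P.hr.le).mp h

/-- The normal of side `i` points halfway between the vertices `i` and `i + 1`, so its angle to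
vertex `k` is an odd multiple of `π/n`, written in the shape required by `cos_odd_mul_le`. -/
theorem inner_sideNormal (P : PolygonFrame n r u v) (i k : ℕ) :
    inner ℝ (sideNormal n u v i) (polygonVertex n r c u v k - c) =
      r * Real.cos ((2 * ((k : ℤ) - i - 1 : ℤ) + 1) * Real.pi / n) := by
  rw [polygonVertex_sub, sideNormal, inner_circle P.hu P.hv P.huv]
  have : (2 * ((k : ℤ) - i - 1 : ℤ) + 1) * Real.pi / n =
      2 * Real.pi * k / n - (2 * i + 1) * Real.pi / n := by
    push_cast
    ring
  rw [this, Real.cos_sub]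
  ring

theorem inner_sideNormal_self (P : PolygonFrame n r u v) (i : ℕ) :
    inner ℝ (sideNormal n u v i) (polygonVertex n r c u v i - c) = r * Real.cos (Real.pi / n) := by
  rw [inner_sideNormal P]
  have : (2 * ((i : ℤ) - i - 1 : ℤ) + 1) * Real.pi / n = -(Real.pi / n) := by
    push_cast
    ring
  rw [this, Real.cos_neg]

theorem inner_sideNormal_succ (P : PolygonFrame n r u v) (i : ℕ) :
    inner ℝ (sideNormal n u v i) (polygonVertex n r c u v (i + 1) - c) =
      r * Real.cos (Real.pi / n) := by
  rw [inner_sideNormal P]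
  have : (2 * (((i + 1 : ℕ) : ℤ) - i - 1 : ℤ) + 1) * Real.pi / n = Real.pi / n := by
    push_cast
    ring
  rw [this]

theorem inner_sideNormal_le (P : PolygonFrame n r u v) (i k : ℕ) :
    inner ℝ (sideNormal n u v i) (polygonVertex n r c u v k - c) ≤
      r * Real.cos (Real.pi / n) := by
  rw [inner_sideNormal P]
  exact mul_le_mul_of_nonneg_left (cos_odd_mul_le (by have := P.hn; omega) _) P.hr.le

theorem inner_sideNormal_le_of_mem (P : PolygonFrame n r u v) (i : ℕ) {y : E3} (hy : y ∈ polygon n r c u v) :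
    inner ℝ (sideNormal n u v i) (y - c) ≤ r * Real.cos (Real.pi / n) := by
  have h : polygon n r c u v ⊆
      {y | inner ℝ (sideNormal n u v i) (y - c) ≤ r * Real.cos (Real.pi / n)} := by
    refine convexHull_min ?_ ?_
    · rintro _ ⟨k, rfl⟩
      exact inner_sideNormal_le P i k
    · have := (convex_halfSpace_le (𝕜 := ℝ) (innerₛₗ ℝ (sideNormal n u v i)).isLinear
        (r * Real.cos (Real.pi / n) + inner ℝ (sideNormal n u v i) c))
      simpa [inner_sub_right] using this
  exact h hy

theorem cos_pi_div_pos (hn : 3 ≤ n) : 0 < Real.cos (Real.pi / n) := by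
  have h3 : (3 : ℝ) ≤ n := by exact_mod_cast hn
  have hpi := Real.pi_pos
  refine Real.cos_pos_of_mem_Ioo ⟨by have : 0 < Real.pi / n := by positivity
                                     linarith, ?_⟩
  rw [div_lt_div_iff₀ (by linarith) (by norm_num)]
  nlinarith

/-- The polygon lies in the ball of radius `r` about `c`, and its vertices lie on the sphere, all of
whose points are extreme in the ball. -/
theorem extremePoints_polygon (P : PolygonFrame n r u v) :
    (polygon n r c u v).extremePoints ℝ = range (polygonVertex n r c u v) := by
  apply Subset.antisymm
  · rw [polygon, range_polygonVertex P.hn]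
    exact extremePoints_convexHull_subset
  · rintro _ ⟨k, rfl⟩
    have hsub : polygon n r c u v ⊆ Metric.closedBall c r := by
      refine convexHull_min ?_ (convex_closedBall c r)
      rintro _ ⟨k, rfl⟩
      rw [mem_closedBall_iff_norm, norm_polygonVertex_sub P]
    refine inter_extremePoints_subset_extremePoints_of_subset hsub
      ⟨polygonVertex_mem P.hn k, StrictConvexSpace.sphere_subset_extremePoints_closedBall c P.hr.ne' ?_⟩
    rw [mem_sphere_iff_norm, norm_polygonVertex_sub P]

theorem sum_polygonVertex (hn : 3 ≤ n) : ∑ k ∈ Finset.range n, polygonVertex n r c u v k = (n : ℝ) • c := by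
  obtain ⟨h1, h2⟩ := sum_cos_sin_eq_zero (n := n) (by omega)
  simp only [polygonVertex, Finset.sum_add_distrib, ← Finset.sum_smul, ← Finset.mul_sum, h1, h2]
  simp [Nat.cast_smul_eq_nsmul]

theorem center_mem_polygon (hn : 3 ≤ n) : c ∈ polygon n r c u v := by
  have hn' : (n : ℝ) ≠ 0 := by positivity
  have h := (convex_convexHull ℝ (range fun k : Fin n => polygonVertex n r c u v k)).sum_mem
    (t := Finset.range n) (w := fun _ => (n : ℝ)⁻¹) (z := polygonVertex n r c u v)
    (fun _ _ => by positivity) (by simp [hn']) (fun k _ => polygonVertex_mem hn k)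
  rw [← Finset.smul_sum, sum_polygonVertex hn, smul_smul, inv_mul_cancel₀ hn', one_smul] at h
  exact h

/-- The normal of a side is maximal over the vertices at the two ends of that side. Testing the
equation with both normals gives `s + t ≤ s' + t'` and the reverse, so equality holds throughout; as
`s` and `t` are positive, the normal of side `k` is also maximal at the vertices `i` and `i + 1`. -/
theorem sector_unique (P : PolygonFrame n r u v) {s t s' t' : ℝ} {i k : ℕ} (hs : 0 < s) (ht : 0 < t) (hs' : 0 ≤ s')
    (ht' : 0 ≤ t')
    (h : s • (polygonVertex n r c u v i - c) + t • (polygonVertex n r c u v (i + 1) - c) =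
      s' • (polygonVertex n r c u v k - c) + t' • (polygonVertex n r c u v (k + 1) - c)) :
    i % n = k % n := by
  have e1 := congrArg (inner ℝ (sideNormal n u v i)) h
  have e2 := congrArg (inner ℝ (sideNormal n u v k)) h
  simp only [inner_add_right, inner_smul_right, inner_sideNormal_self P,
    inner_sideNormal_succ P] at e1 e2
  have l1 := inner_sideNormal_le (c := c) P i k
  have l2 := inner_sideNormal_le (c := c) P i (k + 1)
  have l3 := inner_sideNormal_le (c := c) P k i
  have l4 := inner_sideNormal_le (c := c) P k (i + 1)
  have q1 : inner ℝ (sideNormal n u v k) (polygonVertex n r c u v i - c) =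
      r * Real.cos (Real.pi / n) := by
    refine le_antisymm l3 ?_
    by_contra! hlt
    nlinarith [mul_lt_mul_of_pos_left hlt hs, mul_le_mul_of_nonneg_left l4 ht.le,
      mul_le_mul_of_nonneg_left l1 hs', mul_le_mul_of_nonneg_left l2 ht']
  have q2 : inner ℝ (sideNormal n u v k) (polygonVertex n r c u v (i + 1) - c) =
      r * Real.cos (Real.pi / n) := by
    refine le_antisymm l4 ?_
    by_contra! hlt
    nlinarith [mul_lt_mul_of_pos_left hlt ht, mul_le_mul_of_nonneg_left l3 hs.le,
      mul_le_mul_of_nonneg_left l1 hs', mul_le_mul_of_nonneg_left l2 ht']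
  rw [inner_sideNormal P] at q1 q2
  have q1' := mul_left_cancel₀ P.hr.ne' q1
  have q2' := mul_left_cancel₀ P.hr.ne' q2
  have hd : (n : ℤ) ∣ (i : ℤ) - k := by
    refine dvd_of_cos_eq P.hn q1' ?_
    rw [← q2']
    push_cast
    congr 3
    ring
  exact ((Nat.modEq_iff_dvd).mpr hd).symm

theorem polygonVertex_inj (P : PolygonFrame n r u v) {i k : ℕ} (h : polygonVertex n r c u v i = polygonVertex n r c u v k) :
    i % n = k % n := by
  have h1 := inner_polygonVertex_sub (r := r) (c := c) P i k
  rw [h, real_inner_self_eq_norm_sq, norm_polygonVertex_sub P] at h1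
  have h2 : Real.cos (2 * Real.pi * ((i : ℝ) - k) / n) = 1 := by
    have : r ^ 2 ≠ 0 := pow_ne_zero 2 P.hr.ne'
    exact mul_left_cancel₀ this (by linarith)
  obtain ⟨m, hm⟩ := (Real.cos_eq_one_iff _).mp h2
  have hn := P.hn
  have hn' : (n : ℝ) ≠ 0 := by positivity
  have hpi := Real.pi_ne_zero
  have hd : (n : ℤ) ∣ (i : ℤ) - k := by
    refine ⟨m, ?_⟩
    field_simp at hm
    have hm' : (m : ℝ) * n = i - k := by linarith
    have : ((i : ℤ) - k : ℤ) = m * n := by exact_mod_cast hm'.symm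
    rw [this, mul_comm]
  exact ((Nat.modEq_iff_dvd).mpr hd).symm

theorem mem_span_of_mem_polygon {y : E3} (hy : y ∈ polygon n r c u v) :
    ∃ a b : ℝ, y - c = a • u + b • v := by
  have h : polygon n r c u v ⊆ {y | ∃ a b : ℝ, y - c = a • u + b • v} := by
    refine convexHull_min ?_ ?_
    · rintro _ ⟨k, rfl⟩
      exact ⟨_, _, polygonVertex_sub k⟩
    · rintro x ⟨a, b, hx⟩ y ⟨a', b', hy⟩ s t hs ht hst
      refine ⟨s * a + t * a', s * b + t * b', ?_⟩
      have : s • x + t • y - c = s • (x - c) + t • (y - c) := by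
        obtain rfl : t = 1 - s := by linarith
        module
      rw [this, hx, hy]
      module
  exact h hy

theorem exists_polar (a b : ℝ) :
    ∃ ρ α : ℝ, 0 ≤ ρ ∧ 0 ≤ α ∧ a = ρ * Real.cos α ∧ b = ρ * Real.sin α := by
  -- A full turn is added to make the angle nonnegative, so that the index of a sector can be a
  -- natural number.
  refine ⟨‖(⟨a, b⟩ : ℂ)‖, Complex.arg ⟨a, b⟩ + 2 * Real.pi, norm_nonneg _, ?_, ?_, ?_⟩
  · have := Complex.neg_pi_lt_arg ⟨a, b⟩
    linarith [Real.pi_pos]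
  · rw [Real.cos_add_two_pi, Complex.norm_mul_cos_arg]
  · rw [Real.sin_add_two_pi, Complex.norm_mul_sin_arg]

/-- A regular polygon is the union of the triangles spanned by its center and its sides. -/
theorem exists_mem_triangle (P : PolygonFrame n r u v) {y : E3} (hy : y ∈ polygon n r c u v) :
    ∃ i : ℕ, y ∈ convexHull ℝ {c, polygonVertex n r c u v i, polygonVertex n r c u v (i + 1)} := by
  obtain ⟨a, b, hab⟩ := mem_span_of_mem_polygon hy
  obtain ⟨ρ, α, hρ, hα, rfl, rfl⟩ := exists_polar a b
  have hn : (3 : ℝ) ≤ n := by exact_mod_cast P.hn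
  have hpi := Real.pi_pos
  have hr := P.hr
  set φ := 2 * Real.pi / n with hφ
  have hφ0 : 0 < φ := by positivity
  have hφpi : φ < Real.pi := by
    rw [hφ, div_lt_iff₀ (by linarith)]
    nlinarith
  have hsin : 0 < Real.sin φ := Real.sin_pos_of_pos_of_lt_pi hφ0 hφpi
  -- The index of the sector of opening `φ` that contains the direction of `y`; below, `β` is the
  -- angle left inside it.
  set i := ⌊α / φ⌋₊
  have hi1 : i * φ ≤ α := (le_div_iff₀ hφ0).mp (Nat.floor_le (by positivity))
  have hi2 : α < (i + 1) * φ := (div_lt_iff₀ hφ0).mp (Nat.lt_floor_add_one _)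
  obtain ⟨β, hβ⟩ : ∃ β, α = i * φ + β := ⟨α - i * φ, by ring⟩
  -- Cramer's rule for the vector of length `ρ` at angle `β`, in the basis of two vectors of length
  -- `r` at angles `0` and `φ`.
  set s := ρ * Real.sin (φ - β) / (r * Real.sin φ) with hs
  set t := ρ * Real.sin β / (r * Real.sin φ) with ht
  have hs0 : 0 ≤ s := by
    have : 0 ≤ Real.sin (φ - β) := Real.sin_nonneg_of_nonneg_of_le_pi
      (by linarith) (by linarith)
    positivity
  have ht0 : 0 ≤ t := by
    have : 0 ≤ Real.sin β := Real.sin_nonneg_of_nonneg_of_le_pi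
      (by linarith) (by linarith)
    positivity
  have e1 : 2 * Real.pi * (i : ℝ) / n = i * φ := by rw [hφ]; ring
  have e2 : 2 * Real.pi * ((i + 1 : ℕ) : ℝ) / n = i * φ + φ := by rw [hφ]; push_cast; ring
  have hdecomp : y - c = s • (polygonVertex n r c u v i - c) +
      t • (polygonVertex n r c u v (i + 1) - c) := by
    rw [hab, polygonVertex_sub, polygonVertex_sub, e1, e2]
    have c1 : ρ * Real.cos α = s * (r * Real.cos (i * φ)) + t * (r * Real.cos (i * φ + φ)) := by
      rw [hβ, hs, ht, Real.cos_add, Real.cos_add, Real.sin_sub]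
      field_simp
      ring
    have c2 : ρ * Real.sin α = s * (r * Real.sin (i * φ)) + t * (r * Real.sin (i * φ + φ)) := by
      rw [hβ, hs, ht, Real.sin_add, Real.sin_add, Real.sin_sub]
      field_simp
      ring
    rw [c1, c2]
    module
  -- Only here is membership in the polygon, rather than in its plane, used: `y` does not lie beyond
  -- side `i`.
  have hsum : s + t ≤ 1 := by
    have h1 := inner_sideNormal_le_of_mem P i hy
    rw [hdecomp, inner_add_right, inner_smul_right, inner_smul_right, inner_sideNormal_self P,
      inner_sideNormal_succ P] at h1
    have h2 : 0 < r * Real.cos (Real.pi / n) := mul_pos hr (cos_pi_div_pos P.hn)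
    nlinarith
  refine ⟨i, mem_convexHull_triple.mpr ⟨1 - s - t, s, t, by linarith, hs0, ht0, by ring, ?_⟩⟩
  rw [← sub_eq_zero] at hdecomp ⊢
  rw [← hdecomp]
  module

/-- If the vertices of a regular polygon lie on a sphere, the center of the polygon is the
orthogonal projection of the center of the sphere. -/
theorem inner_center_eq_zero (P : PolygonFrame n r u v) {O : E3} {R : ℝ}
    (h : ∀ k, ‖polygonVertex n r c u v k - O‖ = R) :
    inner ℝ (c - O) u = 0 ∧ inner ℝ (c - O) v = 0 ∧ ‖c - O‖ ^ 2 + r ^ 2 = R ^ 2 := by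
  have hr := P.hr
  have hn : (3 : ℝ) ≤ n := by exact_mod_cast P.hn
  have hpi := Real.pi_pos
  set A := inner ℝ (c - O) u with hA
  set B := inner ℝ (c - O) v with hB
  have key : ∀ k : ℕ, ‖c - O‖ ^ 2 + r ^ 2 + 2 * r * (Real.cos (2 * Real.pi * k / n) * A +
      Real.sin (2 * Real.pi * k / n) * B) = R ^ 2 := by
    intro k
    rw [← h k]
    have h1 : polygonVertex n r c u v k - O = (c - O) + (polygonVertex n r c u v k - c) := by abel
    rw [h1, norm_add_sq_real, norm_polygonVertex_sub P, polygonVertex_sub, inner_add_right,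
      inner_smul_right, inner_smul_right, ← hA, ← hB]
    ring
  -- Three vertices suffice. Vertices `1` and `n - 1` are mirror images in the axis through vertex
  -- `0`, so their difference isolates `B`; comparison of `0` with `1` then isolates `A`.
  have k0 := key 0
  have k1 := key 1
  have k2 := key (n - 1)
  have hφ : 2 * Real.pi * ((n - 1 : ℕ) : ℝ) / n = -(2 * Real.pi * ((1 : ℕ) : ℝ) / n) +
      2 * Real.pi := by
    have := P.hn
    push_cast [Nat.cast_sub (by omega : 1 ≤ n)]
    field_simp
    ring
  rw [hφ, Real.cos_add_two_pi, Real.sin_add_two_pi, Real.cos_neg, Real.sin_neg] at k2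
  simp only [Nat.cast_zero, mul_zero, zero_div, Real.cos_zero, Real.sin_zero, zero_mul, add_zero,
    one_mul, Nat.cast_one, mul_one] at k0 k1 k2
  have hφ0 : 0 < 2 * Real.pi / n := by positivity
  have hφpi : 2 * Real.pi / n < Real.pi := by
    rw [div_lt_iff₀ (by linarith)]
    nlinarith
  have hsin : Real.sin (2 * Real.pi / n) ≠ 0 := (Real.sin_pos_of_pos_of_lt_pi hφ0 hφpi).ne'
  have hcos : Real.cos (2 * Real.pi / n) - 1 ≠ 0 := by
    have := Real.cos_lt_cos_of_nonneg_of_le_pi le_rfl hφpi.le hφ0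
    rw [Real.cos_zero] at this
    linarith
  have hB0 : B = 0 := by
    have : (4 * r * Real.sin (2 * Real.pi / n)) * B = 0 := by linarith
    exact (mul_eq_zero.mp this).resolve_left (by positivity)
  rw [hB0] at k1
  have hA0 : A = 0 := by
    have : (2 * r * (Real.cos (2 * Real.pi / n) - 1)) * A = 0 := by linarith
    exact (mul_eq_zero.mp this).resolve_left (mul_ne_zero (by positivity) hcos)
  refine ⟨hA0, hB0, ?_⟩
  rw [hA0] at k0
  linarith

end Polygon

end Platonic

/-! ### Faces of polytopes and the half-space description -/

namespace Platonic

open Module Set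

section Polytope

variable {V B : Set E3}

/-- An exposed face is the closed convex hull of its extreme points (Krein–Milman), and these form a
subset of the finite set `V`. -/
theorem finite_exposed (hV : V.Finite) (hB : B = convexHull ℝ V) :
    {F : Set E3 | F.Nonempty ∧ IsExposed ℝ B F}.Finite := by
  have hBc : IsCompact B := hB ▸ hV.isCompact_convexHull ℝ
  have hBconv : Convex ℝ B := hB ▸ convex_convexHull ℝ V
  have hfin : (extremePoints ℝ '' {F : Set E3 | F.Nonempty ∧ IsExposed ℝ B F}).Finite := by
    refine hV.finite_subsets.subset ?_
    rintro _ ⟨F, ⟨-, hF⟩, rfl⟩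
    have h1 := hF.isExtreme.extremePoints_subset_extremePoints
    rw [hB] at h1
    exact h1.trans extremePoints_convexHull_subset
  refine hfin.of_finite_image ?_
  rintro F ⟨-, hF⟩ G ⟨-, hG⟩ h
  rw [← closure_convexHull_extremePoints (hF.isCompact hBc) (hF.convex hBconv),
    ← closure_convexHull_extremePoints (hG.isCompact hBc) (hG.convex hBconv)]
  exact congrArg (fun s => closure (convexHull ℝ s)) h

/-- The face of `B` on which the functional with gradient `w` is maximal. -/
def faceOf (B : Set E3) (w : E3) : Set E3 := {x ∈ B | ∀ y ∈ B, inner ℝ w y ≤ inner ℝ w x}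

theorem isExposed_faceOf (B : Set E3) (w : E3) : IsExposed ℝ B (faceOf B w) :=
  fun _ => ⟨innerSL ℝ w, rfl⟩

theorem exists_eq_faceOf {F : Set E3} (hne : F.Nonempty) (hF : IsExposed ℝ B F) :
    ∃ w, F = faceOf B w := by
  obtain ⟨l, hl⟩ := hF hne
  refine ⟨(InnerProductSpace.toDual ℝ E3).symm l, ?_⟩
  simp only [faceOf, InnerProductSpace.toDual_symm_apply]
  exact hl

theorem inner_eq_of_mem_faceOf {w x y : E3} (hx : x ∈ faceOf B w) (hy : y ∈ faceOf B w) :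
    inner ℝ w x = inner ℝ w y :=
  le_antisymm (hy.2 x hx.1) (hx.2 y hy.1)

theorem vectorSpan_faceOf_le (w : E3) : vectorSpan ℝ (faceOf B w) ≤ (ℝ ∙ w)ᗮ := by
  rw [vectorSpan, Submodule.span_le]
  rintro _ ⟨x, hx, y, hy, rfl⟩
  rw [SetLike.mem_coe, Submodule.mem_orthogonal_singleton_iff_inner_right]
  change inner ℝ w (x - y) = 0
  rw [inner_sub_right, inner_eq_of_mem_faceOf hx hy, sub_self]

theorem finrank_vectorSpan_faceOf_le {w : E3} (hw : w ≠ 0) :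
    finrank ℝ (vectorSpan ℝ (faceOf B w)) ≤ 2 := by
  have : Fact (finrank ℝ E3 = 2 + 1) := ⟨by simp⟩
  refine (Submodule.finrank_mono (vectorSpan_faceOf_le w)).trans ?_
  rw [Submodule.finrank_orthogonal_span_singleton (n := 2) hw]

theorem finrank_vectorSpan_of_interior (hint : (interior B).Nonempty) :
    finrank ℝ (vectorSpan ℝ B) = 3 := by
  have h1 : affineSpan ℝ (interior B) = ⊤ := isOpen_interior.affineSpan_eq_top hint
  have h2 : affineSpan ℝ B = ⊤ := top_le_iff.mp (h1 ▸ affineSpan_mono ℝ interior_subset)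
  rw [← direction_affineSpan, h2, AffineSubspace.direction_top, finrank_top]
  simp

/-- The zero functional exposes all of `B`, which has dimension 3. -/
theorem ne_zero_of_isFace {F : Set E3} {k : ℕ} (hk : k < 3) (hint : (interior B).Nonempty)
    (hF : IsFace k B F) {w : E3} (hw : F = faceOf B w) : w ≠ 0 := by
  rintro rfl
  have : faceOf B 0 = B := by
    ext x
    simp [faceOf]
  have h := hF.2.2
  rw [hw, this, finrank_vectorSpan_of_interior hint] at h
  omega

theorem exists_faceOf_of_notMem_interior (hconv : Convex ℝ B) (hint : (interior B).Nonempty)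
    {z : E3} (hz : z ∈ B) (hz' : z ∉ interior B) :
    ∃ w, z ∈ faceOf B w ∧ ∀ y ∈ interior B, inner ℝ w y < inner ℝ w z := by
  obtain ⟨l, hl⟩ := geometric_hahn_banach_open_point hconv.interior isOpen_interior hz'
  refine ⟨(InnerProductSpace.toDual ℝ E3).symm l, ⟨hz, fun y hy => ?_⟩, fun y hy => ?_⟩
  · simp only [InnerProductSpace.toDual_symm_apply]
    have h1 : B ⊆ closure (interior B) :=
      (hconv.closure_interior_eq_closure_of_nonempty_interior hint).symm ▸ subset_closure
    have h2 : closure (interior B) ⊆ {y | l y ≤ l z} :=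
      closure_minimal (fun y hy => (hl y hy).le) (isClosed_le l.continuous continuous_const)
    exact h2 (h1 hy)
  · simpa only [InnerProductSpace.toDual_symm_apply] using hl y hy

/-- A convex polytope with nonempty interior is the intersection of the half-spaces determined by
its two-dimensional faces. -/
theorem mem_of_forall_isFace (hV : V.Finite) (hB : B = convexHull ℝ V)
    (hint : (interior B).Nonempty) {x : E3}
    (hx : ∀ w, IsFace 2 B (faceOf B w) → ∀ y ∈ faceOf B w, inner ℝ w x ≤ inner ℝ w y) : x ∈ B := by
  by_contra hxB
  have hconv : Convex ℝ B := hB ▸ convex_convexHull ℝ V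
  have hclosed : IsClosed B := hB ▸ hV.isClosed_convexHull ℝ
  -- The low-dimensional faces. If `x` satisfied all facet inequalities without lying in `B`, every
  -- segment from an interior point to `x` would leave `B` through one of them, and finitely many
  -- planes through `x` would cover the interior.
  set 𝒢 : Set (Set E3) :=
    {G | (G.Nonempty ∧ IsExposed ℝ B G) ∧ finrank ℝ (vectorSpan ℝ G) ≤ 1} with h𝒢
  have h𝒢fin : 𝒢.Finite := (finite_exposed hV hB).subset fun G hG => hG.1
  have hcover : interior B ⊆ ⋃ G ∈ 𝒢, (affineSpan ℝ (insert x G) : Set E3) := by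
    intro y hy
    obtain ⟨z, hzs, hzB, hzi⟩ : ∃ z ∈ segment ℝ y x, z ∈ B ∧ z ∉ interior B := by
      by_contra! h
      obtain ⟨z, -, hz1, hz2⟩ := (convex_segment (𝕜 := ℝ) y x).isPreconnected _ _ isOpen_interior
        hclosed.isOpen_compl
        (fun z hz => (em (z ∈ B)).imp (h z hz) id)
        ⟨y, left_mem_segment ℝ y x, hy⟩ ⟨x, right_mem_segment ℝ y x, hxB⟩
      exact hz2 (interior_subset hz1)
    rw [segment_eq_image_lineMap] at hzs
    obtain ⟨t, ⟨ht0, ht1⟩, rfl⟩ := hzs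
    have ht0' : 0 < t := by
      refine ht0.lt_of_ne ?_
      rintro rfl
      rw [AffineMap.lineMap_apply_zero] at hzi
      exact hzi hy
    have ht1' : t < 1 := by
      refine ht1.lt_of_ne ?_
      rintro rfl
      rw [AffineMap.lineMap_apply_one] at hzB
      exact hxB hzB
    obtain ⟨w, hw, hlt⟩ := exists_faceOf_of_notMem_interior hconv hint hzB hzi
    have hw0 : w ≠ 0 := by
      rintro rfl
      simpa using hlt y hy
    have hexp : IsExposed ℝ B (faceOf B w) := isExposed_faceOf B w
    have hdim := finrank_vectorSpan_faceOf_le (B := B) hw0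
    have hcase : finrank ℝ (vectorSpan ℝ (faceOf B w)) = 2 ∨
        finrank ℝ (vectorSpan ℝ (faceOf B w)) ≤ 1 := by omega
    rcases hcase with h2 | h1
    -- Leaving through a two-dimensional face is impossible: the functional is strictly smaller at
    -- `y` than at the exit point and, by hypothesis, no larger at `x`, while the exit point lies
    -- between them.
    · exfalso
      have h3 := hx w ⟨⟨_, hw⟩, hexp, h2⟩ _ hw
      have h4 := hlt y hy
      rw [AffineMap.lineMap_apply_module, inner_add_right, inner_smul_right, inner_smul_right]
        at h3 h4
      nlinarith
    · refine mem_iUnion₂.mpr ⟨faceOf B w, ⟨⟨⟨_, hw⟩, hexp⟩, h1⟩, ?_⟩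
      have hy' : y = AffineMap.lineMap x (AffineMap.lineMap y x t) (1 - t)⁻¹ := by
        have h5 : 1 - t ≠ 0 := by linarith
        have h6 : (AffineMap.lineMap y x t : E3) - x = (1 - t) • (y - x) := by
          rw [AffineMap.lineMap_apply_module]
          module
        rw [AffineMap.lineMap_apply_module' x, h6, smul_smul, inv_mul_cancel₀ h5]
        module
      rw [hy']
      exact AffineMap.lineMap_mem _ (subset_affineSpan ℝ _ (mem_insert _ _))
        (subset_affineSpan ℝ _ (mem_insert_of_mem _ hw))
  -- Each `G` has dimension at most 1, so together with `x` it spans at most a plane, which is null.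
  have hnull : volume (⋃ G ∈ 𝒢, (affineSpan ℝ (insert x G) : Set E3)) = 0 := by
    refine (measure_biUnion_null_iff h𝒢fin.countable).mpr fun G hG => ?_
    refine Measure.addHaar_affineSubspace volume _ fun htop => ?_
    have h1 := congrArg AffineSubspace.direction htop
    rw [direction_affineSpan, AffineSubspace.direction_top] at h1
    have h2 := finrank_vectorSpan_insert_le_set ℝ G x
    rw [h1, finrank_top] at h2
    have h3 : finrank ℝ E3 = 3 := by simp
    have := hG.2
    omega
  exact (isOpen_interior.measure_pos volume hint).ne' (measure_mono_null hcover hnull)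

end Polytope

end Platonic

/-! ### A Platonic solid is circumscribed about a sphere touching the faces at their centers -/

namespace Platonic

open Module Set

theorem exists_orthonormalBasis {u v w : E3} (hu : ‖u‖ = 1) (hv : ‖v‖ = 1) (hw : ‖w‖ = 1)
    (huv : inner ℝ u v = 0) (huw : inner ℝ u w = 0) (hvw : inner ℝ v w = 0) :
    ∃ b : OrthonormalBasis (Fin 3) ℝ E3, b 0 = u ∧ b 1 = v ∧ b 2 = w := by
  have hvu : inner ℝ v u = 0 := by rw [real_inner_comm]; exact huv
  have hwu : inner ℝ w u = 0 := by rw [real_inner_comm]; exact huw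
  have hwv : inner ℝ w v = 0 := by rw [real_inner_comm]; exact hvw
  have ho : Orthonormal ℝ ![u, v, w] := by
    rw [orthonormal_iff_ite]
    intro i j
    fin_cases i <;> fin_cases j <;>
      simp [hu, hv, hw, huv, huw, hvw, hvu, hwu, hwv]
  have hc : Fintype.card (Fin 3) = finrank ℝ E3 := by simp
  let b := (basisOfOrthonormalOfCardEqFinrank ho hc).toOrthonormalBasis (by
    rw [coe_basisOfOrthonormalOfCardEqFinrank]; exact ho)
  have hb : ∀ i, b i = ![u, v, w] i := fun i => by
    simp [b, coe_basisOfOrthonormalOfCardEqFinrank]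
  exact ⟨b, hb 0, hb 1, hb 2⟩

/-- Two vectors orthogonal to the same plane of space are proportional. -/
theorem exists_eq_smul_of_orthogonal {u v w a : E3} (hu : ‖u‖ = 1) (hv : ‖v‖ = 1) (hw : w ≠ 0)
    (huv : inner ℝ u v = 0) (hwu : inner ℝ w u = 0) (hwv : inner ℝ w v = 0)
    (hau : inner ℝ a u = 0) (hav : inner ℝ a v = 0) : ∃ l : ℝ, a = l • w := by
  have hw' : ‖w‖ ≠ 0 := norm_ne_zero_iff.mpr hw
  have huw : inner ℝ u w = 0 := by rw [real_inner_comm]; exact hwu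
  have hvw : inner ℝ v w = 0 := by rw [real_inner_comm]; exact hwv
  have hua : inner ℝ u a = 0 := by rw [real_inner_comm]; exact hau
  have hva : inner ℝ v a = 0 := by rw [real_inner_comm]; exact hav
  obtain ⟨b, h0, h1, h2⟩ := exists_orthonormalBasis (w := ‖w‖⁻¹ • w) hu hv
    (by rw [norm_smul, norm_inv, norm_norm, inv_mul_cancel₀ hw']) huv
    (by rw [inner_smul_right, huw, mul_zero]) (by rw [inner_smul_right, hvw, mul_zero])
  refine ⟨inner ℝ (‖w‖⁻¹ • w) a * ‖w‖⁻¹, ?_⟩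
  conv_lhs => rw [← b.sum_repr' a]
  rw [Fin.sum_univ_three, h0, h1, h2, hua, hva, zero_smul, zero_smul, zero_add, zero_add, smul_smul]

/-- The faces of a convex body `B` are regular polygons tangent, at their centers, to a common
sphere with center `O` and squared radius `H`. -/
structure FaceData (B : Set E3) (O : E3) (H : ℝ) (n : ℕ) (r : ℝ) {Φ : Type} (c u v : Φ → E3) :
    Prop where
  frame : ∀ F, PolygonFrame n r (u F) (v F)
  H_pos : 0 < H
  norm_sq : ∀ F, ‖c F - O‖ ^ 2 = H
  inner_u : ∀ F, inner ℝ (c F - O) (u F) = 0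
  inner_v : ∀ F, inner ℝ (c F - O) (v F) = 0
  inner_lt : ∀ F G, F ≠ G → inner ℝ (c F - O) (c G - O) < H
  mem_iff : ∀ x, x ∈ B ↔ ∀ F, inner ℝ (c F - O) (x - O) ≤ H
  mem_polygon_iff : ∀ F x, x ∈ polygon n r (c F) (u F) (v F) ↔
    x ∈ B ∧ inner ℝ (c F - O) (x - O) = H
  isBounded : Bornology.IsBounded B

theorem inner_normal_eq_zero {n : ℕ} {r : ℝ} {c u v w : E3} (P : PolygonFrame n r u v) {K : ℝ}
    (h : ∀ y ∈ polygon n r c u v, inner ℝ w y = K) : inner ℝ w u = 0 ∧ inner ℝ w v = 0 := by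
  have hn : (3 : ℝ) ≤ n := by exact_mod_cast P.hn
  have hpi := Real.pi_pos
  have hr := P.hr
  have hc := h c (center_mem_polygon P.hn)
  have key : ∀ k : ℕ, Real.cos (2 * Real.pi * k / n) * inner ℝ w u +
      Real.sin (2 * Real.pi * k / n) * inner ℝ w v = 0 := by
    intro k
    have h1 : inner ℝ w (polygonVertex n r c u v k - c) = 0 := by
      rw [inner_sub_right, hc, h _ (polygonVertex_mem P.hn k), sub_self]
    rw [polygonVertex_sub, inner_add_right, inner_smul_right, inner_smul_right] at h1
    have h2 : r * (Real.cos (2 * Real.pi * k / n) * inner ℝ w u +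
      Real.sin (2 * Real.pi * k / n) * inner ℝ w v) = 0 := by linarith
    exact (mul_eq_zero.mp h2).resolve_left hr.ne'
  have k0 := key 0
  have k1 := key 1
  simp only [Nat.cast_zero, mul_zero, zero_div, Real.cos_zero, Real.sin_zero, zero_mul, add_zero,
    one_mul] at k0
  have hsin : Real.sin (2 * Real.pi * (1 : ℕ) / n) ≠ 0 := by
    refine (Real.sin_pos_of_pos_of_lt_pi (by positivity) ?_).ne'
    rw [div_lt_iff₀ (by linarith)]
    push_cast
    nlinarith
  rw [k0, mul_zero, zero_add] at k1
  exact ⟨k0, (mul_eq_zero.mp k1).resolve_left hsin⟩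

section Existence

variable {B : Set E3} {O : E3} {R : ℝ}

theorem exists_isFace (hV : ∃ V : Set E3, V.Finite ∧ B = convexHull ℝ V)
    (hint : (interior B).Nonempty) : ∃ F, IsFace 2 B F := by
  by_contra! h
  obtain ⟨V, hV, hB⟩ := hV
  have huniv : B = univ := eq_univ_of_forall fun x =>
    mem_of_forall_isFace hV hB hint fun w hw => absurd hw (h _)
  have hb : Bornology.IsBounded (univ : Set E3) := by
    rw [← huniv, hB]
    exact (hV.isCompact_convexHull ℝ).isBounded
  exact NormedSpace.unbounded_univ ℝ E3 hb

/-- Perpendicularity and the common distance of the face centers follow from the circumscribed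
sphere and the common circumradius. The remaining point is that `O` lies strictly on the inner side
of every face. -/
theorem exists_faceData (hB : IsPlatonicSolid B) (hO : B.extremePoints ℝ ⊆ Metric.sphere O R) :
    ∃ (n : ℕ) (r H : ℝ) (c u v : {F // IsFace 2 B F} → E3), FaceData B O H n r c u v ∧
      (∀ F, F.1 = polygon n r (c F) (u F) (v F)) ∧ H + r ^ 2 = R ^ 2 := by
  obtain ⟨V, hV, hBV⟩ := hB.isPolytope
  have hint := hB.interior_nonempty
  have hbdd : Bornology.IsBounded B := hBV ▸ (hV.isCompact_convexHull ℝ).isBounded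
  obtain ⟨n, r, hreg⟩ := hB.congruent_regular_faces
  have hdata : ∀ F : {F // IsFace 2 B F}, ∃ c u v : E3, PolygonFrame n r u v ∧
      F.1 = polygon n r c u v := by
    rintro ⟨F, hF⟩
    obtain ⟨c, hn, hr, u, v, hu, hv, huv, hpoly⟩ := hreg F hF
    exact ⟨c, u, v, ⟨hn, hr, hu, hv, huv⟩, hpoly⟩
  choose c u v P hpoly using hdata
  have hvert : ∀ F k, ‖polygonVertex n r (c F) (u F) (v F) k - O‖ = R := by
    intro F k
    have h1 : polygonVertex n r (c F) (u F) (v F) k ∈ F.1.extremePoints ℝ := by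
      rw [hpoly F, extremePoints_polygon (P F)]
      exact ⟨k, rfl⟩
    have h2 := hO (F.2.2.1.isExtreme.extremePoints_subset_extremePoints h1)
    rwa [mem_sphere_iff_norm] at h2
  have hcenter := fun F => inner_center_eq_zero (P F) (hvert F)
  have hcF : ∀ F, c F ∈ F.1 := fun F => by
    rw [hpoly F]
    exact center_mem_polygon (P F).hn
  have hFB : ∀ F : {F // IsFace 2 B F}, F.1 ⊆ B := fun F => F.2.2.1.subset
  have hnorm : ∀ F, ‖c F - O‖ ^ 2 = R ^ 2 - r ^ 2 := fun F => by linarith [(hcenter F).2.2]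
  -- the normal of a face is a multiple of the vector from `O` to its center
  have hnormal : ∀ (F : {F // IsFace 2 B F}) (w : E3), F.1 = faceOf B w →
      ∃ l : ℝ, c F - O = l • w := by
    intro F w hw
    have hw0 := ne_zero_of_isFace (by norm_num) hint F.2 hw
    obtain ⟨h1, h2⟩ := inner_normal_eq_zero (P F) (w := w) (K := inner ℝ w (c F)) fun y hy => by
      rw [← hpoly F] at hy
      exact inner_eq_of_mem_faceOf (hw ▸ hy) (hw ▸ hcF F)
    exact exists_eq_smul_of_orthogonal (P F).hu (P F).hv hw0 (P F).huv h1 h2 (hcenter F).1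
      (hcenter F).2.1
  -- If `l ≤ 0`, the functional of `c F - O` is minimal over `B` at `c F`. All centers are equally
  -- far from `O`, so each of them must then coincide with `c F`. All facets thus pass through one
  -- point, `B` is a cone with that apex, and it contains a ray, contrary to boundedness.
  have hpos : ∀ (F : {F // IsFace 2 B F}) (w : E3), F.1 = faceOf B w →
      ∃ l : ℝ, 0 < l ∧ c F - O = l • w := by
    intro F w hw
    obtain ⟨l, hl⟩ := hnormal F w hw
    refine ⟨l, ?_, hl⟩
    by_contra! hl0
    have hge : ∀ x ∈ B, ‖c F - O‖ ^ 2 ≤ inner ℝ (c F - O) (x - O) := by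
      intro x hx
      have h1 : inner ℝ w x ≤ inner ℝ w (c F) := by
        have := hcF F
        rw [hw] at this
        exact this.2 x hx
      have h2 : inner ℝ w (x - O) ≤ inner ℝ w (c F - O) := by
        rw [inner_sub_right, inner_sub_right]
        linarith
      rw [← real_inner_self_eq_norm_sq]
      conv_lhs => rw [hl, inner_smul_left, ← hl]
      conv_rhs => rw [hl, inner_smul_left]
      exact mul_le_mul_of_nonpos_left h2 hl0
    have hsame : ∀ G, c G = c F := by
      intro G
      have h1 := hge (c G) (hFB G (hcF G))
      have h2 := norm_sub_sq_real (c F - O) (c G - O)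
      rw [hnorm G, ← hnorm F] at h2
      have h3 : ‖c F - O - (c G - O)‖ ^ 2 ≤ 0 := by linarith
      have h4 : c F - O - (c G - O) = 0 := by
        rw [← norm_eq_zero]
        exact pow_eq_zero_iff (two_ne_zero) |>.mp (le_antisymm h3 (sq_nonneg _))
      rw [sub_sub_sub_cancel_right, sub_eq_zero] at h4
      exact h4.symm
    obtain ⟨x, hx, hxne⟩ : ∃ x ∈ B, x ≠ c F := by
      by_contra! h
      have h1 : B ⊆ {c F} := h
      obtain ⟨y, hy⟩ := hint
      have h2 : interior B ⊆ interior {c F} := interior_mono h1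
      have := h2 hy
      rw [interior_singleton] at this
      exact this
    have hray : ∀ t : ℝ, 0 ≤ t → c F + t • (x - c F) ∈ B := by
      intro t ht
      refine mem_of_forall_isFace hV hBV hint fun w' hw' y hy => ?_
      have h1 := hcF ⟨_, hw'⟩
      rw [hsame] at h1
      rw [← inner_eq_of_mem_faceOf h1 hy, inner_add_right, inner_smul_right, inner_sub_right]
      have h2 := h1.2 x hx
      nlinarith
    obtain ⟨M, hM⟩ := hbdd.exists_norm_le
    have hd : 0 < ‖x - c F‖ := norm_pos_iff.mpr (sub_ne_zero.mpr hxne)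
    have hM0 : 0 ≤ M := (norm_nonneg _).trans (hM x hx)
    have h1 := hM _ (hray ((M + ‖c F‖ + 1) / ‖x - c F‖) (by positivity))
    have h2 := norm_sub_le (c F + ((M + ‖c F‖ + 1) / ‖x - c F‖) • (x - c F)) (c F)
    rw [add_sub_cancel_left, norm_smul, Real.norm_of_nonneg (by positivity),
      div_mul_cancel₀ _ hd.ne'] at h2
    linarith
  obtain ⟨F₀, hF₀⟩ := exists_isFace hB.isPolytope hint
  have hexp : ∀ F : {F // IsFace 2 B F}, ∃ w, F.1 = faceOf B w := fun F =>
    exists_eq_faceOf F.2.1 F.2.2.1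
  have hH : 0 < R ^ 2 - r ^ 2 := by
    obtain ⟨w, hw⟩ := hexp ⟨F₀, hF₀⟩
    obtain ⟨l, hl0, hl⟩ := hpos ⟨F₀, hF₀⟩ w hw
    have hw0 := ne_zero_of_isFace (by norm_num) hint hF₀ hw
    rw [← hnorm ⟨F₀, hF₀⟩, hl]
    have : l • w ≠ 0 := smul_ne_zero hl0.ne' hw0
    positivity
  have hle : ∀ F, ∀ x ∈ B, inner ℝ (c F - O) (x - O) ≤ R ^ 2 - r ^ 2 := by
    intro F x hx
    obtain ⟨w, hw⟩ := hexp F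
    obtain ⟨l, hl0, hl⟩ := hpos F w hw
    have h1 := hcF F
    rw [hw] at h1
    have h2 := h1.2 x hx
    have h3 : inner ℝ w (x - O) ≤ inner ℝ w (c F - O) := by
      rw [inner_sub_right, inner_sub_right]
      linarith
    rw [← hnorm F, ← real_inner_self_eq_norm_sq]
    conv_rhs => rw [hl, inner_smul_left, ← hl]
    conv_lhs => rw [hl, inner_smul_left]
    exact mul_le_mul_of_nonneg_left h3 hl0.le
  have hmem : ∀ F x, x ∈ F.1 ↔ x ∈ B ∧ inner ℝ (c F - O) (x - O) = R ^ 2 - r ^ 2 := by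
    intro F x
    obtain ⟨w, hw⟩ := hexp F
    obtain ⟨l, hl0, hl⟩ := hpos F w hw
    have h1 := hcF F
    have hin : ∀ y, inner ℝ (c F - O) (y - O) = l * (inner ℝ w y - inner ℝ w O) := fun y => by
      rw [hl, inner_smul_left, inner_sub_right]
      rfl
    have hcc : inner ℝ (c F - O) (c F - O) = R ^ 2 - r ^ 2 := by
      rw [real_inner_self_eq_norm_sq, hnorm F]
    constructor
    · intro hx
      refine ⟨hFB F hx, ?_⟩
      rw [hw] at h1 hx
      rw [← hcc, hin, hin, inner_eq_of_mem_faceOf h1 hx]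
    · rintro ⟨hx, hx'⟩
      rw [← hcc, hin, hin] at hx'
      have h2 := mul_left_cancel₀ hl0.ne' hx'
      rw [hw] at h1 ⊢
      refine ⟨hx, fun y hy => ?_⟩
      linarith [h1.2 y hy]
  refine ⟨n, r, R ^ 2 - r ^ 2, c, u, v, ⟨P, hH, hnorm, fun F => (hcenter F).1,
    fun F => (hcenter F).2.1, fun F G hFG => ?_, fun x => ⟨fun hx F => hle F x hx, fun hx => ?_⟩,
    fun F x => by rw [← hpoly F]; exact hmem F x, hbdd⟩, hpoly, by ring⟩
  -- Equality for two vectors of equal length forces equal centers, and a face is determined by its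
  -- center.
  · refine (hle F _ (hFB G (hcF G))).lt_of_ne fun h => hFG ?_
    have h2 := norm_sub_sq_real (c F - O) (c G - O)
    rw [hnorm G, hnorm F, h] at h2
    have h4 : c F - O - (c G - O) = 0 := by
      rw [← norm_eq_zero]
      exact pow_eq_zero_iff (two_ne_zero) |>.mp (by linarith)
    refine Subtype.ext (Set.ext fun x => ?_)
    rw [sub_sub_sub_cancel_right, sub_eq_zero] at h4
    rw [hmem F, hmem G, h4]
  · refine mem_of_forall_isFace hV hBV hint fun w hw y hy => ?_
    obtain ⟨l, hl0, hl⟩ := hpos ⟨_, hw⟩ w rfl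
    have h1 := hx ⟨_, hw⟩
    have h2 := ((hmem ⟨_, hw⟩ y).mp hy).2
    rw [← h2, hl, inner_smul_left, inner_smul_left, inner_sub_right, inner_sub_right] at h1
    have h3 := le_of_mul_le_mul_left h1 hl0
    linarith

end Existence

end Platonic

/-! ### Tiling of the solid by flag simplices -/

namespace Platonic

open Module Set

theorem exists_eq_smul_of_orthogonal' {p q w a : E3} (hp : p ≠ 0) (hq : q ≠ 0) (hw : w ≠ 0)
    (hpq : inner ℝ p q = 0) (hwp : inner ℝ w p = 0) (hwq : inner ℝ w q = 0)
    (hap : inner ℝ a p = 0) (haq : inner ℝ a q = 0) : ∃ l : ℝ, a = l • w := by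
  have hp' : ‖p‖ ≠ 0 := norm_ne_zero_iff.mpr hp
  have hq' : ‖q‖ ≠ 0 := norm_ne_zero_iff.mpr hq
  refine exists_eq_smul_of_orthogonal (u := ‖p‖⁻¹ • p) (v := ‖q‖⁻¹ • q) ?_ ?_ hw ?_ ?_ ?_ ?_ ?_
  · rw [norm_smul, norm_inv, norm_norm, inv_mul_cancel₀ hp']
  · rw [norm_smul, norm_inv, norm_norm, inv_mul_cancel₀ hq']
  all_goals simp only [inner_smul_left, inner_smul_right, hpq, hwp, hwq, hap, haq, mul_zero]

namespace FaceData

variable {B : Set E3} {O : E3} {H : ℝ} {n : ℕ} {r : ℝ} {Φ : Type} {c u v : Φ → E3}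

theorem injective (D : FaceData B O H n r c u v) {F G : Φ} (h : c F = c G) : F = G := by
  by_contra hne
  have h1 := D.inner_lt F G hne
  rw [← h, real_inner_self_eq_norm_sq, D.norm_sq] at h1
  exact lt_irrefl _ h1

theorem polygon_subset (D : FaceData B O H n r c u v) (F : Φ) :
    polygon n r (c F) (u F) (v F) ⊆ B := fun x hx => ((D.mem_polygon_iff F x).mp hx).1

theorem inner_le (D : FaceData B O H n r c u v) (F : Φ) {x : E3} (hx : x ∈ B) :
    inner ℝ (c F - O) (x - O) ≤ H := (D.mem_iff x).mp hx F

theorem inner_eq (D : FaceData B O H n r c u v) {F : Φ} {x : E3}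
    (hx : x ∈ polygon n r (c F) (u F) (v F)) : inner ℝ (c F - O) (x - O) = H :=
  ((D.mem_polygon_iff F x).mp hx).2

theorem center_mem (D : FaceData B O H n r c u v) (F : Φ) :
    c F ∈ polygon n r (c F) (u F) (v F) := center_mem_polygon (D.frame F).hn

theorem vertex_mem (D : FaceData B O H n r c u v) (F : Φ) (k : ℕ) :
    polygonVertex n r (c F) (u F) (v F) k ∈ polygon n r (c F) (u F) (v F) :=
  polygonVertex_mem (D.frame F).hn k

theorem mem_self (D : FaceData B O H n r c u v) : O ∈ B :=
  (D.mem_iff O).mpr fun F => by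
    rw [sub_self, inner_zero_right]
    exact D.H_pos.le

theorem convex (D : FaceData B O H n r c u v) : Convex ℝ B := by
  intro x hx y hy a b ha hb hab
  refine (D.mem_iff _).mpr fun F => ?_
  have h1 := D.inner_le F hx
  have h2 := D.inner_le F hy
  have h3 : a • x + b • y - O = a • (x - O) + b • (y - O) := by
    obtain rfl : b = 1 - a := by linarith
    module
  rw [h3, inner_add_right, inner_smul_right, inner_smul_right]
  have h4 : H = a * H + b * H := by rw [← add_mul, hab, one_mul]
  rw [h4]
  gcongr

theorem tetrahedron_subset (D : FaceData B O H n r c u v) (F : Φ) (k : ℕ) :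
    convexHull ℝ {O, c F, polygonVertex n r (c F) (u F) (v F) k,
      polygonVertex n r (c F) (u F) (v F) (k + 1)} ⊆ B := by
  refine convexHull_min ?_ D.convex
  rintro x (rfl | rfl | rfl | rfl)
  · exact D.mem_self
  · exact D.polygon_subset F (D.center_mem F)
  · exact D.polygon_subset F (D.vertex_mem F _)
  · exact D.polygon_subset F (D.vertex_mem F _)

theorem triangle_subset_polygon (D : FaceData B O H n r c u v) (F : Φ) (k : ℕ) :
    convexHull ℝ {c F, polygonVertex n r (c F) (u F) (v F) k,
      polygonVertex n r (c F) (u F) (v F) (k + 1)} ⊆ polygon n r (c F) (u F) (v F) := by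
  refine convexHull_min ?_ (convex_convexHull ℝ _)
  rintro x (rfl | rfl | rfl)
  · exact D.center_mem F
  · exact D.vertex_mem F _
  · exact D.vertex_mem F _

theorem norm_vertex_sq (D : FaceData B O H n r c u v) (F : Φ) (k : ℕ) :
    ‖polygonVertex n r (c F) (u F) (v F) k - O‖ ^ 2 = H + r ^ 2 := by
  have h1 : polygonVertex n r (c F) (u F) (v F) k - O =
      (c F - O) + (polygonVertex n r (c F) (u F) (v F) k - c F) := by abel
  rw [h1, norm_add_sq_real, norm_polygonVertex_sub (D.frame F), polygonVertex_sub, inner_add_right,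
    inner_smul_right, inner_smul_right, D.inner_u, D.inner_v, D.norm_sq]
  ring

theorem isClosed (D : FaceData B O H n r c u v) : IsClosed B := by
  have h : B = ⋂ F, {x | inner ℝ (c F - O) (x - O) ≤ H} := by
    ext x
    rw [mem_iInter]
    exact D.mem_iff x
  rw [h]
  exact isClosed_iInter fun F => isClosed_le (by fun_prop) continuous_const

/-- Moving from a point of the face along the outer normal `c F - O` violates the inequality of that
face at once. -/
theorem notMem_interior (D : FaceData B O H n r c u v) {F : Φ} {x : E3}
    (hx : x ∈ polygon n r (c F) (u F) (v F)) : x ∉ interior B := by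
  intro hint
  have hcont : ContinuousAt (fun t : ℝ => x + t • (c F - O)) 0 := by fun_prop
  have hnhds : ∀ᶠ t : ℝ in nhds 0, x + t • (c F - O) ∈ B := by
    refine hcont.eventually_mem ?_
    simpa using mem_interior_iff_mem_nhds.mp hint
  obtain ⟨t, ht, ht0⟩ := ((hnhds.filter_mono nhdsWithin_le_nhds).and
    (self_mem_nhdsWithin : Ioi (0 : ℝ) ∈ nhdsWithin 0 (Ioi 0))).exists
  have h1 := D.inner_le F ht
  have h2 : x + t • (c F - O) - O = (x - O) + t • (c F - O) := by abel
  rw [h2, inner_add_right, D.inner_eq hx, inner_smul_right, real_inner_self_eq_norm_sq,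
    D.norm_sq] at h1
  have := mul_pos (mem_Ioi.mp ht0) D.H_pos
  linarith

theorem mem_interior [Finite Φ] (D : FaceData B O H n r c u v) {x : E3}
    (hx : ∀ F, inner ℝ (c F - O) (x - O) < H) : x ∈ interior B := by
  have hopen : IsOpen (⋂ F, {x | inner ℝ (c F - O) (x - O) < H}) :=
    isOpen_iInter_of_finite fun F => isOpen_lt (by fun_prop) continuous_const
  refine interior_maximal (fun y hy => (D.mem_iff y).mpr fun F => ?_) hopen (mem_iInter.mpr hx)
  exact (mem_iInter.mp hy F).le

theorem exists_mem_polygon [Finite Φ] (D : FaceData B O H n r c u v) {x : E3} (hx : x ∈ B)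
    (hx' : x ∉ interior B) : ∃ F, x ∈ polygon n r (c F) (u F) (v F) := by
  by_contra! h
  refine hx' (D.mem_interior fun F => (D.inner_le F hx).lt_of_ne fun he => h F ?_)
  exact (D.mem_polygon_iff F x).mpr ⟨hx, he⟩

theorem frontier_eq [Finite Φ] (D : FaceData B O H n r c u v) :
    frontier B = ⋃ F, polygon n r (c F) (u F) (v F) := by
  rw [D.isClosed.frontier_eq]
  ext x
  rw [mem_iUnion]
  exact ⟨fun hx => D.exists_mem_polygon hx.1 hx.2,
    fun ⟨F, hF⟩ => ⟨D.polygon_subset F hF, D.notMem_interior hF⟩⟩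

/-- Radial projection from `O`: the face whose functional is largest at `x` is the one hit by the
ray through `x`, and scaling by `H / m` reaches it. The hit point lies in one of the triangles of
that face. -/
theorem exists_mem_tetrahedron [Finite Φ] [Nonempty Φ] (D : FaceData B O H n r c u v) {x : E3}
    (hx : x ∈ B) : ∃ F k, x ∈ convexHull ℝ {O, c F, polygonVertex n r (c F) (u F) (v F) k,
      polygonVertex n r (c F) (u F) (v F) (k + 1)} := by
  by_cases hxO : x = O
  · obtain ⟨F⟩ := ‹Nonempty Φ›
    exact ⟨F, 0, subset_convexHull ℝ _ (by simp [hxO])⟩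
  obtain ⟨F, hF⟩ := Finite.exists_max fun F => inner ℝ (c F - O) (x - O)
  set m := inner ℝ (c F - O) (x - O) with hm
  have hH := D.H_pos
  -- If no functional were positive at `x`, the whole ray from `O` through `x` would stay in the
  -- bounded set `B`.
  have hm0 : 0 < m := by
    by_contra! h
    have hray : ∀ t : ℝ, 0 ≤ t → O + t • (x - O) ∈ B := fun t ht => (D.mem_iff _).mpr fun G => by
      rw [add_sub_cancel_left, inner_smul_right]
      have := (hF G).trans h
      nlinarith
    obtain ⟨M, hM⟩ := D.isBounded.exists_norm_le
    have hd : 0 < ‖x - O‖ := norm_pos_iff.mpr (sub_ne_zero.mpr hxO)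
    have hM0 : 0 ≤ M := (norm_nonneg _).trans (hM x hx)
    have h1 := hM _ (hray ((M + ‖O‖ + 1) / ‖x - O‖) (by positivity))
    have h2 := norm_sub_le (O + ((M + ‖O‖ + 1) / ‖x - O‖) • (x - O)) O
    rw [add_sub_cancel_left, norm_smul, Real.norm_of_nonneg (by positivity),
      div_mul_cancel₀ _ hd.ne'] at h2
    linarith
  have hmH : m ≤ H := D.inner_le F hx
  set y := O + (H / m) • (x - O) with hy
  have hyG : ∀ G, inner ℝ (c G - O) (y - O) = H / m * inner ℝ (c G - O) (x - O) := fun G => by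
    rw [hy, add_sub_cancel_left, inner_smul_right]
  have hyF : y ∈ polygon n r (c F) (u F) (v F) := by
    refine (D.mem_polygon_iff F y).mpr ⟨(D.mem_iff y).mpr fun G => ?_, ?_⟩
    · rw [hyG, div_mul_eq_mul_div, div_le_iff₀ hm0]
      exact mul_le_mul_of_nonneg_left (hF G) hH.le
    · rw [hyG, ← hm, div_mul_cancel₀ _ hm0.ne']
  obtain ⟨k, hk⟩ := exists_mem_triangle (D.frame F) hyF
  refine ⟨F, k, ?_⟩
  have hxy : x = AffineMap.lineMap O y (m / H) := by
    rw [hy, AffineMap.lineMap_apply_module', add_sub_cancel_left, smul_smul,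
      div_mul_div_cancel₀ hH.ne', div_self hm0.ne']
    module
  rw [hxy]
  refine (convex_convexHull ℝ _).lineMap_mem (subset_convexHull ℝ _ (by simp)) ?_
    ⟨by positivity, (div_le_one hH).mpr hmH⟩
  exact convexHull_mono (subset_insert _ _) hk

theorem inner_combination (F : Φ) (p q s : E3) {α β γ δ : ℝ} (h : α + β + γ + δ = 1) :
    inner ℝ (c F - O) (α • O + β • p + γ • q + δ • s - O) = β * inner ℝ (c F - O) (p - O) +
      γ * inner ℝ (c F - O) (q - O) + δ * inner ℝ (c F - O) (s - O) := by
  have h3 : α • O + β • p + γ • q + δ • s - O = β • (p - O) + γ • (q - O) + δ • (s - O) := by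
    obtain rfl : α = 1 - β - γ - δ := by linarith
    module
  rw [h3, inner_add_right, inner_add_right, inner_smul_right, inner_smul_right, inner_smul_right]

/-- A point with a positive barycentric coordinate at the center of a face lies over that face
only. -/
theorem face_unique (D : FaceData B O H n r c u v) {F G : Φ} {i k : ℕ} {α β γ δ α' β' γ' δ' : ℝ}
    (hβ : 0 < β) (hγ : 0 ≤ γ) (hδ : 0 ≤ δ) (h1 : α + β + γ + δ = 1)
    (hβ' : 0 ≤ β') (hγ' : 0 ≤ γ') (hδ' : 0 ≤ δ') (h1' : α' + β' + γ' + δ' = 1)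
    (h : α • O + β • c F + γ • polygonVertex n r (c F) (u F) (v F) i +
        δ • polygonVertex n r (c F) (u F) (v F) (i + 1) =
      α' • O + β' • c G + γ' • polygonVertex n r (c G) (u G) (v G) k +
        δ' • polygonVertex n r (c G) (u G) (v G) (k + 1)) : F = G ∧ α = α' := by
  set x := α • O + β • c F + γ • polygonVertex n r (c F) (u F) (v F) i +
        δ • polygonVertex n r (c F) (u F) (v F) (i + 1) with hx
  -- The functional of the face under `x` reads off `(1 - α) * H`. The functional of any other face
  -- is strictly smaller at `x`, because of the positive weight at the center of `F`.
  have e1 : inner ℝ (c F - O) (x - O) = (1 - α) * H := by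
    rw [hx, inner_combination F _ _ _ h1, D.inner_eq (D.center_mem F),
      D.inner_eq (D.vertex_mem F i), D.inner_eq (D.vertex_mem F (i + 1)), ← h1]
    ring
  have e2 : inner ℝ (c G - O) (x - O) = (1 - α') * H := by
    rw [h, inner_combination G _ _ _ h1', D.inner_eq (D.center_mem G),
      D.inner_eq (D.vertex_mem G k), D.inner_eq (D.vertex_mem G (k + 1)), ← h1']
    ring
  have hH := D.H_pos
  have hFG : F = G := by
    by_contra hne
    have e3 : inner ℝ (c G - O) (x - O) < (1 - α) * H := by
      rw [hx, inner_combination G _ _ _ h1]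
      have k1 := mul_lt_mul_of_pos_left (D.inner_lt G F (Ne.symm hne)) hβ
      have k2 := mul_le_mul_of_nonneg_left
        (D.inner_le G (D.polygon_subset F (D.vertex_mem F i))) hγ
      have k3 := mul_le_mul_of_nonneg_left
        (D.inner_le G (D.polygon_subset F (D.vertex_mem F (i + 1)))) hδ
      have : (1 - α) * H = β * H + γ * H + δ * H := by rw [← h1]; ring
      linarith
    have e4 : inner ℝ (c F - O) (x - O) ≤ (1 - α') * H := by
      rw [h, inner_combination F _ _ _ h1']
      have k1 := mul_le_mul_of_nonneg_left
        (D.inner_le F (D.polygon_subset G (D.center_mem G))) hβ'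
      have k2 := mul_le_mul_of_nonneg_left
        (D.inner_le F (D.polygon_subset G (D.vertex_mem G k))) hγ'
      have k3 := mul_le_mul_of_nonneg_left
        (D.inner_le F (D.polygon_subset G (D.vertex_mem G (k + 1)))) hδ'
      have : (1 - α') * H = β' * H + γ' * H + δ' * H := by rw [← h1']; ring
      linarith
    linarith
  refine ⟨hFG, ?_⟩
  subst hFG
  rw [e1] at e2
  have := mul_right_cancel₀ hH.ne' e2
  linarith

/-- Once the face and the weight at `O` agree, the question is planar and `sector_unique` decides
it. -/
theorem flag_unique (D : FaceData B O H n r c u v) {F G : Φ} {i k : ℕ} {α β γ δ α' β' γ' δ' : ℝ}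
    (hβ : 0 < β) (hγ : 0 < γ) (hδ : 0 < δ) (h1 : α + β + γ + δ = 1)
    (hβ' : 0 ≤ β') (hγ' : 0 ≤ γ') (hδ' : 0 ≤ δ') (h1' : α' + β' + γ' + δ' = 1)
    (h : α • O + β • c F + γ • polygonVertex n r (c F) (u F) (v F) i +
        δ • polygonVertex n r (c F) (u F) (v F) (i + 1) =
      α' • O + β' • c G + γ' • polygonVertex n r (c G) (u G) (v G) k +
        δ' • polygonVertex n r (c G) (u G) (v G) (k + 1)) : F = G ∧ i % n = k % n := by
  obtain ⟨rfl, rfl⟩ := D.face_unique hβ hγ.le hδ.le h1 hβ' hγ' hδ' h1' h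
  refine ⟨rfl, sector_unique (c := c F) (D.frame F) hγ hδ hγ' hδ' ?_⟩
  obtain rfl : β = 1 - α - γ - δ := by linarith
  obtain rfl : β' = 1 - α - γ' - δ' := by linarith
  rw [← sub_eq_zero] at h ⊢
  rw [← h]
  module

/-- A point of the relative interior of a segment joining the center of a face with a vertex lies
on one such segment only. -/
theorem center_vertex_unique (D : FaceData B O H n r c u v) {F G : Φ} {i k : ℕ} {β δ β' δ' : ℝ}
    (hβ : 0 < β) (hδ : 0 < δ) (h1 : β + δ = 1) (hβ' : 0 ≤ β') (hδ' : 0 ≤ δ') (h1' : β' + δ' = 1)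
    (h : β • c F + δ • polygonVertex n r (c F) (u F) (v F) (i + 1) =
      β' • c G + δ' • polygonVertex n r (c G) (u G) (v G) (k + 1)) :
    F = G ∧ (i + 1) % n = (k + 1) % n := by
  obtain ⟨rfl, -⟩ := D.face_unique (i := i) (k := k) (α := 0) (α' := 0) (γ := 0) (γ' := 0) hβ le_rfl
    hδ.le (by linarith) hβ' le_rfl hδ' (by linarith) (by simpa using h)
  have h2 : δ • (polygonVertex n r (c F) (u F) (v F) (i + 1) - c F) =
      δ' • (polygonVertex n r (c F) (u F) (v F) (k + 1) - c F) := by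
    obtain rfl : β = 1 - δ := by linarith
    obtain rfl : β' = 1 - δ' := by linarith
    rw [← sub_eq_zero] at h ⊢
    rw [← h]
    module
  have h3 := congrArg norm h2
  rw [norm_smul, norm_smul, norm_polygonVertex_sub (D.frame F), norm_polygonVertex_sub (D.frame F),
    Real.norm_of_nonneg hδ.le, Real.norm_of_nonneg hδ'] at h3
  obtain rfl := mul_right_cancel₀ (D.frame F).hr.ne' h3
  have h4 := smul_right_injective E3 hδ.ne' h2
  exact ⟨rfl, polygonVertex_inj (D.frame F) (sub_left_inj.mp h4)⟩

/-- All vertices have the same nonzero distance from `O`, so comparing norms gives `γ = γ'`. -/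
theorem vertex_unique (D : FaceData B O H n r c u v) {F G : Φ} {i k : ℕ} {α γ α' γ' : ℝ}
    (hγ : 0 < γ) (h1 : α + γ = 1) (hγ' : 0 ≤ γ') (h1' : α' + γ' = 1)
    (h : α • O + γ • polygonVertex n r (c F) (u F) (v F) i =
      α' • O + γ' • polygonVertex n r (c G) (u G) (v G) k) :
    polygonVertex n r (c F) (u F) (v F) i = polygonVertex n r (c G) (u G) (v G) k := by
  have h2 : γ • (polygonVertex n r (c F) (u F) (v F) i - O) =
      γ' • (polygonVertex n r (c G) (u G) (v G) k - O) := by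
    obtain rfl : α = 1 - γ := by linarith
    obtain rfl : α' = 1 - γ' := by linarith
    rw [← sub_eq_zero] at h ⊢
    rw [← h]
    module
  have h5 : ‖polygonVertex n r (c F) (u F) (v F) i - O‖ =
      ‖polygonVertex n r (c G) (u G) (v G) k - O‖ := by
    rw [← sq_eq_sq₀ (norm_nonneg _) (norm_nonneg _), D.norm_vertex_sq, D.norm_vertex_sq]
  have h6 : ‖polygonVertex n r (c G) (u G) (v G) k - O‖ ≠ 0 := fun h0 => by
    have := D.norm_vertex_sq G k
    rw [h0] at this
    have := D.H_pos
    nlinarith [sq_nonneg r]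
  have h3 := congrArg norm h2
  rw [norm_smul, norm_smul, h5, Real.norm_of_nonneg hγ.le, Real.norm_of_nonneg hγ'] at h3
  obtain rfl := mul_right_cancel₀ h6 h3
  exact sub_left_inj.mp (smul_right_injective E3 hγ.ne' h2)

end FaceData

end Platonic

/-! ### Every side belongs to exactly two faces -/

namespace Platonic

open Module Set

theorem vertex_ne_succ {n : ℕ} {r : ℝ} {u v c : E3} (P : PolygonFrame n r u v) (i : ℕ) :
    polygonVertex n r c u v i ≠ polygonVertex n r c u v (i + 1) := by
  intro h
  have h1 := (Nat.modEq_iff_dvd).mp (polygonVertex_inj P h : i ≡ i + 1 [MOD n])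
  have h2 := Int.le_of_dvd (by norm_num) h1
  have := P.hn
  push_cast at h2
  omega

/-- A sphere centered at the origin meets a line in space in at most two points. -/
theorem eq_or_eq_of_sphere_inter_line {e M a b k : E3} {H K : ℝ} (he : e ≠ 0) (hM : M ≠ 0)
    (heM : inner ℝ e M = 0) (hae : inner ℝ a e = 0) (hbe : inner ℝ b e = 0) (hke : inner ℝ k e = 0)
    (haM : inner ℝ a M = K) (hbM : inner ℝ b M = K) (hkM : inner ℝ k M = K)
    (ha : ‖a‖ ^ 2 = H) (hb : ‖b‖ ^ 2 = H) (hk : ‖k‖ ^ 2 = H) (hab : a ≠ b) : k = a ∨ k = b := by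
  have hd0 : b - a ≠ 0 := sub_ne_zero.mpr hab.symm
  -- Both `k - a` and `b - a` are orthogonal to the independent vectors `e` and `M`, hence parallel.
  -- Equality of the norms then forces `l * (l - 1) = 0`.
  obtain ⟨l, hl⟩ := exists_eq_smul_of_orthogonal' (w := b - a) (a := k - a) he hM hd0 heM
    (by rw [inner_sub_left, hbe, hae, sub_self]) (by rw [inner_sub_left, hbM, haM, sub_self])
    (by rw [inner_sub_left, hke, hae, sub_self]) (by rw [inner_sub_left, hkM, haM, sub_self])
  have hkl : k = a + l • (b - a) := by rw [← hl]; abel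
  have n1 : ‖a + (b - a)‖ ^ 2 = H := by rw [add_sub_cancel, hb]
  have n2 : ‖a + l • (b - a)‖ ^ 2 = H := by rw [← hkl, hk]
  rw [norm_add_sq_real, ha] at n1 n2
  rw [inner_smul_right, norm_smul, mul_pow, Real.norm_eq_abs, sq_abs] at n2
  have hdn : 0 < ‖b - a‖ ^ 2 := by positivity
  have hll : (l * (l - 1)) * ‖b - a‖ ^ 2 = 0 := by linear_combination n2 - l * n1
  rcases mul_eq_zero.mp ((mul_eq_zero.mp hll).resolve_right hdn.ne') with h | h
  · left
    rw [hkl, h, zero_smul, add_zero]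
  · right
    have : l = 1 := by linarith
    rw [hkl, this, one_smul, add_sub_cancel]

namespace FaceData

variable {B : Set E3} {O : E3} {H : ℝ} {n : ℕ} {r : ℝ} {Φ : Type} {c u v : Φ → E3}

/-- The functional of the face is at most `H` at both ends and equal to `H` in between, so it equals
`H` at both ends. -/
theorem mem_polygon_of_mem_openSegment (D : FaceData B O H n r c u v) {G : Φ} {x p q : E3}
    (hp : p ∈ B) (hq : q ∈ B) (hx : x ∈ openSegment ℝ p q)
    (hxG : x ∈ polygon n r (c G) (u G) (v G)) :
    p ∈ polygon n r (c G) (u G) (v G) ∧ q ∈ polygon n r (c G) (u G) (v G) := by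
  obtain ⟨s, t, hs, ht, hst, rfl⟩ := hx
  have h1 := D.inner_eq hxG
  have h2 := D.inner_le G hp
  have h3 := D.inner_le G hq
  have h4 : s • p + t • q - O = s • (p - O) + t • (q - O) := by
    obtain rfl : s = 1 - t := by linarith
    module
  rw [h4, inner_add_right, inner_smul_right, inner_smul_right] at h1
  have h5 : H = s * H + t * H := by rw [← add_mul, hst, one_mul]
  refine ⟨(D.mem_polygon_iff G p).mpr ⟨hp, ?_⟩, (D.mem_polygon_iff G q).mpr ⟨hq, ?_⟩⟩
  · have : s * H ≤ s * inner ℝ (c G - O) (p - O) := by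
      have := mul_le_mul_of_nonneg_left h3 ht.le
      linarith
    exact le_antisymm h2 (le_of_mul_le_mul_left this hs)
  · have : t * H ≤ t * inner ℝ (c G - O) (q - O) := by
      have := mul_le_mul_of_nonneg_left h2 hs.le
      linarith
    exact le_antisymm h3 (le_of_mul_le_mul_left this ht)

/-- The faces containing the `i`-th side of the face `F`. -/
def facesAt (n : ℕ) (r : ℝ) (c u v : Φ → E3) (F : Φ) (i : ℕ) : Set Φ :=
  {G | polygonVertex n r (c F) (u F) (v F) i ∈ polygon n r (c G) (u G) (v G) ∧
    polygonVertex n r (c F) (u F) (v F) (i + 1) ∈ polygon n r (c G) (u G) (v G)}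

theorem mem_facesAt_self (D : FaceData B O H n r c u v) (F : Φ) (i : ℕ) :
    F ∈ facesAt n r c u v F i := ⟨D.vertex_mem F i, D.vertex_mem F (i + 1)⟩

theorem mem_facesAt_iff (D : FaceData B O H n r c u v) {F G : Φ} {i : ℕ} {y : E3}
    (hy : y ∈ openSegment ℝ (polygonVertex n r (c F) (u F) (v F) i)
      (polygonVertex n r (c F) (u F) (v F) (i + 1))) :
    G ∈ facesAt n r c u v F i ↔ y ∈ polygon n r (c G) (u G) (v G) := by
  refine ⟨fun ⟨h1, h2⟩ => ?_, fun h => ?_⟩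
  · exact (convex_convexHull ℝ _).openSegment_subset h1 h2 hy
  · exact D.mem_polygon_of_mem_openSegment (D.polygon_subset F (D.vertex_mem F i))
      (D.polygon_subset F (D.vertex_mem F (i + 1))) hy h

/-- If `F` were the only face at its side, all other face inequalities would be strict at the
midpoint `M`. Then `M` could be pushed slightly across the side, within the plane of `F`, without
leaving `B`, contradicting that the polygon ends at that side. -/
theorem exists_other_face [Finite Φ] (D : FaceData B O H n r c u v) (F : Φ) (i : ℕ) :
    ∃ G ∈ facesAt n r c u v F i, G ≠ F := by
  by_contra! h
  set p := polygonVertex n r (c F) (u F) (v F) i with hp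
  set q := polygonVertex n r (c F) (u F) (v F) (i + 1) with hq
  set M := (1 / 2 : ℝ) • p + (1 / 2 : ℝ) • q with hM
  set m := sideNormal n (u F) (v F) i with hm
  have hMs : M ∈ openSegment ℝ p q := ⟨1 / 2, 1 / 2, by norm_num, by norm_num, by norm_num, rfl⟩
  have hMF : M ∈ polygon n r (c F) (u F) (v F) :=
    (D.mem_facesAt_iff hMs).mp (D.mem_facesAt_self F i)
  have hlt : ∀ G, G ≠ F → inner ℝ (c G - O) (M - O) < H := fun G hG => by
    refine (D.inner_le G (D.polygon_subset F hMF)).lt_of_ne fun he => hG (h G ?_)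
    rw [D.mem_facesAt_iff hMs]
    exact (D.mem_polygon_iff G M).mpr ⟨D.polygon_subset F hMF, he⟩
  have hmF : inner ℝ (c F - O) m = 0 := by
    rw [hm, sideNormal, inner_add_right, inner_smul_right, inner_smul_right, D.inner_u, D.inner_v]
    ring
  have hev : ∀ᶠ t : ℝ in nhds 0, ∀ G, G ≠ F → inner ℝ (c G - O) (M + t • m - O) < H := by
    refine Filter.eventually_all.mpr fun G => ?_
    by_cases hG : G = F
    · exact Filter.Eventually.of_forall fun t ht => absurd hG ht
    · have hc : ContinuousAt (fun t : ℝ => inner ℝ (c G - O) (M + t • m - O)) 0 := by fun_prop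
      have h0 : inner ℝ (c G - O) (M + (0 : ℝ) • m - O) < H := by
        rw [zero_smul, add_zero]
        exact hlt G hG
      filter_upwards [hc.eventually_lt continuousAt_const h0] with t ht _ using ht
  obtain ⟨t, ht, ht0⟩ := ((hev.filter_mono nhdsWithin_le_nhds).and
    (self_mem_nhdsWithin : Ioi (0 : ℝ) ∈ nhdsWithin 0 (Ioi 0))).exists
  have ht0' : 0 < t := ht0
  have hF : inner ℝ (c F - O) (M + t • m - O) = H := by
    have : M + t • m - O = (M - O) + t • m := by abel
    rw [this, inner_add_right, inner_smul_right, hmF, D.inner_eq hMF]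
    ring
  have hin : M + t • m ∈ polygon n r (c F) (u F) (v F) := by
    refine (D.mem_polygon_iff F _).mpr ⟨(D.mem_iff _).mpr fun G => ?_, hF⟩
    by_cases hG : G = F
    · rw [hG]
      exact hF.le
    · exact (ht G hG).le
  have h1 := inner_sideNormal_le_of_mem (D.frame F) i hin
  have h2 : M + t • m - c F = (1 / 2 : ℝ) • (p - c F) + (1 / 2 : ℝ) • (q - c F) + t • m := by
    rw [hM]
    module
  have hmm : inner ℝ m m = (1 : ℝ) := by
    rw [hm, sideNormal, inner_circle (D.frame F).hu (D.frame F).hv (D.frame F).huv]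
    nlinarith [Real.sin_sq_add_cos_sq ((2 * (i : ℝ) + 1) * Real.pi / n)]
  rw [h2, inner_add_right, inner_add_right, inner_smul_right, inner_smul_right, inner_smul_right,
    hp, hq, inner_sideNormal_self (D.frame F), inner_sideNormal_succ (D.frame F), ← hm, hmm] at h1
  linarith

theorem inner_edge_eq_zero (D : FaceData B O H n r c u v) {F G : Φ} {i : ℕ}
    (hG : G ∈ facesAt n r c u v F i) : inner ℝ (c G - O)
      (polygonVertex n r (c F) (u F) (v F) (i + 1) - polygonVertex n r (c F) (u F) (v F) i) = 0 := by
  have h1 := D.inner_eq hG.1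
  have h2 := D.inner_eq hG.2
  rw [← sub_sub_sub_cancel_right (polygonVertex n r (c F) (u F) (v F) (i + 1)) _ O, inner_sub_right,
    h1, h2, sub_self]

/-- For every face through the side, the vector `c K - O` is orthogonal to the side, has the same
inner product with the sum of its endpoints, and has squared length `H`. It therefore lies on a line
and on a sphere, which leaves at most two possibilities. -/
theorem facesAt_eq_pair (D : FaceData B O H n r c u v) {F G : Φ} {i : ℕ}
    (hG : G ∈ facesAt n r c u v F i) (hne : G ≠ F) : facesAt n r c u v F i = {F, G} := by
  refine Subset.antisymm (fun K hK => ?_) (by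
    rintro K (rfl | rfl)
    · exact D.mem_facesAt_self _ _
    · exact hG)
  set p := polygonVertex n r (c F) (u F) (v F) i with hp
  set q := polygonVertex n r (c F) (u F) (v F) (i + 1) with hq
  have hF := D.mem_facesAt_self F i
  have he0 : q - p ≠ 0 := sub_ne_zero.mpr (vertex_ne_succ (D.frame F) i).symm
  have hin : ∀ {K}, K ∈ facesAt n r c u v F i → inner ℝ (c K - O) ((p - O) + (q - O)) = 2 * H :=
    fun {K} hK => by
      rw [inner_add_right, D.inner_eq hK.1, D.inner_eq hK.2]
      ring
  have hH := D.H_pos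
  have hM0 : (p - O) + (q - O) ≠ 0 := by
    intro h
    have := hin hF
    rw [h, inner_zero_right] at this
    linarith
  have heM : inner ℝ (q - p) ((p - O) + (q - O)) = 0 := by
    have h1 : q - p = (q - O) - (p - O) := by abel
    have h2 := D.norm_vertex_sq F i
    have h3 := D.norm_vertex_sq F (i + 1)
    rw [← hp] at h2
    rw [← hq] at h3
    rw [h1, inner_sub_left, inner_add_right, inner_add_right, real_inner_self_eq_norm_sq,
      real_inner_self_eq_norm_sq, h2, h3, real_inner_comm (p - O) (q - O)]
    ring
  have hab : c F - O ≠ c G - O := fun h => hne (D.injective (sub_left_inj.mp h)).symm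
  rcases eq_or_eq_of_sphere_inter_line he0 hM0 heM (D.inner_edge_eq_zero hF)
    (D.inner_edge_eq_zero hG) (D.inner_edge_eq_zero hK) (hin hF) (hin hG) (hin hK) (D.norm_sq F)
    (D.norm_sq G) (D.norm_sq K) hab with h | h
  · exact Or.inl (D.injective (sub_left_inj.mp h))
  · exact Or.inr (D.injective (sub_left_inj.mp h))

theorem ncard_facesAt [Finite Φ] (D : FaceData B O H n r c u v) (F : Φ) (i : ℕ) :
    (facesAt n r c u v F i).ncard = 2 := by
  obtain ⟨G, hG, hne⟩ := D.exists_other_face F i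
  rw [D.facesAt_eq_pair hG hne, ncard_pair hne.symm]

/-- An inner point of a side lies strictly inside the sphere through the vertices, so it is not a
vertex. Both of its weights on side `k` are then positive and `sector_unique` applies. -/
theorem side_unique (D : FaceData B O H n r c u v) {F G : Φ} {i k l : ℕ} {y : E3}
    (hy : y ∈ openSegment ℝ (polygonVertex n r (c F) (u F) (v F) i)
      (polygonVertex n r (c F) (u F) (v F) (i + 1)))
    (hk : y ∈ segment ℝ (polygonVertex n r (c G) (u G) (v G) k)
      (polygonVertex n r (c G) (u G) (v G) (k + 1)))
    (hl : y ∈ segment ℝ (polygonVertex n r (c G) (u G) (v G) l)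
      (polygonVertex n r (c G) (u G) (v G) (l + 1))) : k % n = l % n := by
  have hnv : ∀ j, y ≠ polygonVertex n r (c G) (u G) (v G) j := by
    rintro j rfl
    obtain ⟨s, t, hs, ht, hst, he⟩ := hy
    have h1 := D.norm_vertex_sq G j
    have h2 := D.norm_vertex_sq F i
    have h3 := D.norm_vertex_sq F (i + 1)
    set p := polygonVertex n r (c F) (u F) (v F) i
    set q := polygonVertex n r (c F) (u F) (v F) (i + 1)
    have hpq : p ≠ q := vertex_ne_succ (D.frame F) i
    have h4 : polygonVertex n r (c G) (u G) (v G) j - O = s • (p - O) + t • (q - O) := by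
      rw [← he]
      obtain rfl : s = 1 - t := by linarith
      module
    have h5 : 0 < ‖(p - O) - (q - O)‖ ^ 2 := by
      have : (p - O) - (q - O) ≠ 0 := by
        rw [sub_sub_sub_cancel_right]
        exact sub_ne_zero.mpr hpq
      positivity
    rw [norm_sub_sq_real, h2, h3] at h5
    rw [h4, norm_add_sq_real, norm_smul, norm_smul, mul_pow, mul_pow, inner_smul_left,
      inner_smul_right, Real.norm_eq_abs, Real.norm_eq_abs, sq_abs, sq_abs, h2, h3] at h1
    simp only [conj_trivial] at h1
    obtain rfl : s = 1 - t := by linarith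
    -- The squared radius exceeds the squared distance from `O` to the dividing point by `(1 - t) *
    -- t * ‖p - q‖ ^ 2`.
    have h6 : ((1 - t) * t) * (H + r ^ 2 - 2 * inner ℝ (p - O) (q - O) + (H + r ^ 2)) = 0 := by
      linear_combination -h1
    have h7 := mul_pos (mul_pos hs ht) h5
    linarith
  obtain ⟨s, t, hs, ht, hst, he⟩ := hk
  obtain ⟨s', t', hs', ht', hst', he'⟩ := hl
  have hs0 : 0 < s := by
    refine hs.lt_of_ne ?_
    rintro rfl
    refine hnv (k + 1) ?_
    rw [← he]
    obtain rfl : t = 1 := by linarith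
    simp
  have ht0 : 0 < t := by
    refine ht.lt_of_ne ?_
    rintro rfl
    refine hnv k ?_
    rw [← he]
    obtain rfl : s = 1 := by linarith
    simp
  refine sector_unique (c := c G) (D.frame G) hs0 ht0 hs' ht' ?_
  have e1 := he.trans he'.symm
  obtain rfl : s = 1 - t := by linarith
  obtain rfl : s' = 1 - t' := by linarith
  rw [← sub_eq_zero] at e1 ⊢
  rw [← e1]
  module

/-- For `G ≠ F`, the functional of `F` equals `H` at `y` but is strictly less at `c G`. So `y` has
no weight at the center in its triangle of `G`, and lies on a side. -/
theorem exists_side (D : FaceData B O H n r c u v) {F G : Φ} {i : ℕ} {y : E3}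
    (hy : y ∈ openSegment ℝ (polygonVertex n r (c F) (u F) (v F) i)
      (polygonVertex n r (c F) (u F) (v F) (i + 1)))
    (hG : G ∈ facesAt n r c u v F i) :
    ∃ k, y ∈ segment ℝ (polygonVertex n r (c G) (u G) (v G) k)
      (polygonVertex n r (c G) (u G) (v G) (k + 1)) := by
  by_cases hGF : G = F
  · subst hGF
    exact ⟨i, openSegment_subset_segment ℝ _ _ hy⟩
  have hyG := (D.mem_facesAt_iff hy).mp hG
  have hyF := (D.mem_facesAt_iff hy).mp (D.mem_facesAt_self F i)
  obtain ⟨k, hk⟩ := exists_mem_triangle (D.frame G) hyG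
  obtain ⟨α, β, γ, hα, hβ, hγ, h1, he⟩ := mem_convexHull_triple.mp hk
  refine ⟨k, ?_⟩
  have h2 := D.inner_eq hyF
  have h3 := inner_combination (O := O) (c := c) F (c G) (polygonVertex n r (c G) (u G) (v G) k)
    (polygonVertex n r (c G) (u G) (v G) (k + 1)) (α := 0) (by linarith : 0 + α + β + γ = 1)
  rw [zero_smul, zero_add, ← he, h2] at h3
  have k1 := mul_le_mul_of_nonneg_left (D.inner_le F (D.polygon_subset G (D.vertex_mem G k))) hβ
  have k2 := mul_le_mul_of_nonneg_left
    (D.inner_le F (D.polygon_subset G (D.vertex_mem G (k + 1)))) hγ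
  have hα0 : α = 0 := by
    by_contra hne
    have k3 := mul_lt_mul_of_pos_left (D.inner_lt F G (Ne.symm hGF)) (hα.lt_of_ne (Ne.symm hne))
    have k4 : H = α * H + β * H + γ * H := by rw [← add_mul, ← add_mul, h1, one_mul]
    linarith
  subst hα0
  exact ⟨β, γ, hβ, hγ, by linarith, by rw [he, zero_smul, zero_add]⟩

end FaceData

end Platonic

/-! ### Covering multiplicities of the flag pieces -/

namespace Platonic

open Module Set

theorem polygonVertex_mod_succ {n : ℕ} {r : ℝ} {c u v : E3} (hn : 3 ≤ n) (k : ℕ) :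
    polygonVertex n r c u v (k % n + 1) = polygonVertex n r c u v (k + 1) :=
  polygonVertex_congr hn (by simp)

namespace FaceData

section Unions

variable {B : Set E3} {O : E3} {H : ℝ} {n : ℕ} {r : ℝ} {Φ : Type} {c u v : Φ → E3}

theorem polygon_eq_iUnion (D : FaceData B O H n r c u v) (F : Φ) :
    polygon n r (c F) (u F) (v F) = ⋃ k : Fin n, convexHull ℝ {c F,
      polygonVertex n r (c F) (u F) (v F) k, polygonVertex n r (c F) (u F) (v F) (k + 1)} := by
  have hn := (D.frame F).hn
  refine Subset.antisymm (fun x hx => ?_) (iUnion_subset fun k => D.triangle_subset_polygon F k)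
  obtain ⟨k, hk⟩ := exists_mem_triangle (D.frame F) hx
  refine mem_iUnion.mpr ⟨⟨k % n, Nat.mod_lt _ (by omega)⟩, ?_⟩
  rwa [polygonVertex_mod hn, polygonVertex_mod_succ hn]

theorem frontier_eq_iUnion [Finite Φ] (D : FaceData B O H n r c u v) :
    frontier B = ⋃ j : Φ × Fin n, convexHull ℝ {c j.1,
      polygonVertex n r (c j.1) (u j.1) (v j.1) j.2,
      polygonVertex n r (c j.1) (u j.1) (v j.1) (j.2 + 1)} := by
  rw [D.frontier_eq, iUnion_prod']
  exact iUnion_congr fun F => D.polygon_eq_iUnion F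

theorem eq_iUnion [Finite Φ] [Nonempty Φ] (D : FaceData B O H n r c u v) :
    B = ⋃ j : Φ × Fin n, convexHull ℝ {O, c j.1,
      polygonVertex n r (c j.1) (u j.1) (v j.1) j.2,
      polygonVertex n r (c j.1) (u j.1) (v j.1) (j.2 + 1)} := by
  refine Subset.antisymm (fun x hx => ?_) (iUnion_subset fun j => D.tetrahedron_subset j.1 j.2)
  obtain ⟨F, k, hk⟩ := D.exists_mem_tetrahedron hx
  have hn := (D.frame F).hn
  refine mem_iUnion.mpr ⟨(F, ⟨k % n, Nat.mod_lt _ (by omega)⟩), ?_⟩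
  rwa [polygonVertex_mod hn, polygonVertex_mod_succ hn]

theorem eq_singleton_of_unique {y : E3} {T : Φ × Fin n → Set E3} {F : Φ} {i : Fin n}
    (h0 : y ∈ T (F, i)) (h : ∀ G k, y ∈ T (G, k) → F = G ∧ (i : ℕ) % n = k % n) :
    {k | y ∈ T k}.ncard = 1 := by
  rw [ncard_eq_one]
  refine ⟨(F, i), Subset.antisymm ?_ (singleton_subset_iff.mpr h0)⟩
  rintro ⟨G, k⟩ hk
  obtain ⟨h1, h2⟩ := h G k hk
  rw [Nat.mod_eq_of_lt i.2, Nat.mod_eq_of_lt k.2] at h2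
  exact Prod.ext h1.symm (Fin.ext h2.symm)

theorem ncard_tetrahedra (D : FaceData B O H n r c u v) {F : Φ} {i : Fin n} {y : E3}
    (hy : y ∈ openTetrahedron O (c F) (polygonVertex n r (c F) (u F) (v F) i)
      (polygonVertex n r (c F) (u F) (v F) (i + 1))) :
    {j : Φ × Fin n | y ∈ convexHull ℝ {O, c j.1, polygonVertex n r (c j.1) (u j.1) (v j.1) j.2,
      polygonVertex n r (c j.1) (u j.1) (v j.1) (j.2 + 1)}}.ncard = 1 := by
  refine eq_singleton_of_unique (F := F) (i := i) (openTetrahedron_subset _ _ _ _ hy)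
    fun G k hk => ?_
  obtain ⟨α, β, γ, δ, hα, hβ, hγ, hδ, h1, rfl⟩ := hy
  obtain ⟨α', β', γ', δ', hα', hβ', hγ', hδ', h1', h⟩ := mem_convexHull_quadruple.mp hk
  exact D.flag_unique hβ hγ hδ h1 hβ' hγ' hδ' h1' h

theorem ncard_triangles (D : FaceData B O H n r c u v) {F : Φ} {i : Fin n} {y : E3}
    (hy : y ∈ openTriangle (c F) (polygonVertex n r (c F) (u F) (v F) i)
      (polygonVertex n r (c F) (u F) (v F) (i + 1))) :
    {j : Φ × Fin n | y ∈ convexHull ℝ {c j.1, polygonVertex n r (c j.1) (u j.1) (v j.1) j.2,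
      polygonVertex n r (c j.1) (u j.1) (v j.1) (j.2 + 1)}}.ncard = 1 := by
  refine eq_singleton_of_unique (F := F) (i := i) (openTriangle_subset _ _ _ hy)
    fun G k hk => ?_
  obtain ⟨β, γ, δ, hβ, hγ, hδ, h1, rfl⟩ := hy
  obtain ⟨β', γ', δ', hβ', hγ', hδ', h1', h⟩ := mem_convexHull_triple.mp hk
  exact D.flag_unique (O := O) (α := 0) (α' := 0) hβ hγ hδ (by linarith) hβ' hγ' hδ' (by linarith)
    (by simpa using h)

/-- The segment does not depend on the side, so it is repeated once for each of the `n` flags of its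
face. -/
theorem ncard_centerSegments (D : FaceData B O H n r c u v) {F : Φ} {y : E3}
    (hy : y ∈ openSegment ℝ O (c F)) :
    {j : Φ × Fin n | y ∈ segment ℝ O (c j.1)}.ncard = n := by
  have h : {j : Φ × Fin n | y ∈ segment ℝ O (c j.1)} = Prod.mk F '' univ := by
    ext ⟨G, k⟩
    constructor
    · rintro ⟨α', β', hα', hβ', h1', h'⟩
      obtain ⟨α, β, hα, hβ, h1, h⟩ := hy
      obtain ⟨rfl, -⟩ := D.face_unique (i := 0) (k := 0) (F := F) (G := G) (α := α) (α' := α')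
        (γ := 0) (γ' := 0) (δ := 0) (δ' := 0) hβ le_rfl le_rfl (by linarith) hβ' le_rfl le_rfl
        (by linarith) (by simpa using h.trans h'.symm)
      exact ⟨k, trivial, rfl⟩
    · rintro ⟨k', -, hk'⟩
      obtain ⟨rfl, rfl⟩ := Prod.ext_iff.mp hk'
      exact openSegment_subset_segment ℝ _ _ hy
  rw [h, ncard_image_of_injective _ (Prod.mk_right_injective F), ncard_univ, Nat.card_eq_fintype_card,
    Fintype.card_fin]

theorem ncard_centerVertexSegments (D : FaceData B O H n r c u v) {F : Φ} {i : Fin n} {y : E3}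
    (hy : y ∈ openSegment ℝ (c F) (polygonVertex n r (c F) (u F) (v F) (i + 1))) :
    {j : Φ × Fin n | y ∈ segment ℝ (c j.1)
      (polygonVertex n r (c j.1) (u j.1) (v j.1) (j.2 + 1))}.ncard = 1 := by
  refine eq_singleton_of_unique (F := F) (i := i) (openSegment_subset_segment ℝ _ _ hy)
    fun G k hk => ?_
  obtain ⟨β, δ, hβ, hδ, h1, rfl⟩ := hy
  obtain ⟨β', δ', hβ', hδ', h1', h⟩ := hk
  obtain ⟨h2, h3⟩ := D.center_vertex_unique hβ hδ h1 hβ' hδ' h1' h.symm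
  exact ⟨h2, Nat.ModEq.add_right_cancel' 1 h3⟩

/-- Each face through the vertex contributes exactly one flag having it as left vertex. The
hypothesis `hv` guarantees that a face containing the point has it as a vertex. -/
theorem ncard_vertexSegments (D : FaceData B O H n r c u v) {F : Φ} {i : Fin n} {y : E3}
    (hy : y ∈ openSegment ℝ O (polygonVertex n r (c F) (u F) (v F) i))
    (hv : ∀ G, polygonVertex n r (c F) (u F) (v F) i ∈ polygon n r (c G) (u G) (v G) →
      ∃ k, polygonVertex n r (c F) (u F) (v F) i = polygonVertex n r (c G) (u G) (v G) k) :
    {j : Φ × Fin n | y ∈ segment ℝ O (polygonVertex n r (c j.1) (u j.1) (v j.1) j.2)}.ncard =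
      {G | polygonVertex n r (c F) (u F) (v F) i ∈ polygon n r (c G) (u G) (v G)}.ncard := by
  have hval : ∀ j : Φ × Fin n, y ∈ segment ℝ O (polygonVertex n r (c j.1) (u j.1) (v j.1) j.2) →
      polygonVertex n r (c F) (u F) (v F) i = polygonVertex n r (c j.1) (u j.1) (v j.1) j.2 := by
    rintro j ⟨α', γ', hα', hγ', h1', h'⟩
    obtain ⟨α, γ, hα, hγ, h1, h⟩ := hy
    exact D.vertex_unique hγ h1 hγ' h1' (h.trans h'.symm)
  rw [← InjOn.ncard_image (f := Prod.fst)
    (s := {j : Φ × Fin n | y ∈ segment ℝ O (polygonVertex n r (c j.1) (u j.1) (v j.1) j.2)})]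
  · congr 1
    ext G
    constructor
    · rintro ⟨j, hj, rfl⟩
      rw [mem_ofPred_eq, hval j hj]
      exact D.vertex_mem _ _
    · intro hG
      obtain ⟨k, hk⟩ := hv G hG
      have hn := (D.frame F).hn
      refine ⟨(G, ⟨k % n, Nat.mod_lt _ (by omega)⟩), ?_, rfl⟩
      rw [mem_ofPred_eq, polygonVertex_mod hn, ← hk]
      exact openSegment_subset_segment ℝ _ _ hy
  · rintro ⟨G, k⟩ hk ⟨G', l⟩ hl hGG
    obtain rfl : G = G' := hGG
    have := polygonVertex_inj (D.frame G) ((hval (G, k) hk).symm.trans (hval (G, l) hl))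
    rw [Nat.mod_eq_of_lt k.2, Nat.mod_eq_of_lt l.2] at this
    exact Prod.ext rfl (Fin.ext this)

/-- Each of the two faces at the side contributes exactly one flag. -/
theorem ncard_sides [Finite Φ] (D : FaceData B O H n r c u v) {F : Φ} {i : Fin n} {y : E3}
    (hy : y ∈ openSegment ℝ (polygonVertex n r (c F) (u F) (v F) i)
      (polygonVertex n r (c F) (u F) (v F) (i + 1))) :
    {j : Φ × Fin n | y ∈ segment ℝ (polygonVertex n r (c j.1) (u j.1) (v j.1) j.2)
      (polygonVertex n r (c j.1) (u j.1) (v j.1) (j.2 + 1))}.ncard = 2 := by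
  rw [← D.ncard_facesAt F i, ← InjOn.ncard_image (f := Prod.fst)
    (s := {j : Φ × Fin n | y ∈ segment ℝ (polygonVertex n r (c j.1) (u j.1) (v j.1) j.2)
      (polygonVertex n r (c j.1) (u j.1) (v j.1) (j.2 + 1))})]
  · congr 1
    ext G
    constructor
    · rintro ⟨j, hj, rfl⟩
      rw [D.mem_facesAt_iff hy]
      exact (convex_convexHull ℝ _).segment_subset (D.vertex_mem _ _) (D.vertex_mem _ _) hj
    · intro hG
      obtain ⟨k, hk⟩ := D.exists_side hy hG
      have hn := (D.frame F).hn
      refine ⟨(G, ⟨k % n, Nat.mod_lt _ (by omega)⟩), ?_, rfl⟩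
      rwa [mem_ofPred_eq, polygonVertex_mod hn, polygonVertex_mod_succ hn]
  · rintro ⟨G, k⟩ hk ⟨G', l⟩ hl hGG
    obtain rfl : G = G' := hGG
    have := D.side_unique hy hk hl
    rw [Nat.mod_eq_of_lt k.2, Nat.mod_eq_of_lt l.2] at this
    exact Prod.ext rfl (Fin.ext this)

end Unions

/-! ### The vertices and the families of segments as unions over flags -/

section Platonic

variable {B : Set E3} {O : E3} {R H : ℝ} {n : ℕ} {r : ℝ} {c u v : {F // IsFace 2 B F} → E3}

theorem extremePoints_face (D : FaceData B O H n r c u v)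
    (hpoly : ∀ F, F.1 = polygon n r (c F) (u F) (v F)) (F : {F // IsFace 2 B F}) :
    F.1.extremePoints ℝ = range (polygonVertex n r (c F) (u F) (v F)) := by
  rw [hpoly F, extremePoints_polygon (D.frame F)]

theorem vertex_mem_extremePoints (D : FaceData B O H n r c u v)
    (hpoly : ∀ F, F.1 = polygon n r (c F) (u F) (v F)) (F : {F // IsFace 2 B F}) (k : ℕ) :
    polygonVertex n r (c F) (u F) (v F) k ∈ B.extremePoints ℝ := by
  refine F.2.2.1.isExtreme.extremePoints_subset_extremePoints ?_
  rw [D.extremePoints_face hpoly]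
  exact ⟨k, rfl⟩

theorem exists_eq_vertex (D : FaceData B O H n r c u v) {x : E3} (hx : x ∈ B.extremePoints ℝ)
    (G : {F // IsFace 2 B F}) (hG : x ∈ polygon n r (c G) (u G) (v G)) :
    ∃ k, x = polygonVertex n r (c G) (u G) (v G) k := by
  have h : x ∈ (polygon n r (c G) (u G) (v G)).extremePoints ℝ :=
    inter_extremePoints_subset_extremePoints_of_subset (D.polygon_subset G) ⟨hG, hx⟩
  rw [extremePoints_polygon (D.frame G)] at h
  obtain ⟨k, hk⟩ := h
  exact ⟨k, hk.symm⟩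

theorem ncard_faces
    (hpoly : ∀ F, F.1 = polygon n r (c F) (u F) (v F)) (x : E3) :
    {G | x ∈ polygon n r (c G) (u G) (v G)}.ncard = {F : Set E3 | IsFace 2 B F ∧ x ∈ F}.ncard := by
  rw [← ncard_image_of_injective _ Subtype.val_injective]
  congr 1
  ext F
  constructor
  · rintro ⟨G, hG, rfl⟩
    refine ⟨G.2, ?_⟩
    rw [hpoly G]
    exact hG
  · rintro ⟨hF, hx⟩
    refine ⟨⟨F, hF⟩, ?_, rfl⟩
    rw [mem_ofPred_eq, ← hpoly]
    exact hx

/-- An extreme point of `B` lies in some flag simplex and is extreme there, hence is a corner. The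
corners `O` and `c F` are excluded, since they are closer to `O` than `R`. -/
theorem extremePoints_eq [Finite {F // IsFace 2 B F}] [Nonempty {F // IsFace 2 B F}]
    (D : FaceData B O H n r c u v) (hpoly : ∀ F, F.1 = polygon n r (c F) (u F) (v F))
    (hR : H + r ^ 2 = R ^ 2) (hO : B.extremePoints ℝ ⊆ Metric.sphere O R) :
    B.extremePoints ℝ = {x | ∃ (F : {F // IsFace 2 B F}) (k : Fin n),
      x = polygonVertex n r (c F) (u F) (v F) k} := by
  have hH := D.H_pos
  refine Subset.antisymm (fun x hx => ?_) ?_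
  · obtain ⟨⟨F, k⟩, hj⟩ := mem_iUnion.mp (D.eq_iUnion ▸ extremePoints_subset hx)
    have hr := (D.frame F).hr
    have h1 := extremePoints_convexHull_subset (inter_extremePoints_subset_extremePoints_of_subset
      (D.tetrahedron_subset F k) ⟨hj, hx⟩)
    have h2 := mem_sphere_iff_norm.mp (hO hx)
    rcases h1 with rfl | rfl | rfl | rfl
    · rw [sub_self, norm_zero] at h2
      rw [← h2] at hR
      nlinarith
    · have h3 := D.norm_sq F
      rw [h2] at h3
      nlinarith
    · exact ⟨F, k, rfl⟩
    · have hn := (D.frame F).hn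
      exact ⟨F, ⟨(k + 1) % n, Nat.mod_lt _ (by omega)⟩, (polygonVertex_mod hn _).symm⟩
  · rintro _ ⟨F, k, rfl⟩
    exact D.vertex_mem_extremePoints hpoly F k

/-- `IsCenter` allows any presentation of the polygon, so uniqueness has to be shown. Two centers
are both feet of the perpendicular from `O`; their difference is orthogonal to `c F - O` and to `x -
O`, hence to itself. -/
theorem isCenter_iff (D : FaceData B O H n r c u v)
    (hpoly : ∀ F, F.1 = polygon n r (c F) (u F) (v F))
    (hO : B.extremePoints ℝ ⊆ Metric.sphere O R) (F : {F // IsFace 2 B F}) (x : E3) :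
    IsCenter x F.1 ↔ x = c F := by
  constructor
  · rintro ⟨n', r', hn', hr', u', v', hu', hv', huv', hF⟩
    have P : PolygonFrame n' r' u' v' := ⟨hn', hr', hu', hv', huv'⟩
    have hF' : F.1 = polygon n' r' x u' v' := hF
    have hvert : ∀ k, ‖polygonVertex n' r' x u' v' k - O‖ = R := fun k => by
      have h1 : polygonVertex n' r' x u' v' k ∈ F.1.extremePoints ℝ := by
        rw [hF', extremePoints_polygon P]
        exact ⟨k, rfl⟩
      exact mem_sphere_iff_norm.mp (hO (F.2.2.1.isExtreme.extremePoints_subset_extremePoints h1))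
    obtain ⟨h1, h2, -⟩ := inner_center_eq_zero P hvert
    have hxF : x ∈ polygon n r (c F) (u F) (v F) := by
      rw [← hpoly F, hF']
      exact center_mem_polygon hn'
    have hcF : c F ∈ polygon n' r' x u' v' := by
      rw [← hF', hpoly F]
      exact D.center_mem F
    obtain ⟨a, b, hab⟩ := mem_span_of_mem_polygon hxF
    obtain ⟨a', b', hab'⟩ := mem_span_of_mem_polygon hcF
    have e1 : inner ℝ (c F - O) (x - c F) = 0 := by
      rw [hab, inner_add_right, inner_smul_right, inner_smul_right, D.inner_u, D.inner_v]
      ring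
    have e2 : inner ℝ (x - O) (c F - x) = 0 := by
      rw [hab', inner_add_right, inner_smul_right, inner_smul_right, h1, h2]
      ring
    have e3 : inner ℝ (x - c F) (x - c F) = (0 : ℝ) := by
      have h3 : x - c F = (x - O) - (c F - O) := by abel
      conv_lhs => rw [h3, inner_sub_left, ← h3]
      rw [e1, sub_zero, ← neg_sub (c F) x, inner_neg_right, e2, neg_zero]
    exact sub_eq_zero.mp (inner_self_eq_zero.mp e3)
  · rintro rfl
    have P := D.frame F
    exact ⟨n, r, P.hn, P.hr, u F, v F, P.hu, P.hv, P.huv, hpoly F⟩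

theorem sUnion_segmentsToCenters (D : FaceData B O H n r c u v)
    (hpoly : ∀ F, F.1 = polygon n r (c F) (u F) (v F))
    (hO : B.extremePoints ℝ ⊆ Metric.sphere O R) :
    ⋃₀ segmentsToCenters O B =
      ⋃ j : {F // IsFace 2 B F} × Fin n, segment ℝ O (c j.1) := by
  ext x
  constructor
  · rintro ⟨_, ⟨F, d, hF, hd, rfl⟩, hx⟩
    rw [D.isCenter_iff hpoly hO ⟨F, hF⟩] at hd
    have hn := (D.frame ⟨F, hF⟩).hn
    exact mem_iUnion.mpr ⟨(⟨F, hF⟩, ⟨0, by omega⟩), hd ▸ hx⟩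
  · intro hx
    obtain ⟨⟨F, k⟩, hx⟩ := mem_iUnion.mp hx
    exact ⟨_, ⟨F.1, c F, F.2, (D.isCenter_iff hpoly hO F _).mpr rfl, rfl⟩, hx⟩

theorem sUnion_segmentsToVertices [Finite {F // IsFace 2 B F}] [Nonempty {F // IsFace 2 B F}]
    (D : FaceData B O H n r c u v) (hpoly : ∀ F, F.1 = polygon n r (c F) (u F) (v F))
    (hR : H + r ^ 2 = R ^ 2) (hO : B.extremePoints ℝ ⊆ Metric.sphere O R) :
    ⋃₀ segmentsToVertices O B = ⋃ j : {F // IsFace 2 B F} × Fin n,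
      segment ℝ O (polygonVertex n r (c j.1) (u j.1) (v j.1) j.2) := by
  ext x
  constructor
  · rintro ⟨_, ⟨p, hp, rfl⟩, hx⟩
    rw [D.extremePoints_eq hpoly hR hO] at hp
    obtain ⟨F, k, rfl⟩ := hp
    exact mem_iUnion.mpr ⟨(F, k), hx⟩
  · intro hx
    obtain ⟨⟨F, k⟩, hx⟩ := mem_iUnion.mp hx
    exact ⟨_, ⟨_, D.vertex_mem_extremePoints hpoly F k, rfl⟩, hx⟩

theorem sUnion_segmentsCenterToVertex (D : FaceData B O H n r c u v)
    (hpoly : ∀ F, F.1 = polygon n r (c F) (u F) (v F))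
    (hO : B.extremePoints ℝ ⊆ Metric.sphere O R) :
    ⋃₀ segmentsCenterToVertex B = ⋃ j : {F // IsFace 2 B F} × Fin n,
      segment ℝ (c j.1) (polygonVertex n r (c j.1) (u j.1) (v j.1) (j.2 + 1)) := by
  ext x
  constructor
  · rintro ⟨_, ⟨F, d, p, hF, hd, hp, rfl⟩, hx⟩
    rw [D.isCenter_iff hpoly hO ⟨F, hF⟩] at hd
    rw [D.extremePoints_face hpoly ⟨F, hF⟩] at hp
    obtain ⟨k, rfl⟩ := hp
    have hn := (D.frame ⟨F, hF⟩).hn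
    -- The segment of a flag ends at the right vertex `j.2 + 1`, so the index is shifted back by one
    -- modulo `n`.
    refine mem_iUnion.mpr ⟨(⟨F, hF⟩, ⟨(k + n - 1) % n, Nat.mod_lt _ (by omega)⟩), ?_⟩
    rw [polygonVertex_mod_succ hn, show k + n - 1 + 1 = k + n by omega, polygonVertex_add_self hn]
    exact hd ▸ hx
  · intro hx
    obtain ⟨⟨F, k⟩, hx⟩ := mem_iUnion.mp hx
    refine ⟨_, ⟨F.1, c F, _, F.2, (D.isCenter_iff hpoly hO F _).mpr rfl, ?_, rfl⟩, hx⟩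
    rw [D.extremePoints_face hpoly]
    exact ⟨_, rfl⟩

/-- Each functional is at most `H` on `B`, and the sum `2 * H` is attained at the common point `p`;
hence the sum is maximal exactly where both summands are. -/
theorem faceOf_add_eq (D : FaceData B O H n r c u v) {F G : {F // IsFace 2 B F}} {p : E3}
    (hpF : p ∈ polygon n r (c F) (u F) (v F)) (hpG : p ∈ polygon n r (c G) (u G) (v G)) :
    faceOf B ((c F - O) + (c G - O)) =
      polygon n r (c F) (u F) (v F) ∩ polygon n r (c G) (u G) (v G) := by
  have hkey : ∀ x y, inner ℝ ((c F - O) + (c G - O)) y ≤ inner ℝ ((c F - O) + (c G - O)) x ↔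
      inner ℝ (c F - O) (y - O) + inner ℝ (c G - O) (y - O) ≤
        inner ℝ (c F - O) (x - O) + inner ℝ (c G - O) (x - O) := fun x y => by
    rw [← inner_add_left, ← inner_add_left, inner_sub_right _ y, inner_sub_right _ x,
      sub_le_sub_iff_right]
  ext x
  constructor
  · rintro ⟨hx, hmax⟩
    have h1 := (hkey x p).mp (hmax p (D.polygon_subset F hpF))
    rw [D.inner_eq hpF, D.inner_eq hpG] at h1
    have h2 := D.inner_le F hx
    have h3 := D.inner_le G hx
    exact ⟨(D.mem_polygon_iff F x).mpr ⟨hx, by linarith⟩,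
      (D.mem_polygon_iff G x).mpr ⟨hx, by linarith⟩⟩
  · rintro ⟨hxF, hxG⟩
    refine ⟨D.polygon_subset F hxF, fun y hy => (hkey x y).mpr ?_⟩
    rw [D.inner_eq hxF, D.inner_eq hxG]
    exact add_le_add (D.inner_le F hy) (D.inner_le G hy)

/-- Directions inside both faces are orthogonal to both normals. The sum and difference of the
normals are nonzero and, the normals having equal length, orthogonal to each other; so only the
direction of the side remains. -/
theorem isFace_one_inter (D : FaceData B O H n r c u v) {F G : {F // IsFace 2 B F}} {i : ℕ}
    (hG : G ∈ facesAt n r c u v F i) (hne : G ≠ F) :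
    IsFace 1 B (polygon n r (c F) (u F) (v F) ∩ polygon n r (c G) (u G) (v G)) := by
  have hF := D.mem_facesAt_self F i
  have hface := D.faceOf_add_eq hF.1 hG.1
  set p := polygonVertex n r (c F) (u F) (v F) i with hp
  set q := polygonVertex n r (c F) (u F) (v F) (i + 1) with hq
  refine ⟨⟨p, hF.1, hG.1⟩, hface ▸ isExposed_faceOf B _, ?_⟩
  have hH := D.H_pos
  have he0 : q - p ≠ 0 := sub_ne_zero.mpr (vertex_ne_succ (D.frame F) i).symm
  have hmem : q - p ∈ vectorSpan ℝ (polygon n r (c F) (u F) (v F) ∩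
      polygon n r (c G) (u G) (v G)) := vsub_mem_vectorSpan ℝ ⟨hF.2, hG.2⟩ ⟨hF.1, hG.1⟩
  have hspan : vectorSpan ℝ (polygon n r (c F) (u F) (v F) ∩ polygon n r (c G) (u G) (v G)) =
      ℝ ∙ (q - p) := by
    refine le_antisymm ?_ ((Submodule.span_singleton_le_iff_mem _ _).mpr hmem)
    rw [vectorSpan, Submodule.span_le]
    rintro _ ⟨x, ⟨hxF, hxG⟩, y, ⟨hyF, hyG⟩, rfl⟩
    have hsum0 : (c F - O) + (c G - O) ≠ 0 := by
      intro h
      have h1 := D.inner_eq hF.1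
      have h2 := D.inner_eq hG.1
      have h3 : inner ℝ ((c F - O) + (c G - O)) (p - O) = 0 := by rw [h, inner_zero_left]
      rw [inner_add_left, h1, h2] at h3
      linarith
    have hdiff0 : (c F - O) - (c G - O) ≠ 0 := by
      rw [sub_sub_sub_cancel_right]
      exact sub_ne_zero.mpr fun h => hne (D.injective h).symm
    have horth : inner ℝ ((c F - O) + (c G - O)) ((c F - O) - (c G - O)) = 0 := by
      rw [real_inner_add_sub_eq_zero_iff, ← sq_eq_sq₀ (norm_nonneg _) (norm_nonneg _), D.norm_sq,
        D.norm_sq]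
    have hd : ∀ {K} {x y : E3}, x ∈ polygon n r (c K) (u K) (v K) →
        y ∈ polygon n r (c K) (u K) (v K) → inner ℝ (x - y) (c K - O) = 0 := fun {K x y} hx hy => by
      rw [real_inner_comm, ← sub_sub_sub_cancel_right x y O, inner_sub_right, D.inner_eq hx,
        D.inner_eq hy, sub_self]
    obtain ⟨l, hl⟩ := exists_eq_smul_of_orthogonal' (w := q - p) (a := x - y) hsum0 hdiff0 he0 horth
      (by rw [inner_add_right, hd hF.2 hF.1, hd hG.2 hG.1, add_zero])
      (by rw [inner_sub_right, hd hF.2 hF.1, hd hG.2 hG.1, sub_self])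
      (by rw [inner_add_right, hd hxF hyF, hd hxG hyG, add_zero])
      (by rw [inner_sub_right, hd hxF hyF, hd hxG hyG, sub_self])
    change x - y ∈ _
    rw [hl]
    exact Submodule.smul_mem _ _ (Submodule.mem_span_singleton_self _)
  rw [hspan, finrank_span_singleton he0]

/-- Conversely to the preceding construction, a point of a one-dimensional face lies on the
boundary, in some triangle of a face `F`; it remains to see that it has no weight at the center of
`F`. -/
theorem sUnion_edges [Finite {F // IsFace 2 B F}]
    (D : FaceData B O H n r c u v) (hpoly : ∀ F, F.1 = polygon n r (c F) (u F) (v F))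
    (hint : (interior B).Nonempty) :
    ⋃₀ edges B = ⋃ j : {F // IsFace 2 B F} × Fin n,
      segment ℝ (polygonVertex n r (c j.1) (u j.1) (v j.1) j.2)
        (polygonVertex n r (c j.1) (u j.1) (v j.1) (j.2 + 1)) := by
  ext x
  constructor
  · rintro ⟨s, hs, hx⟩
    obtain ⟨w, rfl⟩ := exists_eq_faceOf hs.1 hs.2.1
    have hw0 := ne_zero_of_isFace (by norm_num) hint hs rfl
    have hxi : x ∉ interior B := by
      intro hxi
      have hcont : ContinuousAt (fun t : ℝ => x + t • w) 0 := by fun_prop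
      have hnhds : ∀ᶠ t : ℝ in nhds 0, x + t • w ∈ B := by
        refine hcont.eventually_mem ?_
        simpa using mem_interior_iff_mem_nhds.mp hxi
      obtain ⟨t, ht, ht0⟩ := ((hnhds.filter_mono nhdsWithin_le_nhds).and
        (self_mem_nhdsWithin : Ioi (0 : ℝ) ∈ nhdsWithin 0 (Ioi 0))).exists
      have h1 := hx.2 _ ht
      rw [inner_add_right, inner_smul_right, real_inner_self_eq_norm_sq] at h1
      have h2 : 0 < ‖w‖ ^ 2 := by positivity
      have := mul_pos (mem_Ioi.mp ht0) h2
      linarith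
    obtain ⟨F, hF⟩ := D.exists_mem_polygon hx.1 hxi
    rw [D.polygon_eq_iUnion, mem_iUnion] at hF
    obtain ⟨k, hk⟩ := hF
    obtain ⟨α, β, γ, hα, hβ, hγ, h1, he⟩ := mem_convexHull_triple.mp hk
    refine mem_iUnion.mpr ⟨(F, k), ?_⟩
    -- A positive weight would make `w` maximal at the center. The center is the mean of the
    -- vertices, so `w` would be maximal at every vertex, and the two-dimensional face `F` would lie
    -- in a one-dimensional one.
    have hα0 : α = 0 := by
      by_contra hne
      have hα' : 0 < α := hα.lt_of_ne (Ne.symm hne)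
      have hmax : ∀ y ∈ polygon n r (c F) (u F) (v F), inner ℝ w y ≤ inner ℝ w x :=
        fun y hy => hx.2 y (D.polygon_subset F hy)
      have hc : inner ℝ w (c F) = inner ℝ w x := by
        refine le_antisymm (hmax _ (D.center_mem F)) ?_
        have h2 : inner ℝ w x = α * inner ℝ w (c F) +
            β * inner ℝ w (polygonVertex n r (c F) (u F) (v F) k) +
            γ * inner ℝ w (polygonVertex n r (c F) (u F) (v F) (k + 1)) := by
          conv_lhs => rw [he, inner_add_right, inner_add_right, inner_smul_right, inner_smul_right,
            inner_smul_right]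
        have h3 := mul_le_mul_of_nonneg_left (hmax _ (D.vertex_mem F k)) hβ
        have h4 := mul_le_mul_of_nonneg_left (hmax _ (D.vertex_mem F (k + 1))) hγ
        have h5 : inner ℝ w x = α * inner ℝ w x + β * inner ℝ w x + γ * inner ℝ w x := by
          rw [← add_mul, ← add_mul, h1, one_mul]
        have h6 : α * inner ℝ w x ≤ α * inner ℝ w (c F) := by linarith
        exact le_of_mul_le_mul_left h6 hα'
      have hv : ∀ l ∈ Finset.range n,
          inner ℝ w (polygonVertex n r (c F) (u F) (v F) l) = inner ℝ w x := by
        have hsum := congrArg (inner ℝ w) (sum_polygonVertex (r := r) (c := c F) (u := u F) (v := v F)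
          (D.frame F).hn)
        rw [inner_sum, inner_smul_right, hc] at hsum
        refine (Finset.sum_eq_sum_iff_of_le fun l _ => hmax _ (D.vertex_mem F l)).mp ?_
        rw [hsum, Finset.sum_const, Finset.card_range, nsmul_eq_mul]
      have hsub : F.1 ⊆ faceOf B w := by
        rw [hpoly F]
        refine convexHull_min ?_ ((isExposed_faceOf B w).convex D.convex)
        rintro _ ⟨l, rfl⟩
        refine ⟨D.polygon_subset F (D.vertex_mem F l), fun y hy => ?_⟩
        rw [hv l (Finset.mem_range.mpr l.2)]
        exact hx.2 y hy
      have h2 := Submodule.finrank_mono (vectorSpan_mono ℝ hsub)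
      rw [F.2.2.2, hs.2.2] at h2
      omega
    subst hα0
    exact ⟨β, γ, hβ, hγ, by linarith, by rw [he, zero_smul, zero_add]⟩
  · intro hx
    obtain ⟨⟨F, k⟩, hx⟩ := mem_iUnion.mp hx
    obtain ⟨G, hG, hne⟩ := D.exists_other_face F k
    refine ⟨_, D.isFace_one_inter hG hne, ?_, ?_⟩
    · exact (convex_convexHull ℝ _).segment_subset (D.vertex_mem _ _) (D.vertex_mem _ _) hx
    · exact (convex_convexHull ℝ _).segment_subset hG.1 hG.2 hx

end Platonic

end FaceData

end Platonic

/-! ### Transfer to the reference simplex by isometries -/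

namespace Platonic

open Module Set

theorem image_triple {E F : Type*} [AddCommGroup E] [Module ℝ E] [AddCommGroup F] [Module ℝ F]
    (g : E →ᵃ[ℝ] F) (p q r : E) :
    g '' convexHull ℝ {p, q, r} = convexHull ℝ {g p, g q, g r} := by
  rw [AffineMap.image_convexHull, image_insert_eq, image_pair]

theorem image_quadruple {E F : Type*} [AddCommGroup E] [Module ℝ E] [AddCommGroup F] [Module ℝ F]
    (g : E →ᵃ[ℝ] F) (p q r s : E) :
    g '' convexHull ℝ {p, q, r, s} = convexHull ℝ {g p, g q, g r, g s} := by
  rw [AffineMap.image_convexHull, image_insert_eq, image_insert_eq, image_pair]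

theorem map_combination₃ (g : E3 →ᵃ[ℝ] E3) (p q r : E3) {a b c : ℝ} (h : a + b + c = 1) :
    g (a • p + b • q + c • r) = a • g p + b • g q + c • g r := by
  have hg : ∀ x, g x = g.linear x + g 0 := fun x => by simpa using congrFun g.decomp x
  simp only [hg p, hg q, hg r, hg (a • p + b • q + c • r), map_add, map_smul]
  obtain rfl : c = 1 - a - b := by linarith
  module

theorem map_combination₄ (g : E3 →ᵃ[ℝ] E3) (p q r s : E3) {a b c d : ℝ} (h : a + b + c + d = 1) :
    g (a • p + b • q + c • r + d • s) = a • g p + b • g q + c • g r + d • g s := by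
  have hg : ∀ x, g x = g.linear x + g 0 := fun x => by simpa using congrFun g.decomp x
  simp only [hg p, hg q, hg r, hg s, hg (a • p + b • q + c • r + d • s), map_add, map_smul]
  obtain rfl : d = 1 - a - b - c := by linarith
  module

theorem image_openTriangle (g : E3 →ᵃ[ℝ] E3) (p q r : E3) :
    g '' openTriangle p q r = openTriangle (g p) (g q) (g r) := by
  ext x
  constructor
  · rintro ⟨_, ⟨a, b, c, ha, hb, hc, h, rfl⟩, rfl⟩
    exact ⟨a, b, c, ha, hb, hc, h, map_combination₃ g p q r h⟩
  · rintro ⟨a, b, c, ha, hb, hc, h, rfl⟩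
    exact ⟨_, ⟨a, b, c, ha, hb, hc, h, rfl⟩, map_combination₃ g p q r h⟩

theorem map_mem_openTetrahedron (g : E3 →ᵃ[ℝ] E3) {p q r s x : E3}
    (hx : x ∈ openTetrahedron p q r s) : g x ∈ openTetrahedron (g p) (g q) (g r) (g s) := by
  obtain ⟨a, b, c, d, ha, hb, hc, hd, h, rfl⟩ := hx
  exact ⟨a, b, c, d, ha, hb, hc, hd, h, map_combination₄ g p q r s h⟩

theorem frontier_image_homothety (O : E3) {t : ℝ} (ht : t ≠ 0) (B : Set E3) :
    frontier (AffineMap.homothety O t '' B) = AffineMap.homothety O t '' frontier B := by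
  have h := ((AffineEquiv.homothetyUnitsMulHom O
    (Units.mk0 t ht)).toContinuousAffineEquiv.toHomeomorph).image_frontier B
  exact h.symm

/-- Exchanges center and left vertex, which selects the other pair of opposite edges: `O` to vertex,
and center to vertex. -/
theorem Nondegenerate.swap {p q r s : E3} (h : Nondegenerate p q r s) : Nondegenerate p r q s := by
  intro a b c habc
  obtain ⟨h1, h2, h3⟩ := h b a c (by rw [← habc]; abel)
  exact ⟨h2, h1, h3⟩

/-- A family of isometries which carry a fixed simplex to simplices with a common apex. -/
structure FlagMaps {J : Type*} (ι : J → E3 ≃ᵃⁱ[ℝ] E3) (p q r s p' : E3) (q' r' s' : J → E3) :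
    Prop where
  nondegenerate : Nondegenerate p q r s
  map_apex : ∀ j, ι j p = p'
  map_center : ∀ j, ι j q = q' j
  map_left : ∀ j, ι j r = r' j
  map_right : ∀ j, ι j s = s' j

/-- The average of `f` over a finite family of isometries. -/
noncomputable def symmetrize {J : Type*} [Fintype J] (ι : J → E3 ≃ᵃⁱ[ℝ] E3) (f : E3 → ℝ) (x : E3) :
    ℝ := (Fintype.card J : ℝ)⁻¹ * ∑ j, f (ι j x)

theorem convexOn_symmetrize {J : Type*} [Fintype J] {ι : J → E3 ≃ᵃⁱ[ℝ] E3} {f : E3 → ℝ}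
    {s : Set E3} (hs : Convex ℝ s) (h : ∀ j, ConvexOn ℝ s (f ∘ ι j)) :
    ConvexOn ℝ s (symmetrize ι f) := by
  refine ConvexOn.smul (by positivity) ⟨hs, fun x hx y hy a b ha hb hab => ?_⟩
  have h1 := Finset.sum_le_sum fun j (_ : j ∈ Finset.univ) => (h j).2 hx hy ha hb hab
  rw [Finset.sum_add_distrib, ← Finset.smul_sum, ← Finset.smul_sum] at h1
  exact h1

namespace FlagMaps

variable {J : Type*} {ι : J → E3 ≃ᵃⁱ[ℝ] E3} {p q r s p' : E3} {q' r' s' : J → E3} {f : E3 → ℝ}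
  {m : ℕ}

theorem image_tetrahedron (M : FlagMaps ι p q r s p' q' r' s') (j : J) :
    ι j '' convexHull ℝ {p, q, r, s} = convexHull ℝ {p', q' j, r' j, s' j} := by
  rw [← M.map_apex j, ← M.map_center, ← M.map_left, ← M.map_right]
  exact image_quadruple (ι j).toAffineEquiv.toAffineMap p q r s

theorem image_triangle (M : FlagMaps ι p q r s p' q' r' s') (j : J) :
    ι j '' convexHull ℝ {q, r, s} = convexHull ℝ {q' j, r' j, s' j} := by
  rw [← M.map_center, ← M.map_left, ← M.map_right]
  exact image_triple (ι j).toAffineEquiv.toAffineMap q r s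

theorem map_homothety (M : FlagMaps ι p q r s p' q' r' s') (j : J) (t : ℝ) (x : E3) :
    ι j (AffineMap.homothety p t x) = AffineMap.homothety p' t (ι j x) := by
  rw [← M.map_apex j, AffineMap.homothety_eq_lineMap, AffineMap.homothety_eq_lineMap]
  exact (ι j).toAffineEquiv.toAffineMap.apply_lineMap p x t

theorem image_segment_eq (j : J) (x y : E3) :
    ι j '' segment ℝ x y = segment ℝ (ι j x) (ι j y) :=
  image_segment ℝ (ι j).toAffineEquiv.toAffineMap x y

theorem map_mem_openSegment (j : J) {x y z : E3} (hz : z ∈ openSegment ℝ x y) :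
    ι j z ∈ openSegment ℝ (ι j x) (ι j y) := by
  have h := image_openSegment ℝ (ι j).toAffineEquiv.toAffineMap x y
  exact h ▸ mem_image_of_mem _ hz

theorem convexOn_comp (M : FlagMaps ι p q r s p' q' r' s')
    (hf : ∀ j, ConvexOn ℝ (convexHull ℝ {p', q' j, r' j, s' j}) f) (j : J) :
    ConvexOn ℝ (convexHull ℝ {p, q, r, s}) (f ∘ ι j) :=
  ((hf j).comp_affineMap (ι j).toAffineEquiv.toAffineMap).subset
    (image_subset_iff.mp (M.image_tetrahedron j).subset) (convex_convexHull ℝ _)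

theorem symmetrize_apex [Fintype J] [Nonempty J] (M : FlagMaps ι p q r s p' q' r' s') :
    symmetrize ι f p = f p' := by
  have hJ : (Fintype.card J : ℝ) ≠ 0 := Nat.cast_ne_zero.mpr Fintype.card_ne_zero
  simp [symmetrize, M.map_apex, hJ]

theorem measurableSet_convexHull {A : Set E3} (hA : A.Finite) :
    MeasurableSet (convexHull ℝ A) := (hA.isCompact_convexHull (𝕜 := ℝ)).measurableSet

/-- The constant 1 is convex, so the integrability results for simplices also give finiteness of
their measure. -/
theorem measure_ne_top {A : Set E3} {d : ℕ}
    (h : IntegrableOn (fun _ => (1 : ℝ)) A μHE[d]) : μHE[d] A ≠ ⊤ := by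
  rw [integrableOn_const_iff] at h
  exact (h.resolve_left (by simp)).ne

theorem homothety {t : ℝ} (ht : t ≠ 0) (M : FlagMaps ι p q r s p' q' r' s') :
    FlagMaps ι p (AffineMap.homothety p t q) (AffineMap.homothety p t r)
      (AffineMap.homothety p t s) p' (fun j => AffineMap.homothety p' t (q' j))
      (fun j => AffineMap.homothety p' t (r' j)) (fun j => AffineMap.homothety p' t (s' j)) where
  nondegenerate := M.nondegenerate.homothety ht
  map_apex := M.map_apex
  map_center j := by rw [M.map_homothety, M.map_center]
  map_left j := by rw [M.map_homothety, M.map_left]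
  map_right j := by rw [M.map_homothety, M.map_right]

variable [Fintype J] [Nonempty J]

theorem solid (M : FlagMaps ι p q r s p' q' r' s')
    (hf : ∀ j, ConvexOn ℝ (convexHull ℝ {p', q' j, r' j, s' j}) f)
    (hcount : ∀ j, ∀ x ∈ openTetrahedron p' (q' j) (r' j) (s' j),
      {k | x ∈ convexHull ℝ {p', q' k, r' k, s' k}}.ncard = 1) :
    IntegrableOn f (⋃ j, convexHull ℝ {p', q' j, r' j, s' j}) μHE[3] ∧
      Avg 3 f (⋃ j, convexHull ℝ {p', q' j, r' j, s' j}) =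
        Avg 3 (symmetrize ι f) (convexHull ℝ {p, q, r, s}) := by
  have hint := fun j => integrableOn_tetrahedron M.nondegenerate (M.convexOn_comp hf j)
  simp_rw [← M.image_tetrahedron] at hcount ⊢
  refine ⟨integrableOn_iUnion_image hint, avg_iUnion_image (measurableSet_convexHull (by simp))
    (tetrahedron_ae_eq M.nondegenerate) (measure_ne_top (integrableOn_tetrahedron M.nondegenerate
      (convexOn_const 1 (convex_convexHull ℝ _)))) one_ne_zero (fun j x hx => hcount j _ ?_) hint⟩
  rw [← M.map_apex j, ← M.map_center, ← M.map_left, ← M.map_right]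
  exact map_mem_openTetrahedron (ι j).toAffineEquiv.toAffineMap hx

theorem surface (M : FlagMaps ι p q r s p' q' r' s')
    (hf : ∀ j, ConvexOn ℝ (convexHull ℝ {p', q' j, r' j, s' j}) f)
    (hcount : ∀ j, ∀ x ∈ openTriangle (q' j) (r' j) (s' j),
      {k | x ∈ convexHull ℝ {q' k, r' k, s' k}}.ncard = 1) :
    IntegrableOn f (⋃ j, convexHull ℝ {q' j, r' j, s' j}) μHE[2] ∧
      Avg 2 f (⋃ j, convexHull ℝ {q' j, r' j, s' j}) =
        Avg 2 (symmetrize ι f) (convexHull ℝ {q, r, s}) := by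
  have hint := fun j => integrableOn_triangle M.nondegenerate (M.convexOn_comp hf j)
  simp_rw [← M.image_triangle] at hcount ⊢
  refine ⟨integrableOn_iUnion_image hint, avg_iUnion_image (measurableSet_convexHull (by simp))
    (triangle_ae_eq M.nondegenerate) (measure_ne_top (integrableOn_triangle M.nondegenerate
      (convexOn_const 1 (convex_convexHull ℝ _)))) one_ne_zero (fun j x hx => hcount j _ ?_) hint⟩
  rw [← M.map_center, ← M.map_left, ← M.map_right]
  exact (image_openTriangle (ι j).toAffineEquiv.toAffineMap q r s).subset (mem_image_of_mem _ hx)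

/-- Isometries commute with the homotheties about corresponding apexes, so the shrunken simplices
are again a family of flags. They lie inside the original ones, and injectivity of the homothety
preserves the multiplicity. -/
theorem homothety_surface {t : ℝ} (ht0 : 0 < t) (ht1 : t ≤ 1)
    (M : FlagMaps ι p q r s p' q' r' s')
    (hf : ∀ j, ConvexOn ℝ (convexHull ℝ {p', q' j, r' j, s' j}) f)
    (hcount : ∀ j, ∀ x ∈ openTriangle (q' j) (r' j) (s' j),
      {k | x ∈ convexHull ℝ {q' k, r' k, s' k}}.ncard = 1) :
    IntegrableOn f (AffineMap.homothety p' t '' ⋃ j, convexHull ℝ {q' j, r' j, s' j}) μHE[2] ∧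
      Avg 2 f (AffineMap.homothety p' t '' ⋃ j, convexHull ℝ {q' j, r' j, s' j}) =
        Avg 2 (symmetrize ι f) (AffineMap.homothety p t '' convexHull ℝ {q, r, s}) := by
  rw [image_iUnion]
  simp_rw [homothety_image_triangle]
  refine (M.homothety ht0.ne').surface (fun j => (hf j).subset (convexHull_min ?_
    (convex_convexHull ℝ _)) (convex_convexHull ℝ _)) fun j x hx => ?_
  · have hp : p' ∈ convexHull ℝ {p', q' j, r' j, s' j} := subset_convexHull ℝ _ (by simp)
    have h : ∀ y ∈ ({p', q' j, r' j, s' j} : Set E3),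
        AffineMap.homothety p' t y ∈ convexHull ℝ {p', q' j, r' j, s' j} := fun y hy =>
      AffineMap.homothety_eq_lineMap p' t y ▸ (convex_convexHull ℝ _).lineMap_mem hp
        (subset_convexHull ℝ _ hy) ⟨ht0.le, ht1⟩
    rintro y (rfl | rfl | rfl | rfl)
    · exact hp
    all_goals exact h _ (by simp)
  · rw [← image_openTriangle] at hx
    obtain ⟨y, hy, rfl⟩ := hx
    simp_rw [← homothety_image_triangle, (AffineMap.homothety_injective p' ht0.ne').mem_set_image]
    exact hcount j y hy

/-- The multiplicity `m` is arbitrary because a segment may be shared by several flags. -/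
theorem segments {x y : E3} {x' y' : J → E3} (hx : ∀ j, ι j x = x' j) (hy : ∀ j, ι j y = y' j)
    (hne : x ≠ y) (hf : ∀ j, ConvexOn ℝ (segment ℝ (x' j) (y' j)) f) (hm0 : m ≠ 0)
    (hcount : ∀ j, ∀ z ∈ openSegment ℝ (x' j) (y' j), {k | z ∈ segment ℝ (x' k) (y' k)}.ncard = m) :
    IntegrableOn f (⋃ j, segment ℝ (x' j) (y' j)) μHE[1] ∧
      Avg 1 f (⋃ j, segment ℝ (x' j) (y' j)) = Avg 1 (symmetrize ι f) (segment ℝ x y) := by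
  have hseg : ∀ j, ι j '' segment ℝ x y = segment ℝ (x' j) (y' j) := fun j => by
    rw [image_segment_eq, hx, hy]
  have hint := fun j => integrableOn_segment hne
    (((hf j).comp_affineMap (ι j).toAffineEquiv.toAffineMap).subset
      (image_subset_iff.mp (hseg j).subset) (convex_segment x y))
  simp_rw [← hseg] at hcount ⊢
  refine ⟨integrableOn_iUnion_image hint, avg_iUnion_image
    (by rw [← convexHull_pair]; exact measurableSet_convexHull (by simp)) (segment_ae_eq hne)
    (measure_ne_top (integrableOn_segment hne (convexOn_const 1 (convex_segment x y)))) hm0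
    (fun j z hz => hcount j _ ?_) hint⟩
  rw [← hx, ← hy]
  exact map_mem_openSegment j hz

end FlagMaps

/-- A simplex congruent to the simplices spanned by the flags of a regular polyhedron. -/
theorem nondegenerate_reference {n : ℕ} {r h : ℝ} (hn : 3 ≤ n) (hr : 0 < r) (hh : 0 < h) :
    Nondegenerate 0 !₂[0, 0, h] !₂[r, 0, h]
      !₂[r * Real.cos (2 * Real.pi / n), r * Real.sin (2 * Real.pi / n), h] := by
  have hn' : (3 : ℝ) ≤ n := by exact_mod_cast hn
  have hpi := Real.pi_pos
  have hsin : 0 < Real.sin (2 * Real.pi / n) := by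
    refine Real.sin_pos_of_pos_of_lt_pi (by positivity) ?_
    rw [div_lt_iff₀ (by linarith)]
    nlinarith
  intro a b c h0
  have e0 := congrArg (fun x : E3 => x 0) h0
  have e1 := congrArg (fun x : E3 => x 1) h0
  have e2 := congrArg (fun x : E3 => x 2) h0
  simp [hr.ne', hsin.ne'] at e0 e1 e2
  subst e1
  simp [hr.ne'] at e0
  subst e0
  simp [hh.ne'] at e2
  exact ⟨e2, rfl, rfl⟩

/-- The standard frame is sent to the frame with origin `O`, third axis towards `c F` and first axis
towards vertex `i`. The reference points depend only on `n`, `r`, `H`, hence are the same for all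
flags. -/
theorem FaceData.exists_isometry {B : Set E3} {O : E3} {H : ℝ} {n : ℕ} {r : ℝ} {Φ : Type}
    {c u v : Φ → E3} (D : FaceData B O H n r c u v) (F : Φ) (i : ℕ) :
    ∃ e : E3 ≃ᵃⁱ[ℝ] E3, e 0 = O ∧ e !₂[0, 0, √H] = c F ∧
      e !₂[r, 0, √H] = polygonVertex n r (c F) (u F) (v F) i ∧
      e !₂[r * Real.cos (2 * Real.pi / n), r * Real.sin (2 * Real.pi / n), √H] =
        polygonVertex n r (c F) (u F) (v F) (i + 1) := by
  have P := D.frame F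
  have hh : √H ≠ 0 := (Real.sqrt_pos.mpr D.H_pos).ne'
  have hnorm : ‖c F - O‖ = √H := by rw [← D.norm_sq F, Real.sqrt_sq (norm_nonneg _)]
  set w := (√H)⁻¹ • (c F - O) with hw
  have hcO : √H • w = c F - O := by rw [hw, smul_smul, mul_inv_cancel₀ hh, one_smul]
  have hwn : ‖w‖ = 1 := by
    rw [hw, norm_smul, hnorm, norm_inv, Real.norm_of_nonneg (Real.sqrt_nonneg _),
      inv_mul_cancel₀ hh]
  set θ := 2 * Real.pi * i / n with hθ
  have hrot : ∃ b' : OrthonormalBasis (Fin 3) ℝ E3, b' 0 = Real.cos θ • u F + Real.sin θ • v F ∧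
      b' 1 = -Real.sin θ • u F + Real.cos θ • v F ∧ b' 2 = w := by
    have huu : inner ℝ (u F) (u F) = (1 : ℝ) := by rw [real_inner_self_eq_norm_sq, P.hu, one_pow]
    have hvv : inner ℝ (v F) (v F) = (1 : ℝ) := by rw [real_inner_self_eq_norm_sq, P.hv, one_pow]
    have huw : inner ℝ (u F) w = 0 := by
      rw [hw, inner_smul_right, real_inner_comm, D.inner_u, mul_zero]
    have hvw : inner ℝ (v F) w = 0 := by
      rw [hw, inner_smul_right, real_inner_comm, D.inner_v, mul_zero]
    have hvu : inner ℝ (v F) (u F) = 0 := by rw [real_inner_comm, P.huv]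
    have hsc := Real.sin_sq_add_cos_sq θ
    refine exists_orthonormalBasis ?_ ?_ hwn ?_ ?_ ?_
    · rw [norm_eq_sqrt_real_inner, Real.sqrt_eq_one]
      simp only [inner_add_left, inner_add_right, real_inner_smul_left, real_inner_smul_right,
        huu, hvv, hvu, P.huv]
      linear_combination hsc
    · rw [norm_eq_sqrt_real_inner, Real.sqrt_eq_one]
      simp only [inner_add_left, inner_add_right, real_inner_smul_left, real_inner_smul_right,
        huu, hvv, hvu, P.huv]
      linear_combination hsc
    · simp only [inner_add_left, inner_add_right, real_inner_smul_left, real_inner_smul_right,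
        huu, hvv, hvu, P.huv]
      ring
    · rw [inner_add_left, real_inner_smul_left, real_inner_smul_left, huw, hvw]
      ring
    · rw [inner_add_left, real_inner_smul_left, real_inner_smul_left, huw, hvw]
      ring
  obtain ⟨b', hb0, hb1, hb2⟩ := hrot
  set e : E3 ≃ᵃⁱ[ℝ] E3 := b'.repr.symm.toAffineIsometryEquiv.trans
    (AffineIsometryEquiv.constVAdd ℝ E3 O)
  have he : ∀ x, e x = O + (x 0 • b' 0 + x 1 • b' 1 + x 2 • w) := fun x => by
    change O + b'.repr.symm x = _
    rw [← OrthonormalBasis.sum_repr_symm, Fin.sum_univ_three, hb2]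
  have hc : c F = O + √H • w := by rw [hcO, add_sub_cancel]
  refine ⟨e, ?_, ?_, ?_, ?_⟩
  · simp [he]
  · simp [he, hc]
  · rw [he, hb0, polygonVertex, ← hθ]
    nth_rw 1 [hc]
    simp only [Matrix.cons_val]
    module
  · have hθ' : 2 * Real.pi * ((i + 1 : ℕ) : ℝ) / n = θ + 2 * Real.pi / n := by
      rw [hθ]
      push_cast
      ring
    rw [he, hb0, hb1, polygonVertex, hθ', Real.cos_add, Real.sin_add]
    nth_rw 1 [hc]
    simp only [Matrix.cons_val]
    module

end Platonic

/-! ### Assembly of the main theorem -/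

namespace Platonic

open Module Set

variable {B : Set E3} {O : E3} {R H : ℝ} {n : ℕ} {r : ℝ} {c u v : {F // IsFace 2 B F} → E3}

theorem finite_isFace (h : ∃ V : Set E3, V.Finite ∧ B = convexHull ℝ V) :
    Finite {F // IsFace 2 B F} := by
  obtain ⟨V, hV, hB⟩ := h
  exact ((finite_exposed hV hB).subset fun F hF => ⟨hF.1, hF.2.1⟩).to_subtype

namespace FaceData

theorem tetrahedron_subset_pyramid (D : FaceData B O H n r c u v)
    (hpoly : ∀ F, F.1 = polygon n r (c F) (u F) (v F)) (F : {F // IsFace 2 B F}) (k : ℕ) :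
    convexHull ℝ {O, c F, polygonVertex n r (c F) (u F) (v F) k,
      polygonVertex n r (c F) (u F) (v F) (k + 1)} ⊆ pyramid O F := by
  refine convexHull_mono (insert_subset_insert ?_)
  rw [hpoly F]
  exact (subset_convexHull ℝ _).trans (D.triangle_subset_polygon F k)

/-- Equal vertex degrees are needed here: otherwise the average over flags would weigh the segments
from `O` to the vertices unequally. -/
theorem exists_vertexDegree [Finite {F // IsFace 2 B F}] [Nonempty {F // IsFace 2 B F}]
    (D : FaceData B O H n r c u v) (hpoly : ∀ F, F.1 = polygon n r (c F) (u F) (v F))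
    (hdeg : ∃ q : ℕ, ∀ x ∈ B.extremePoints ℝ, {F : Set E3 | IsFace 2 B F ∧ x ∈ F}.ncard = q) :
    ∃ q : ℕ, q ≠ 0 ∧ ∀ (j : {F // IsFace 2 B F} × Fin n),
      ∀ y ∈ openSegment ℝ O (polygonVertex n r (c j.1) (u j.1) (v j.1) j.2),
      {k : {F // IsFace 2 B F} × Fin n |
        y ∈ segment ℝ O (polygonVertex n r (c k.1) (u k.1) (v k.1) k.2)}.ncard = q := by
  obtain ⟨q, hq⟩ := hdeg
  refine ⟨q, ?_, fun j y hy => ?_⟩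
  · obtain ⟨F⟩ := ‹Nonempty {F // IsFace 2 B F}›
    rw [← hq _ (D.vertex_mem_extremePoints hpoly F 0), ← ncard_faces hpoly]
    exact ncard_ne_zero_of_mem (a := F) (D.vertex_mem F 0)
  · have hx := D.vertex_mem_extremePoints hpoly j.1 j.2
    rw [D.ncard_vertexSegments hy fun G hG => D.exists_eq_vertex hx G hG, ncard_faces hpoly, hq _ hx]

end FaceData

end Platonic

open Platonic Set in
theorem mainTheorem4 (B : Set E3) (hB : Platonic.IsPlatonicSolid B)
    (O : E3) (R : ℝ) (hO : B.extremePoints ℝ ⊆ Metric.sphere O R)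
    (f : E3 → ℝ)
    (hf : ∀ F : Set E3, Platonic.IsFace 2 B F → ConvexOn ℝ (Platonic.pyramid O F) f) :
    -- the averages below are meaningful
    (IntegrableOn f B μHE[3] ∧
      IntegrableOn f (frontier B) μHE[2] ∧
      IntegrableOn f (⋃₀ Platonic.segmentsToCenters O B) μHE[1] ∧
      IntegrableOn f (⋃₀ Platonic.edges B) μHE[1] ∧
      IntegrableOn f (⋃₀ Platonic.segmentsToVertices O B) μHE[1] ∧
      IntegrableOn f (⋃₀ Platonic.segmentsCenterToVertex B) μHE[1] ∧
      IntegrableOn f (frontier (AffineMap.homothety O (3 / 4 : ℝ) '' B)) μHE[2]) ∧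
    -- the four inequalities
    Platonic.Avg 3 f B ≤ 1 / 4 * f O + 3 / 4 * Platonic.Avg 2 f (frontier B) ∧
    Platonic.Avg 3 f B ≤
      1 / 2 * Platonic.Avg 1 f (⋃₀ Platonic.segmentsToCenters O B) +
        1 / 2 * Platonic.Avg 1 f (⋃₀ Platonic.edges B) ∧
    Platonic.Avg 3 f B ≤
      1 / 2 * Platonic.Avg 1 f (⋃₀ Platonic.segmentsToVertices O B) +
        1 / 2 * Platonic.Avg 1 f (⋃₀ Platonic.segmentsCenterToVertex B) ∧
    Platonic.Avg 2 f (frontier (AffineMap.homothety O (3 / 4 : ℝ) '' B)) ≤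
      Platonic.Avg 3 f B := by
  have := finite_isFace hB.isPolytope
  have := Fintype.ofFinite {F // IsFace 2 B F}
  obtain ⟨F₀, hF₀⟩ := exists_isFace hB.isPolytope hB.interior_nonempty
  have : Nonempty {F // IsFace 2 B F} := ⟨⟨F₀, hF₀⟩⟩
  obtain ⟨n, r, H, c, u, v, D, hpoly, hR⟩ := exists_faceData hB hO
  have P := D.frame ⟨F₀, hF₀⟩
  have : Nonempty (Fin n) := ⟨⟨0, by have := P.hn; omega⟩⟩
  choose ι h0 hc hp hq using fun j : {F // IsFace 2 B F} × Fin n => D.exists_isometry j.1 j.2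
  have M : FlagMaps ι _ _ _ _ _ _ _ _ :=
    ⟨nondegenerate_reference P.hn P.hr (Real.sqrt_pos.mpr D.H_pos), h0, hc, hp, hq⟩
  have hconv := fun j : {F // IsFace 2 B F} × Fin n => (hf j.1 j.1.2).subset
    (D.tetrahedron_subset_pyramid hpoly j.1 j.2) (convex_convexHull ℝ _)
  have hseg := fun (j : {F // IsFace 2 B F} × Fin n) {x y : E3}
    (hx : x ∈ convexHull ℝ {O, c j.1, polygonVertex n r (c j.1) (u j.1) (v j.1) j.2,
      polygonVertex n r (c j.1) (u j.1) (v j.1) (j.2 + 1)})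
    (hy : y ∈ convexHull ℝ {O, c j.1, polygonVertex n r (c j.1) (u j.1) (v j.1) j.2,
      polygonVertex n r (c j.1) (u j.1) (v j.1) (j.2 + 1)}) =>
    (hconv j).subset ((convex_convexHull ℝ _).segment_subset hx hy) (convex_segment x y)
  have hmem := fun j : {F // IsFace 2 B F} × Fin n => subset_convexHull ℝ
    {O, c j.1, polygonVertex n r (c j.1) (u j.1) (v j.1) j.2,
      polygonVertex n r (c j.1) (u j.1) (v j.1) (j.2 + 1)}
  obtain ⟨q, hq0, hq⟩ := D.exists_vertexDegree hpoly hB.equal_vertex_degrees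
  have hn0 : n ≠ 0 := by have := P.hn; omega
  have S3 := M.solid hconv fun j x hx => D.ncard_tetrahedra hx
  have S2 := M.surface hconv fun j x hx => D.ncard_triangles hx
  have S2' := M.homothety_surface (t := 3 / 4) (by norm_num) (by norm_num) hconv
    fun j x hx => D.ncard_triangles hx
  have SO := FlagMaps.segments M.map_apex M.map_center M.nondegenerate.ne₁
    (fun j => hseg j (hmem j (by simp)) (hmem j (by simp))) hn0
    fun j x hx => D.ncard_centerSegments hx
  have SE := FlagMaps.segments M.map_left M.map_right M.nondegenerate.ne₂
    (fun j => hseg j (hmem j (by simp)) (hmem j (by simp))) two_ne_zero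
    fun j x hx => D.ncard_sides hx
  have SS := FlagMaps.segments M.map_apex M.map_left M.nondegenerate.swap.ne₁
    (fun j => hseg j (hmem j (by simp)) (hmem j (by simp))) hq0 hq
  have SD := FlagMaps.segments M.map_center M.map_right M.nondegenerate.swap.ne₂
    (fun j => hseg j (hmem j (by simp)) (hmem j (by simp))) one_ne_zero
    fun j x hx => D.ncard_centerVertexSegments hx
  -- All averages now refer to this one convex function on the reference simplex.
  have hsymm := convexOn_symmetrize (convex_convexHull ℝ _) (M.convexOn_comp hconv)
  rw [← D.eq_iUnion] at S3
  rw [← D.frontier_eq_iUnion] at S2 S2'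
  rw [← frontier_image_homothety O (by norm_num)] at S2'
  rw [← D.sUnion_segmentsToCenters hpoly hO] at SO
  rw [← D.sUnion_edges hpoly hB.interior_nonempty] at SE
  rw [← D.sUnion_segmentsToVertices hpoly hR hO] at SS
  rw [← D.sUnion_segmentsCenterToVertex hpoly hO] at SD
  refine ⟨⟨S3.1, S2.1, SO.1, SE.1, SS.1, SD.1, S2'.1⟩, ?_, ?_, ?_, ?_⟩
  · rw [S3.2, S2.2, ← M.symmetrize_apex (f := f)]
    exact avg_tetrahedron_le_cone M.nondegenerate hsymm
  · rw [S3.2, SO.2, SE.2]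
    exact avg_tetrahedron_le_join M.nondegenerate hsymm
  · rw [S3.2, SS.2, SD.2]
    -- Reorders the vertices so that the opposite edges are apex–left vertex and center–right
    -- vertex.
    rw [insert_comm (!₂[0, 0, √H] : E3)] at hsymm ⊢
    exact avg_tetrahedron_le_join M.nondegenerate.swap hsymm
  · rw [S3.2, S2'.2]
    exact avg_homothety_le_avg_tetrahedron M.nondegenerate hsymm
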